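/- Notation. Let $\mathfrak S_n$ be the set of permutations of $[n]=\{1,\dots,n\}$. The cycle type of a permutation of $[n]$ is $t=(t_1,\dots,t_n)$, where $t_p$ is its number of $p$-cycles (so $\sum_p p\,t_p=n$, and $t$ is said to have size $n$); a uniform $t$-cyclic permutation is a uniformly random element of the set of permutations with cycle type $t$. For $\tau\in\mathfrak S_n$ and $\pi\in\mathfrak S_r$, let $X_\pi(\tau)$ be the number of subsets $\{i_1<\dots<i_r\}$ of $[n]$ such that, for all $j,k\in[r]$, $\pi(j)>\pi(k)\iff\tau(i_j)>\tau(i_k)$. For points $z_1,\dots,z_r$ of the plane with distinct $x$-coordinates and distinct $y$-coordinates, let $\mathrm{perm}(z_1,\dots,z_r)\in\mathfrak S_r$ be the permutation that maps $i$ to $j$ when the $i$-th point from the left is the $j$-th point from the bottom. For $\pi\in\mathfrak S_r$ and $z\in[0,1]^2$ let $$\psi_\pi(z)=\mathbf P\big(\mathrm{perm}(\hat Z_1,\dots,\hat Z_{r-1},z)=\pi\big),$$ where $\hat Z_1,\dots,\hat Z_{r-1}$ are i.i.d. uniform in $[0,1]^2$. For $p_2\in[0,1]$ let $\Sigma^{p_2}=(\Sigma^{p_2}_{\pi,\rho})_{\pi,\rho\in\mathfrak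 S_r}$ be defined by $$(r-1)!^2\,\Sigma^{p_2}_{\pi,\rho}=\mathrm{Cov}\big(\psi_\pi(U,V),\psi_\rho(U,V)\big)+p_2\,\mathrm{Cov}\big(\psi_\pi(U,V),\psi_\rho(V,U)\big),$$ where $U,V$ are i.i.d. uniform on $[0,1]$. Theorem. Let $r\ge1$ be an integer and let $p_2\in[0,1]$. (1) For each $n$ let $t^{(n)}$ be a cycle type of size $n$, such that $t^{(n)}_1=o(\sqrt n)$ and $2t^{(n)}_2=np_2+o(n)$ as $n\to\infty$, and let $\tau_n$ be a uniform $t^{(n)}$-cyclic permutation. Then, as $n\to\infty$, the following convergence in distribution of random vectors holds: $$\left(\frac{X_\pi(\tau_n)-\binom nr\frac1{r!}}{n^{r-1/2}}\right)_{\pi\in\mathfrak S_r}\longrightarrow\mathcal N\big(0,\Sigma^{p_2}\big),$$ where $\mathcal N(0,\Sigma^{p_2})$ is the (possibly degenerate) centered Gaussian distribution on $\mathbb R^{\mathfrak S_r}$ with covariance matrix $\Sigma^{p_2}$; in particular, $\Sigma^{p_2}$ is symmetric positive semidefinite. (2) The matrix $\Sigma^{p_2}$ has rank $(r-1)^2$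 if $p_2<1$, and rank $r(r-1)/2$ if $p_2=1$. (3) If $r\ge2$, then $\Sigma^{p_2}_{\pi,\pi}>0$ for every $\pi\in\mathfrak S_r$. -/

import Mathlib

namespace PatternCLT

/-- Standardization of a sequence of pairwise distinct numbers: the permutation `τ` with
`τ i < τ j ↔ y i < y j` (see `st_lt_st_iff`; ties, if any, are broken by index). -/
def st {n : ℕ} {α : Type*} [LinearOrder α] (y : Fin n → α) : Equiv.Perm (Fin n) :=
  (Tuple.sort y)⁻¹

theorem st_lt_st_iff {n : ℕ} {α : Type*} [LinearOrder α] {y : Fin n → α}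
    (hy : Function.Injective y) (i j : Fin n) : st y i < st y j ↔ y i < y j := by
  have h : StrictMono (y ∘ Tuple.sort y) :=
    (Tuple.monotone_sort y).strictMono_of_injective (hy.comp (Tuple.sort y).injective)
  have := h.lt_iff_lt (a := st y i) (b := st y j)
  simpa [st] using this.symm

/-- The permutation of a family of points of the plane with distinct x-coordinates and distinct
y-coordinates: it maps `i` to `j` when the `i`-th point from the left is the `j`-th point from
the bottom. -/
noncomputable def perm {n : ℕ} (z : Fin n → ℝ × ℝ) : Equiv.Perm (Fin n) :=
  st fun i => (z (Tuple.sort (fun k => (z k).1) i)).2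

/-- The pattern induced by `τ` on an `r`-element set `I` of positions. -/
def pat {n r : ℕ} (τ : Equiv.Perm (Fin n)) (I : Finset (Fin n)) (hI : I.card = r) :
    Equiv.Perm (Fin r) :=
  st fun j => τ (I.orderEmbOfFin hI j)

/-- The number of `r`-element sets of positions on which `τ` induces the pattern `π`. -/
def patternCount {n r : ℕ} (π : Equiv.Perm (Fin r)) (τ : Equiv.Perm (Fin n)) : ℕ :=
  (Finset.univ.filter fun I : Finset (Fin n) => ∃ hI : I.card = r, pat τ I hI = π).card

/-- Permutations form a finite set: every subset is measurable. -/
instance instMeasurableSpacePerm (n : ℕ) : MeasurableSpace (Equiv.Perm (Fin n)) := ⊤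

/-- The permutations of cycle type `t`. A cycle type of size `n` is encoded as the partition of
`n` into the cycle lengths (fixed points included), so that `t_p = t.parts.count p`. -/
def cyclicPerms {n : ℕ} (t : n.Partition) : Set (Equiv.Perm (Fin n)) :=
  {σ | σ.partition.parts = t.parts}

/-- The uniform distribution on `𝔖_n` restricted to the permutations of cycle type `t`. -/
noncomputable def uniformCyclic {n : ℕ} (t : n.Partition) :
    MeasureTheory.Measure (Equiv.Perm (Fin n)) :=
  ProbabilityTheory.uniformOn (cyclicPerms t)

/-- The uniform distribution on `[0,1]`. -/
noncomputable def unif : MeasureTheory.Measure ℝ :=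
  MeasureTheory.volume.restrict (Set.Icc 0 1)

/-- The uniform distribution on `[0,1]²`, that is, the law of `(U, V)`. -/
noncomputable def unifSq : MeasureTheory.Measure (ℝ × ℝ) := unif.prod unif

/-- `ψ_π(z)`: the probability that `r - 1` i.i.d. uniform points of `[0,1]²` together with `z`
form the permutation `π ∈ 𝔖_r` (for `r ≥ 1`; the points are listed as `Z_1, …, Z_{r-1}, z`). -/
noncomputable def psi {r : ℕ} (π : Equiv.Perm (Fin r)) (z : ℝ × ℝ) : ℝ :=
  (MeasureTheory.Measure.pi fun _ : Fin (r - 1) => unifSq).real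
    {Z | perm (fun i : Fin r => if h : (i : ℕ) < r - 1 then Z ⟨i, h⟩ else z) = π}

open ProbabilityTheory in
/-- The limiting covariance matrix `Σ^{p₂}`. -/
noncomputable def sigma (r : ℕ) (p₂ : ℝ) : Matrix (Equiv.Perm (Fin r)) (Equiv.Perm (Fin r)) ℝ :=
  Matrix.of fun π ρ =>
    (cov[fun z => psi π z, fun z => psi ρ z; unifSq] +
      p₂ * cov[fun z => psi π z, fun z => psi ρ z.swap; unifSq]) / ((r - 1).factorial : ℝ) ^ 2

/-- The rescaled vector `((X_π(τ) - C(n,r)/r!) / n^{r-1/2})_{π ∈ 𝔖_r}`. -/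
noncomputable def normalizedCounts (r : ℕ) {n : ℕ} (τ : Equiv.Perm (Fin n)) :
    EuclideanSpace ℝ (Equiv.Perm (Fin r)) :=
  WithLp.toLp 2 fun π =>
    ((patternCount π τ : ℝ) - (n.choose r : ℝ) / (r.factorial : ℝ)) /
      (n : ℝ) ^ ((r : ℝ) - 1 / 2)

end PatternCLT

/-!
Let `U` be a family of i.i.d. uniform points of `[0,1]` and let `σ` be a fixed permutation of cycle
type `t`. The standardization of `U` is a uniform permutation, so conjugating `σ` by it gives a
uniform `t`-cyclic permutation, whose pattern counts are read off from the patterns formed by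
`r`-tuples of *arcs* `(U i, U (σ i))`. Unless two arcs meet, such a tuple consists of `r`
independent uniform points of the square, so a linear combination of pattern counts is a
`U`-statistic up to the influence of the cycle structure. As for a `U`-statistic, one subtracts the
projections to single arcs; in the second moment of what is left, only pairs of tuples with two
meetings contribute, so it is negligible, while the fixed points matter only at order
`t₁ n^(r-1) = o(n^(r-1/2))`.

There remains `∑ g(U i, U (σ i))` with `g` centered in each variable. Revealing the vertices one
by one turns it into a sum of martingale differences, and its characteristic function is compared
with the Gaussian one through `exp (i x) ≈ (1 + i x) exp (-x² / 2)`, the product of the factors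
`1 + i x` having expectation one. Distinct arcs are uncorrelated except for the two arcs of a
2-cycle, which produce the term with the factor `p₂`.

Conditionally on its coordinates `(x, y)`, a uniform point placed among `r - 1` others has ranks
with independent binomial distributions, so `ψ_π` is, up to a constant, the bilinear form of the
permutation matrix of `π` in the Bernstein polynomials of degree `r - 1`. As these are linearly
independent, `Σ` is the Gram matrix of the centered permutation matrices for a form that is positive
definite unless `p₂ = 1`; its rank is then the dimension `(r - 1)²` of the space of matrices with
vanishing row and column sums, which they span by Birkhoff's theorem. If `p₂ = 1` only the symmetric
part of the matrices counts.
-/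

namespace PatternCLT

open MeasureTheory ProbabilityTheory Filter Topology
open Equiv (Perm)
open Function (Injective)
open scoped Finset

section Standardization

variable {n r : ℕ} {α β γ δ : Type*} [LinearOrder α] [LinearOrder β] [LinearOrder γ]
  [LinearOrder δ]

lemma st_eq_of_lt_iff {y : Fin n → α} (hy : Injective y) {σ : Perm (Fin n)}
    (h : ∀ i j, σ i < σ j ↔ y i < y j) : st y = σ := by
  have hmono : StrictMono (st y ∘ σ.symm) := fun i j hij => by
    simpa only [Function.comp_apply, st_lt_st_iff hy, ← h, Equiv.apply_symm_apply] using hij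
  have hid : st y ∘ σ.symm = id := (hmono.range_inj strictMono_id).1 <| by
    rw [((st y).surjective.comp σ.symm.surjective).range_eq, Set.range_id]
  ext i
  simpa using congrArg Fin.val (congrFun hid (σ i))

lemma st_comp_perm {y : Fin n → α} (hy : Injective y) (e : Perm (Fin n)) :
    st (y ∘ e) = st y * e :=
  st_eq_of_lt_iff (hy.comp e.injective) fun i j => by simp [st_lt_st_iff hy]

lemma st_congr {y : Fin n → α} {z : Fin n → β} (hy : Injective y)
    (h : ∀ i j, y i < y j ↔ z i < z j) : st y = st z := by
  have hz : Injective z := fun i j hij => by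
    have hle : ∀ k l, y k ≤ y l ↔ z k ≤ z l := fun k l => by simpa using not_congr (h l k)
    exact hy (le_antisymm ((hle i j).2 hij.le) ((hle j i).2 hij.ge))
  exact st_eq_of_lt_iff hy fun i j => by rw [h, st_lt_st_iff hz]

lemma st_eq_one_of_strictMono {y : Fin n → α} (hy : StrictMono y) : st y = 1 :=
  st_eq_of_lt_iff hy.injective fun i j => by simp [hy.lt_iff_lt]

lemma val_st_apply {y : Fin n → α} (hy : Injective y) (b : Fin n) :
    (st y b : ℕ) = #{j | y j < y b} := by
  have hmap : ({j | y j < y b} : Finset (Fin n)).map (st y).toEmbedding =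
      Finset.Iio (st y b) := by
    ext k
    simp only [Finset.mem_map_equiv, Finset.mem_filter, Finset.mem_univ, true_and,
      Finset.mem_Iio, ← st_lt_st_iff hy, Equiv.apply_symm_apply]
  rw [← Finset.card_map (st y).toEmbedding, hmap, Fin.card_Iio]

/-- The permutation that maps the rank of `x i` to the rank of `y i`: the permutation formed by
the points `(x i, y i)`, in whatever order they are listed. -/
def relPerm (x : Fin r → α) (y : Fin r → β) : Perm (Fin r) := st y * (st x)⁻¹

lemma relPerm_comp_perm {x : Fin r → α} {y : Fin r → β} (hx : Injective x) (hy : Injective y)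
    (e : Perm (Fin r)) : relPerm (x ∘ e) (y ∘ e) = relPerm x y := by
  rw [relPerm, relPerm, st_comp_perm hx, st_comp_perm hy]
  group

lemma relPerm_congr {x : Fin r → α} {y : Fin r → β} {x' : Fin r → γ} {y' : Fin r → δ}
    (hx : Injective x) (hy : Injective y) (hxx' : ∀ i j, x i < x j ↔ x' i < x' j)
    (hyy' : ∀ i j, y i < y j ↔ y' i < y' j) : relPerm x y = relPerm x' y' := by
  rw [relPerm, relPerm, st_congr hx hxx', st_congr hy hyy']

lemma perm_eq_relPerm {z : Fin n → ℝ × ℝ} (hy : Injective fun i => (z i).2) :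
    perm z = relPerm (fun i => (z i).1) fun i => (z i).2 := by
  change st ((fun i => (z i).2) ∘ Tuple.sort fun k => (z k).1) = _
  rw [st_comp_perm hy]
  simp [relPerm, st]

end Standardization

section PatternsOfTuples

variable {n r : ℕ}

/-- An injective tuple is a set of entries together with the order in which they are listed. -/
def setPermEquivInjective (n r : ℕ) :
    {I : Finset (Fin n) // #I = r} × Perm (Fin r) ≃ {f : Fin r → Fin n // Injective f} where
  toFun q := ⟨q.1.1.orderEmbOfFin q.1.2 ∘ q.2,
    (q.1.1.orderEmbOfFin q.1.2).injective.comp q.2.injective⟩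
  invFun f := (⟨Finset.univ.image f.1, by simp [Finset.card_image_of_injective _ f.2]⟩, st f.1)
  left_inv := by
    rintro ⟨⟨I, hI⟩, e⟩
    refine Prod.ext (Subtype.ext ?_) ?_
    · apply Finset.coe_injective
      simp only [Finset.coe_image, Finset.coe_univ, Set.image_univ, e.surjective.range_comp,
        Finset.range_orderEmbOfFin]
    · simp [st_comp_perm (I.orderEmbOfFin hI).injective,
        st_eq_one_of_strictMono (I.orderEmbOfFin hI).strictMono]
  right_inv := by
    rintro ⟨f, hf⟩
    have hcard : #(Finset.univ.image f) = r := by simp [Finset.card_image_of_injective _ hf]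
    have hsorted : f ∘ (st f).symm = (Finset.univ.image f).orderEmbOfFin hcard :=
      Finset.orderEmbOfFin_unique hcard (by simp) fun i j hij => by
        simpa only [Function.comp_apply, ← st_lt_st_iff hf, Equiv.apply_symm_apply] using hij
    ext a
    simp [← hsorted]

lemma relPerm_orderEmbOfFin_comp (τ : Perm (Fin n)) {I : Finset (Fin n)} (hI : #I = r)
    (e : Perm (Fin r)) :
    relPerm (I.orderEmbOfFin hI ∘ e) (τ ∘ I.orderEmbOfFin hI ∘ e) = pat τ I hI := by
  have hinj := (I.orderEmbOfFin hI).injective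
  rw [← Function.comp_assoc, relPerm_comp_perm hinj (τ.injective.comp hinj), relPerm,
    st_eq_one_of_strictMono (I.orderEmbOfFin hI).strictMono, inv_one, mul_one]
  rfl

variable {M : Type*} [AddCommMonoid M]

lemma sum_relPerm_eq_factorial_smul_sum_pat (τ : Perm (Fin n)) (H : Perm (Fin r) → M) :
    ∑ f : Fin r → Fin n with Injective f, H (relPerm f (τ ∘ f)) =
      r.factorial • ∑ I : {I : Finset (Fin n) // #I = r}, H (pat τ I.1 I.2) := by
  rw [Finset.sum_subtype (p := Injective) _ (by simp),
    ← (setPermEquivInjective n r).sum_comp, Fintype.sum_prod_type, Finset.smul_sum]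
  refine Finset.sum_congr rfl fun I _ => ?_
  refine (Finset.sum_congr rfl fun e _ =>
    congrArg H (relPerm_orderEmbOfFin_comp τ I.2 e)).trans ?_
  rw [Finset.sum_const, Finset.card_univ, Fintype.card_perm, Fintype.card_fin]

lemma card_pat_eq_patternCount (τ : Perm (Fin n)) (π : Perm (Fin r)) :
    #{I : {I : Finset (Fin n) // #I = r} | pat τ I.1 I.2 = π} = patternCount π τ := by
  refine Finset.card_nbij Subtype.val (fun I hI => ?_) Subtype.val_injective.injOn fun I hI => ?_
  · have hpat : pat τ I.1 I.2 = π := by simpa using hI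
    simpa using ⟨I.2, hpat⟩
  · obtain ⟨hcard, hpat⟩ : ∃ hI, pat τ I hI = π := by simpa using hI
    exact ⟨⟨I, hcard⟩, by simpa using hpat, rfl⟩

lemma sum_pat_eq_sum_patternCount_smul (τ : Perm (Fin n)) (H : Perm (Fin r) → M) :
    ∑ I : {I : Finset (Fin n) // #I = r}, H (pat τ I.1 I.2) = ∑ π, patternCount π τ • H π := by
  rw [← Finset.sum_fiberwise (s := Finset.univ)
    (g := fun I : {I : Finset (Fin n) // #I = r} => pat τ I.1 I.2)]
  refine Finset.sum_congr rfl fun π _ => ?_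
  rw [Finset.sum_congr rfl fun I hI => congrArg H (Finset.mem_filter.1 hI).2, Finset.sum_const,
    card_pat_eq_patternCount]

lemma card_injective_tuples :
    #{f : Fin r → Fin n | Injective f} = r.factorial * n.choose r := by
  classical
  rw [← Fintype.card_subtype, Fintype.card_congr (Equiv.subtypeInjectiveEquivEmbedding _ _),
    Fintype.card_embedding_eq, Fintype.card_fin, Fintype.card_fin,
    Nat.descFactorial_eq_factorial_mul_choose]

/-- The pattern formed by the points `(U i, U (σ i))`, where `i` runs through the tuple `f`. -/
def arcPattern {ι α : Type*} [LinearOrder α] (σ : Perm ι) (f : Fin r → ι) (U : ι → α) :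
    Perm (Fin r) :=
  relPerm (fun a => U (f a)) fun a => U (σ (f a))

lemma relPerm_conj_st {α : Type*} [LinearOrder α] {U : Fin n → α} (hU : Injective U)
    (σ : Perm (Fin n)) {f : Fin r → Fin n} (hf : Injective f) :
    relPerm (st U ∘ f) ((st U * σ * (st U)⁻¹) ∘ st U ∘ f) = arcPattern σ f U :=
  relPerm_congr ((Equiv.injective _).comp hf)
    ((Equiv.injective _).comp ((Equiv.injective _).comp hf))
    (fun i j => by simp [st_lt_st_iff hU]) fun i j => by simp [st_lt_st_iff hU]

lemma sum_relPerm_conj_st {α : Type*} [LinearOrder α] {U : Fin n → α} (hU : Injective U)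
    (σ : Perm (Fin n)) (H : Perm (Fin r) → M) :
    ∑ f : Fin r → Fin n with Injective f, H (relPerm f ((st U * σ * (st U)⁻¹) ∘ f)) =
      ∑ f : Fin r → Fin n with Injective f, H (arcPattern σ f U) := by
  symm
  refine Finset.sum_equiv (Equiv.piCongrRight fun _ => st U) (fun f => ?_) fun f hf => ?_
  · simp only [Finset.mem_filter, Finset.mem_univ, true_and]
    exact ((st U).injective.of_comp_iff f).symm
  · rw [← relPerm_conj_st hU σ (by simpa using hf)]
    rfl

/-- The mean of `H` under the uniform distribution. -/
noncomputable def permMean (H : Perm (Fin r) → ℝ) : ℝ := (∑ π, H π) / r.factorial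

lemma sum_mul_patternCount_conj_sub {α : Type*} [LinearOrder α] {U : Fin n → α}
    (hU : Injective U) (σ : Perm (Fin n)) (H : Perm (Fin r) → ℝ) :
    (r.factorial : ℝ) * ∑ π, H π *
        ((patternCount π (st U * σ * (st U)⁻¹) : ℝ) - (n.choose r : ℝ) / (r.factorial : ℝ)) =
      ∑ f : Fin r → Fin n with Injective f, (H (arcPattern σ f U) - permMean H) := by
  have hr : (r.factorial : ℝ) ≠ 0 := by positivity
  rw [Finset.sum_sub_distrib, ← sum_relPerm_conj_st hU, sum_relPerm_eq_factorial_smul_sum_pat,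
    sum_pat_eq_sum_patternCount_smul, Finset.sum_const, card_injective_tuples, permMean]
  simp only [mul_sub, Finset.sum_sub_distrib, ← Finset.sum_mul, nsmul_eq_mul, Nat.cast_mul,
    mul_comm (H _) (patternCount _ _ : ℝ)]
  field_simp

end PatternsOfTuples

section CycleType

variable {n : ℕ} {α : Type*} [Fintype α] [DecidableEq α]

lemma filter_two_le_add_replicate_one (t : n.Partition) :
    t.parts.filter (2 ≤ ·) + .replicate (n - (t.parts.filter (2 ≤ ·)).sum) 1 = t.parts := by
  have hones : t.parts.filter (fun a => ¬ 2 ≤ a) =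
      .replicate (t.parts.filter fun a => ¬ 2 ≤ a).card 1 := by
    refine Multiset.eq_replicate_card.2 fun a ha => ?_
    obtain ⟨hat, ha2⟩ := Multiset.mem_filter.1 ha
    have := t.parts_pos hat
    lia
  have hsum := t.parts_sum
  rw [← Multiset.filter_add_not (2 ≤ ·) t.parts, Multiset.sum_add, hones,
    Multiset.sum_replicate, smul_eq_mul, mul_one] at hsum
  conv_rhs => rw [← Multiset.filter_add_not (2 ≤ ·) t.parts, hones]
  congr 2
  lia

lemma exists_perm_partition_parts_eq (t : n.Partition) :
    ∃ σ : Perm (Fin n), σ.partition.parts = t.parts := by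
  obtain ⟨σ, hσ⟩ : ∃ σ : Perm (Fin n), σ.cycleType = t.parts.filter (2 ≤ ·) := by
    refine (Equiv.Perm.exists_with_cycleType_iff _).2 ⟨?_, fun a ha => (Multiset.mem_filter.1 ha).2⟩
    have hsum := t.parts_sum
    rw [← Multiset.filter_add_not (2 ≤ ·) t.parts, Multiset.sum_add] at hsum
    rw [Fintype.card_fin]
    lia
  refine ⟨σ, ?_⟩
  rw [Equiv.Perm.parts_partition, ← σ.sum_cycleType, hσ, Fintype.card_fin,
    filter_two_le_add_replicate_one]

lemma count_one_partition (σ : Perm α) : σ.partition.parts.count 1 = #{i | σ i = i} := by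
  have hcycle : σ.cycleType.count 1 = 0 :=
    Multiset.count_eq_zero.2 fun h => absurd (Equiv.Perm.two_le_of_mem_cycleType h) (by simp)
  rw [Equiv.Perm.parts_partition, Multiset.count_add, hcycle, Multiset.count_replicate_self,
    zero_add, ← Finset.card_compl]
  congr 1
  ext i
  simp

lemma swap_mem_cycleFactorsFinset {σ : Perm α} {i : α} (hi : σ i ≠ i) (hi2 : σ (σ i) = i) :
    Equiv.swap i (σ i) ∈ σ.cycleFactorsFinset := by
  refine Equiv.Perm.mem_cycleFactorsFinset_iff.2 ⟨Equiv.Perm.isCycle_swap hi.symm, ?_⟩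
  simp [Equiv.Perm.support_swap hi.symm, hi2]

lemma filter_sq_fixed_eq_biUnion_support (σ : Perm α) :
    ({i | σ i ≠ i ∧ σ (σ i) = i} : Finset α) =
      {c ∈ σ.cycleFactorsFinset | 2 = #c.support}.biUnion Equiv.Perm.support := by
  ext i
  simp only [Finset.mem_filter, Finset.mem_univ, true_and, Finset.mem_biUnion]
  constructor
  · rintro ⟨hi, hi2⟩
    exact ⟨Equiv.swap i (σ i), ⟨swap_mem_cycleFactorsFinset hi hi2,
      (Equiv.Perm.card_support_swap hi.symm).symm⟩, by simp [Equiv.Perm.support_swap hi.symm]⟩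
  · rintro ⟨c, ⟨hc, hcard⟩, hi⟩
    obtain ⟨hcycle, hσ⟩ := Equiv.Perm.mem_cycleFactorsFinset_iff.1 hc
    have hc2 : c ^ 2 = 1 := by rw [hcard, ← hcycle.orderOf, pow_orderOf_eq_one]
    rw [← hσ i hi, ← hσ _ (Equiv.Perm.apply_mem_support.2 hi), ← Equiv.Perm.mul_apply, ← sq, hc2]
    exact ⟨Equiv.Perm.mem_support.1 hi, rfl⟩

lemma two_mul_count_two_partition (σ : Perm α) :
    2 * σ.partition.parts.count 2 = #{i | σ i ≠ i ∧ σ (σ i) = i} := by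
  rw [Equiv.Perm.parts_partition, Multiset.count_add, Multiset.count_replicate,
    if_neg (by norm_num), add_zero, Equiv.Perm.cycleType_def, Multiset.count_map,
    filter_sq_fixed_eq_biUnion_support, Finset.card_biUnion]
  · rw [Finset.sum_congr rfl fun c hc => (Finset.mem_filter.1 hc).2.symm, Finset.sum_const,
      smul_eq_mul, mul_comm]
    rfl
  · intro c hc d hd hcd
    exact (Equiv.Perm.cycleFactorsFinset_pairwise_disjoint σ (Finset.mem_filter.1 hc).1
      (Finset.mem_filter.1 hd).1 hcd).disjoint_support

end CycleType

section ProductMeasures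

variable {ι κ : Type*} [Fintype ι] [Fintype κ] {X : ι → Type*} [∀ i, MeasurableSpace (X i)]
  (μ : ∀ i, Measure (X i)) [∀ i, IsProbabilityMeasure (μ i)]

lemma iIndepFun_eval_pi : iIndepFun (fun i (x : ∀ i, X i) => x i) (Measure.pi μ) :=
  iIndepFun_pi (X := fun i (x : X i) => x) fun _ => aemeasurable_id

lemma measurePreserving_comp_injective_pi {e : κ → ι} (he : Injective e) :
    MeasurePreserving (fun (x : ∀ i, X i) k => x (e k)) (Measure.pi μ)
      (Measure.pi fun k => μ (e k)) := by
  refine ⟨by fun_prop, ?_⟩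
  have hindep := (iIndepFun_eval_pi μ).precomp he
  rw [iIndepFun_iff_map_fun_eq_pi_map fun k => (measurable_pi_apply _).aemeasurable] at hindep
  simpa only [(measurePreserving_eval μ _).map_eq] using hindep

lemma measurePreserving_pair_pi {i j : ι} (hij : i ≠ j) :
    MeasurePreserving (fun x : ∀ i, X i => (x i, x j)) (Measure.pi μ) ((μ i).prod (μ j)) := by
  refine ⟨by fun_prop, ?_⟩
  have hindep := (iIndepFun_eval_pi μ).indepFun hij
  rwa [indepFun_iff_map_prod_eq_prod_map_map (measurable_pi_apply _).aemeasurable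
    (measurable_pi_apply _).aemeasurable, (measurePreserving_eval μ i).map_eq,
    (measurePreserving_eval μ j).map_eq] at hindep

variable [DecidableEq ι]

lemma measurePreserving_piecewise_pi (T : Finset ι) :
    MeasurePreserving (fun p : (∀ i, X i) × (∀ i, X i) => T.piecewise p.2 p.1)
      ((Measure.pi μ).prod (Measure.pi μ)) (Measure.pi μ) := by
  have hm : Measurable fun p : (∀ i, X i) × (∀ i, X i) => T.piecewise p.2 p.1 := by
    refine measurable_pi_lambda _ fun i => ?_
    by_cases hi : i ∈ T <;> simp only [Finset.piecewise, hi, if_true, if_false] <;> fun_prop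
  refine ⟨hm, (Measure.pi_eq fun s hs => ?_).symm⟩
  have hpre : (fun p : (∀ i, X i) × (∀ i, X i) => T.piecewise p.2 p.1) ⁻¹' Set.univ.pi s =
      (Set.univ.pi fun i => if i ∈ T then Set.univ else s i) ×ˢ
        (Set.univ.pi fun i => if i ∈ T then s i else Set.univ) := by
    ext p
    simp only [Set.mem_preimage, Set.mem_pi, Set.mem_univ, true_imp_iff, Set.mem_prod,
      ← forall_and]
    refine forall_congr' fun i => ?_
    by_cases hi : i ∈ T <;> simp [hi]
  rw [Measure.map_apply hm (MeasurableSet.univ_pi hs), hpre, Measure.prod_prod, Measure.pi_pi,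
    Measure.pi_pi, ← Finset.prod_mul_distrib]
  refine Finset.prod_congr rfl fun i _ => ?_
  by_cases hi : i ∈ T <;> simp [hi]

-- Resampling the coordinates in `T` does not change the law of the point, and `φ` factors out of
-- the average over the resampled coordinates.
lemma integral_mul_eq_zero_of_integral_piecewise_eq_zero {𝕜 : Type*} [RCLike 𝕜] (T : Finset ι)
    {φ R : (∀ i, X i) → 𝕜} (hφ : ∀ x y, φ (T.piecewise y x) = φ x)
    (hint : Integrable (fun x => φ x * R x) (Measure.pi μ))
    (hR : ∀ᵐ x ∂Measure.pi μ, ∫ y, R (T.piecewise y x) ∂Measure.pi μ = 0) :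
    ∫ x, φ x * R x ∂Measure.pi μ = 0 := by
  have hp := measurePreserving_piecewise_pi μ T
  have hint' : Integrable (fun p : (∀ i, X i) × (∀ i, X i) =>
      φ (T.piecewise p.2 p.1) * R (T.piecewise p.2 p.1)) ((Measure.pi μ).prod (Measure.pi μ)) :=
    hp.integrable_comp_of_integrable hint
  calc ∫ x, φ x * R x ∂Measure.pi μ
      = ∫ p : (∀ i, X i) × (∀ i, X i), φ (T.piecewise p.2 p.1) * R (T.piecewise p.2 p.1)
          ∂(Measure.pi μ).prod (Measure.pi μ) := by
        conv_lhs => rw [← hp.map_eq]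
        exact integral_map hp.measurable.aemeasurable (by rw [hp.map_eq]; exact hint.1)
    _ = ∫ x, φ x * ∫ y, R (T.piecewise y x) ∂Measure.pi μ ∂Measure.pi μ := by
        rw [integral_prod _ hint']
        simp only [hφ, integral_const_mul]
    _ = 0 := by
        refine integral_eq_zero_of_ae ?_
        filter_upwards [hR] with x hx
        rw [hx, mul_zero, Pi.zero_apply]

lemma ae_fst_ne_snd_prod {Y : Type*} [MeasurableSpace Y] [MeasurableEq Y] (μ ν : Measure Y)
    [SFinite ν] [NullSingletonClass ν] : ∀ᵐ z ∂μ.prod ν, z.1 ≠ z.2 := by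
  have hdiag : MeasurableSet {z : Y × Y | z.1 = z.2} :=
    measurableSet_eq_fun measurable_fst measurable_snd
  have hslice : ∀ x : Y, Prod.mk x ⁻¹' {z : Y × Y | z.1 = z.2} = {x} := fun x => by
    ext y
    simp [eq_comm]
  simp only [ae_iff, ne_eq, not_not]
  rw [Measure.measure_prod_null hdiag]
  exact ae_of_all _ fun x => by simp [hslice x]

end ProductMeasures

section UniformPoints

instance : IsProbabilityMeasure unif := ⟨by simp [unif]⟩

instance : NullSingletonClass unif := by unfold unif; infer_instance

instance : IsProbabilityMeasure unifSq := by unfold unifSq; infer_instance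

/-- The law of a family of i.i.d. uniform points of `[0,1]` indexed by `ι`. -/
noncomputable abbrev unifPi (ι : Type*) [Fintype ι] : Measure (ι → ℝ) := Measure.pi fun _ => unif

variable {ι κ : Type*} [Fintype ι] [Fintype κ]

lemma measurePreserving_comp_injective {e : κ → ι} (he : Injective e) :
    MeasurePreserving (fun (U : ι → ℝ) k => U (e k)) (unifPi ι) (unifPi κ) :=
  measurePreserving_comp_injective_pi (fun _ => unif) he

lemma measurePreserving_pair {i j : ι} (hij : i ≠ j) :
    MeasurePreserving (fun U : ι → ℝ => (U i, U j)) (unifPi ι) unifSq :=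
  measurePreserving_pair_pi (fun _ => unif) hij

lemma ae_injective_unifPi : ∀ᵐ U ∂unifPi ι, Injective U := by
  have hne : ∀ i j : ι, ∀ᵐ U ∂unifPi ι, U i = U j → i = j := fun i j => by
    by_cases hij : i = j
    · exact ae_of_all _ fun _ _ => hij
    · filter_upwards [(measurePreserving_pair hij).quasiMeasurePreserving.ae
        (ae_fst_ne_snd_prod unif unif)] with U hU hU' using absurd hU' hU
  filter_upwards [ae_all_iff.2 fun i => ae_all_iff.2 (hne i)] with U hU i j using hU i j

lemma ae_ne_unifPi (x : ℝ) : ∀ᵐ U ∂unifPi ι, ∀ i, U i ≠ x := by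
  have hne : ∀ᵐ y ∂unif, y ≠ x := by simp [ae_iff]
  exact ae_all_iff.2 fun i =>
    (measurePreserving_eval (fun _ : ι => unif) i).quasiMeasurePreserving.ae hne

lemma ae_injective_update_unifPi [DecidableEq ι] (b : ι) (x : ℝ) :
    ∀ᵐ U ∂unifPi ι, Injective (Function.update U b x) := by
  filter_upwards [ae_injective_unifPi, ae_ne_unifPi x] with U hU hx i j hij
  rcases eq_or_ne i b with rfl | hi <;> rcases eq_or_ne j i with rfl | hj
  all_goals grind [Function.update_apply]

end UniformPoints

section Exchangeability

lemma map_uniformOn_univ_of_card_fiber_eq {α β : Type*} [Fintype α] [MeasurableSpace α]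
    [DiscreteMeasurableSpace α] [Countable β] [MeasurableSpace β] [MeasurableSingletonClass β]
    [DecidableEq β] {f : α → β} {k : ℕ} (hk : ∀ a, #{a' | f a' = f a} = k) :
    (uniformOn Set.univ).map f = uniformOn (Set.range f) := by
  classical
  have hcard : Fintype.card α = #(Finset.univ.image f) * k := by
    rw [← Finset.card_univ, Finset.card_eq_sum_card_image f, Finset.sum_const_nat]
    simpa using hk
  refine Measure.ext_of_singleton fun b => ?_
  have hpre : f ⁻¹' {b} = (({a | f a = b} : Finset α) : Set α) := by ext; simp
  rw [Measure.map_apply .of_discrete (MeasurableSet.singleton b), hpre, ← Finset.coe_univ,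
    uniformOn_apply_finset, ← Set.image_univ, ← Finset.coe_univ, ← Finset.coe_image,
    ← Finset.coe_singleton, uniformOn_apply_finset, Finset.univ_inter, Finset.card_univ, hcard]
  by_cases hb : b ∈ Finset.univ.image f
  · obtain ⟨a, -, rfl⟩ := Finset.mem_image.1 hb
    have hk0 : (k : ENNReal) ≠ 0 := by
      rw [← hk a, Nat.cast_ne_zero]
      exact Finset.card_ne_zero_of_mem (a := a) (by simp)
    rw [hk, Finset.inter_singleton_of_mem hb, Finset.card_singleton, Nat.cast_mul, Nat.cast_one,
      ← ENNReal.mul_div_mul_right 1 _ hk0 (ENNReal.natCast_ne_top k), one_mul]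
  · have hempty : ({a | f a = b} : Finset α) = ∅ := by
      simpa [Finset.filter_eq_empty_iff] using hb
    rw [hempty, Finset.inter_singleton_of_notMem hb]
    simp

lemma map_conj_uniformOn_univ {G : Type*} [Group G] [Finite G] [MeasurableSpace G]
    [DiscreteMeasurableSpace G] (σ : G) :
    (uniformOn Set.univ).map (fun ρ : G => ρ * σ * ρ⁻¹) = uniformOn {τ | IsConj σ τ} := by
  classical
  have := Fintype.ofFinite G
  have hfiber : ∀ ρ : G, #{ρ' | ρ' * σ * ρ'⁻¹ = ρ * σ * ρ⁻¹} = #{ρ' | ρ' * σ * ρ'⁻¹ = σ} :=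
    fun ρ => by
      refine Finset.card_equiv (Equiv.mulLeft ρ⁻¹) fun ρ' => ?_
      simp only [Finset.mem_filter, Finset.mem_univ, true_and, Equiv.coe_mulLeft]
      rw [show ρ⁻¹ * ρ' * σ * (ρ⁻¹ * ρ')⁻¹ = ρ⁻¹ * (ρ' * σ * ρ'⁻¹) * ρ by group]
      constructor <;> intro h
      · rw [h]; group
      · conv_rhs => rw [← h]
        group
  rw [map_uniformOn_univ_of_card_fiber_eq hfiber]
  congr 1
  ext τ
  simp [isConj_iff]

variable {n : ℕ}

instance : DiscreteMeasurableSpace (Perm (Fin n)) := ⟨fun _ => trivial⟩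

lemma measurable_st : Measurable (st : (Fin n → ℝ) → Perm (Fin n)) := by
  refine measurable_to_countable' fun α => ?_
  have hpre : st ⁻¹' {α} = {y : Fin n → ℝ | (∀ i j, i ≤ j → y (α⁻¹ i) ≤ y (α⁻¹ j)) ∧
      ∀ i j, i < j → y (α⁻¹ i) = y (α⁻¹ j) → α⁻¹ i < α⁻¹ j} := by
    ext y
    rw [Set.mem_preimage, Set.mem_singleton_iff, st, inv_eq_iff_eq_inv, eq_comm,
      Tuple.eq_sort_iff]
    rfl
  rw [hpre]
  measurability

lemma measureReal_st_eq (α : Perm (Fin n)) :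
    (unifPi (Fin n)).real {U | st U = α} = 1 / n.factorial := by
  have hmeas : ∀ α : Perm (Fin n), MeasurableSet {U : Fin n → ℝ | st U = α} := fun α =>
    measurable_st (MeasurableSet.singleton α)
  have hconst : ∀ α : Perm (Fin n), (unifPi (Fin n)).real {U | st U = α} =
      (unifPi (Fin n)).real {U | st U = 1} := fun α => by
    rw [← (measurePreserving_comp_injective α.injective).measureReal_preimage
      (hmeas α).nullMeasurableSet]
    refine measureReal_congr ?_
    filter_upwards [ae_injective_unifPi] with U hU
    change (st (U ∘ α) = α) = (st U = 1)
    rw [st_comp_perm hU, mul_eq_right]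
  have hsum : ∑ α : Perm (Fin n), (unifPi (Fin n)).real {U | st U = α} = 1 := by
    rw [← probReal_univ (μ := unifPi (Fin n)), ← Set.preimage_univ (f := st), ← Finset.coe_univ,
      ← sum_measureReal_preimage_singleton _ fun α _ => hmeas α]
    rfl
  rw [hconst, eq_div_iff (by positivity), ← hsum]
  simp only [hconst, Finset.sum_const, Finset.card_univ, Fintype.card_perm, Fintype.card_fin,
    nsmul_eq_mul, mul_comm]

lemma measurePreserving_st :
    MeasurePreserving st (unifPi (Fin n)) (uniformOn (Set.univ : Set (Perm (Fin n)))) := by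
  refine ⟨measurable_st, Measure.ext_of_singleton fun α => ?_⟩
  rw [← ENNReal.toReal_eq_toReal_iff' (by finiteness) (by finiteness),
    Measure.map_apply measurable_st (MeasurableSet.singleton α)]
  refine (measureReal_st_eq α).trans ?_
  rw [← Finset.coe_univ, ← Finset.coe_singleton, uniformOn_apply_finset]
  simp [Fintype.card_perm]

lemma cyclicPerms_eq_setOf_isConj {t : n.Partition} {σ : Perm (Fin n)}
    (hσ : σ.partition.parts = t.parts) : cyclicPerms t = {τ | IsConj σ τ} := by
  ext τ
  rw [Set.mem_ofPred_eq, Equiv.Perm.partition_eq_of_isConj, Nat.Partition.ext_iff, hσ, eq_comm]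
  rfl

lemma measurePreserving_conj_st {t : n.Partition} {σ : Perm (Fin n)}
    (hσ : σ.partition.parts = t.parts) :
    MeasurePreserving (fun U => st U * σ * (st U)⁻¹) (unifPi (Fin n)) (uniformCyclic t) := by
  rw [uniformCyclic, cyclicPerms_eq_setOf_isConj hσ, ← map_conj_uniformOn_univ]
  exact (⟨.of_discrete, rfl⟩ : MeasurePreserving (fun ρ => ρ * σ * ρ⁻¹) (uniformOn Set.univ) _).comp
    measurePreserving_st

end Exchangeability

section BinomialLaw

variable {ι Y : Type*} {A : Set Y} [DecidablePred (· ∈ A)]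

lemma setOf_filter_mem_eq [DecidableEq ι] {s S : Finset ι} (hS : S ⊆ s) :
    {U : ι → Y | {j ∈ s | U j ∈ A} = S} =
      Set.univ.pi fun j => if j ∈ S then A else if j ∈ s then Aᶜ else Set.univ := by
  ext U
  simp only [Set.mem_ofPred_eq, Set.mem_pi, Set.mem_univ, true_imp_iff, Finset.ext_iff,
    Finset.mem_filter]
  refine forall_congr' fun j => ?_
  have := @hS j
  split_ifs <;> simp_all

variable [MeasurableSpace Y]

lemma measurableSet_setOf_filter_mem_eq [Finite ι] (hA : MeasurableSet A) (s S : Finset ι) :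
    MeasurableSet {U : ι → Y | {j ∈ s | U j ∈ A} = S} := by
  classical
  by_cases hS : S ⊆ s
  · rw [setOf_filter_mem_eq hS]
    refine .univ_pi fun j => ?_
    split_ifs
    exacts [hA, hA.compl, .univ]
  · convert MeasurableSet.empty
    exact Set.eq_empty_of_forall_notMem fun U hU => hS (hU ▸ Finset.filter_subset _ _)

variable [Fintype ι] (μ : Measure Y) [IsProbabilityMeasure μ]

lemma measureReal_setOf_filter_mem_eq (hA : MeasurableSet A) {s S : Finset ι} (hS : S ⊆ s) :
    (Measure.pi fun _ : ι => μ).real {U | {j ∈ s | U j ∈ A} = S} =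
      μ.real A ^ #S * (1 - μ.real A) ^ (#s - #S) := by
  classical
  have hcoord : ∀ j, (μ (if j ∈ S then A else if j ∈ s then Aᶜ else Set.univ)).toReal =
      (if j ∈ S then μ.real A else 1) * if j ∈ s \ S then 1 - μ.real A else 1 := fun j => by
    have := @hS j
    rw [← probReal_compl_eq_one_sub hA]
    split_ifs <;> simp_all [Measure.real]
  rw [setOf_filter_mem_eq hS, Measure.real, Measure.pi_pi, ENNReal.toReal_prod]
  simp only [hcoord, Finset.prod_mul_distrib, Finset.prod_ite_mem, Finset.univ_inter,
    Finset.prod_const, Finset.card_sdiff_of_subset hS]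

lemma measureReal_card_filter_mem_eq (hA : MeasurableSet A) (s : Finset ι) (k : ℕ) :
    (Measure.pi fun _ : ι => μ).real {U | #{j ∈ s | U j ∈ A} = k} =
      (#s).choose k * μ.real A ^ k * (1 - μ.real A) ^ (#s - k) := by
  have hunion : {U : ι → Y | #{j ∈ s | U j ∈ A} = k} =
      ⋃ S ∈ s.powersetCard k, {U | {j ∈ s | U j ∈ A} = S} := by
    ext U
    simp [Finset.filter_subset]
  rw [hunion, measureReal_biUnion_finset
      (fun S _ S' _ hne => Set.disjoint_left.2 fun U hU hU' => hne (hU.symm.trans hU'))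
      (fun S _ => measurableSet_setOf_filter_mem_eq hA s S),
    Finset.sum_congr rfl fun S hS => by
      rw [measureReal_setOf_filter_mem_eq μ hA (Finset.mem_powersetCard.1 hS).1,
        (Finset.mem_powersetCard.1 hS).2],
    Finset.sum_const, Finset.card_powersetCard, nsmul_eq_mul, mul_assoc]

end BinomialLaw

section BernsteinPolynomials

/-- The Bernstein polynomial of degree `r - 1` and index `k`, extended to the real line by its
values at the endpoints of `[0,1]`: the probability that exactly `k` of `r - 1` independent uniform
points lie to the left of the argument. -/
noncomputable def bern (r : ℕ) (k : Fin r) : ℝ → ℝ :=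
  Set.IccExtend zero_le_one (bernstein (r - 1) k)

variable {r : ℕ}

lemma bern_apply (k : Fin r) (x : ℝ) :
    bern r k x = ((r - 1).choose k : ℝ) * (Set.projIcc 0 1 zero_le_one x : ℝ) ^ (k : ℕ) *
      (1 - (Set.projIcc 0 1 zero_le_one x : ℝ)) ^ (r - 1 - (k : ℕ)) :=
  bernstein_apply _ _ _

lemma continuous_bern (k : Fin r) : Continuous (bern r k) :=
  (bernstein (r - 1) k).continuous.Icc_extend'

lemma bern_nonneg (k : Fin r) (x : ℝ) : 0 ≤ bern r k x :=
  bernstein_nonneg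

lemma sum_bern [NeZero r] (x : ℝ) : ∑ k, bern r k x = 1 := by
  obtain ⟨m, rfl⟩ := Nat.exists_eq_add_one_of_ne_zero (NeZero.ne r)
  exact bernstein.probability m (Set.projIcc 0 1 zero_le_one x)

lemma bern_le_one (k : Fin r) (x : ℝ) : bern r k x ≤ 1 := by
  have : NeZero r := ⟨k.pos.ne'⟩
  rw [← sum_bern (r := r) x]
  exact Finset.single_le_sum (f := fun k => bern r k x) (fun k _ => bern_nonneg k x)
    (Finset.mem_univ k)

lemma measureReal_unif_Iio (x : ℝ) : unif.real (Set.Iio x) = Set.projIcc 0 1 zero_le_one x := by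
  have hinter : Set.Iic x ∩ Set.Icc 0 1 = Set.Icc 0 (min 1 x) := by
    ext y
    simp only [Set.mem_inter_iff, Set.mem_Iic, Set.mem_Icc, le_min_iff]
    tauto
  rw [measureReal_congr Iio_ae_eq_Iic, unif, measureReal_restrict_apply measurableSet_Iic, hinter,
    Real.volume_real_Icc, sub_zero, max_comm, Set.coe_projIcc]

lemma measureReal_card_lt_eq_bern (b k : Fin r) (x : ℝ) :
    (unifPi (Fin r)).real {U | #{j | j ≠ b ∧ U j < x} = k} = bern r k x := by
  classical
  have hfilter : ∀ U : Fin r → ℝ, ({j | j ≠ b ∧ U j < x} : Finset (Fin r)) =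
      {j ∈ Finset.univ.erase b | U j ∈ Set.Iio x} := fun U => by ext; simp
  simp only [hfilter]
  rw [measureReal_card_filter_mem_eq unif measurableSet_Iio, measureReal_unif_Iio, bern_apply,
    Finset.card_erase_of_mem (Finset.mem_univ b), Finset.card_univ, Fintype.card_fin]

end BernsteinPolynomials

section OneFixedPoint

lemma card_perm_apply_eq {α : Type*} [Fintype α] [DecidableEq α] (b k : α) :
    #{σ : Perm α | σ b = k} = (Fintype.card α - 1).factorial := by
  have hcongr : ∀ k', #{σ : Perm α | σ b = k'} = #{σ : Perm α | σ b = k} := fun k' =>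
    Finset.card_equiv (Equiv.mulLeft (Equiv.swap k' k)) fun σ => by
      simp [Equiv.swap_apply_eq_iff]
  have hsum := Finset.card_eq_sum_card_fiberwise (f := fun σ : Perm α => σ b)
    (s := Finset.univ) (t := Finset.univ) fun _ _ => Finset.mem_coe.2 (Finset.mem_univ _)
  have hcard : 0 < Fintype.card α := Fintype.card_pos_iff.2 ⟨b⟩
  simp only [hcongr, Finset.sum_const, Finset.card_univ, Fintype.card_perm, smul_eq_mul,
    ← Nat.mul_factorial_pred hcard.ne'] at hsum
  exact (Nat.eq_of_mul_eq_mul_left hcard hsum).symm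

variable {r : ℕ}

lemma measurable_st_update (b : Fin r) (x : ℝ) :
    Measurable fun U : Fin r → ℝ => st (Function.update U b x) :=
  measurable_st.comp measurable_update_left

lemma measurableSet_st_update_eq (b : Fin r) (x : ℝ) (α : Perm (Fin r)) :
    MeasurableSet {U : Fin r → ℝ | st (Function.update U b x) = α} :=
  measurable_st_update b x (MeasurableSet.singleton α)

lemma measureReal_st_update_congr (b : Fin r) (x : ℝ) {α β : Perm (Fin r)} (h : β b = α b) :
    (unifPi (Fin r)).real {U | st (Function.update U b x) = β} =
      (unifPi (Fin r)).real {U | st (Function.update U b x) = α} := by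
  have hfix : (α⁻¹ * β) b = b := by simp [h]
  rw [← (measurePreserving_comp_injective (α⁻¹ * β).injective).measureReal_preimage
    (measurableSet_st_update_eq b x β).nullMeasurableSet]
  refine measureReal_congr ?_
  filter_upwards [ae_injective_update_unifPi b x] with U hU
  have hupdate : Function.update (fun k => U ((α⁻¹ * β) k)) b x =
      Function.update U b x ∘ (α⁻¹ * β) := by
    conv_rhs => rw [← hfix, Function.update_comp_eq_of_injective _ (α⁻¹ * β).injective]
    rfl
  change (st (Function.update (fun k => U ((α⁻¹ * β) k)) b x) = β) = (st _ = α)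
  rw [hupdate, st_comp_perm hU, ← mul_assoc, mul_eq_right, mul_inv_eq_one]

lemma measureReal_st_update (b : Fin r) (x : ℝ) (α : Perm (Fin r)) :
    (unifPi (Fin r)).real {U | st (Function.update U b x) = α} =
      bern r (α b) x / (r - 1).factorial := by
  have hrank : (unifPi (Fin r)).real {U | #{j | j ≠ b ∧ U j < x} = α b} =
      (unifPi (Fin r)).real (⋃ β ∈ ({β | β b = α b} : Finset (Perm (Fin r))),
        {U | st (Function.update U b x) = β}) := by
    refine measureReal_congr ?_
    filter_upwards [ae_injective_update_unifPi b x] with U hU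
    have hfilter : #{j | j ≠ b ∧ U j < x} =
        #{j | Function.update U b x j < Function.update U b x b} := by
      congr 1
      ext j
      rcases eq_or_ne j b with rfl | hj <;> simp [*]
    change (#{j | j ≠ b ∧ U j < x} = (α b : ℕ)) = (U ∈ ⋃ β ∈ _, _)
    rw [hfilter, ← val_st_apply hU]
    simp [Fin.ext_iff]
  rw [measureReal_card_lt_eq_bern, measureReal_biUnion_finset
      (fun β _ β' _ hne => Set.disjoint_left.2 fun U hU hU' => hne (hU.symm.trans hU'))
      (fun β _ => measurableSet_st_update_eq b x β),
    Finset.sum_congr rfl fun β hβ => measureReal_st_update_congr b x (Finset.mem_filter.1 hβ).2,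
    Finset.sum_const, card_perm_apply_eq, nsmul_eq_mul, Fintype.card_fin] at hrank
  rw [hrank, mul_div_cancel_left₀ _ (by positivity)]

lemma integral_bern (k : Fin r) : ∫ x, bern r k x ∂unif = 1 / r := by
  have hresample := measurePreserving_piecewise_pi (fun _ : Fin r => unif) {k}
  have hmeas : MeasurableSet {U : Fin r → ℝ | st U = 1} := measurable_st (MeasurableSet.singleton 1)
  have hslice : ∀ V : Fin r → ℝ, (unifPi (Fin r)).real ((fun U => (U, V)) ⁻¹'
      ((fun p : (Fin r → ℝ) × (Fin r → ℝ) => ({k} : Finset (Fin r)).piecewise p.2 p.1) ⁻¹'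
        {U | st U = 1})) = bern r k (V k) / (r - 1).factorial := fun V => by
    simp only [Set.preimage_ofPred_eq, Finset.piecewise_singleton]
    exact measureReal_st_update k (V k) 1
  have heval : ∫ V, bern r k (V k) ∂unifPi (Fin r) = ∫ x, bern r k x ∂unif :=
    integral_comp_eval (μ := fun _ : Fin r => unif) (continuous_bern k).aestronglyMeasurable
  have hst := measureReal_st_eq (n := r) 1
  rw [← hresample.measureReal_preimage hmeas.nullMeasurableSet, Measure.real,
    Measure.prod_apply_symm (hresample.measurable hmeas),
    ← integral_toReal (measurable_measure_prodMk_right (hresample.measurable hmeas)).aemeasurable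
      (ae_of_all _ fun _ => measure_lt_top _ _)] at hst
  simp only [← measureReal_def, hslice] at hst
  rw [integral_div, heval, ← Nat.mul_factorial_pred k.pos.ne', Nat.cast_mul, ← div_div,
    div_left_inj' (by positivity)] at hst
  exact hst

end OneFixedPoint

section Psi

variable {r : ℕ}

lemma measurable_relPerm_update (b : Fin r) (x y : ℝ) :
    Measurable fun p : (Fin r → ℝ) × (Fin r → ℝ) =>
      relPerm (Function.update p.1 b x) (Function.update p.2 b y) :=
  (measurable_of_countable fun q : Perm (Fin r) × Perm (Fin r) => q.2 * q.1⁻¹).comp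
    (((measurable_st_update b x).comp measurable_fst).prodMk
      ((measurable_st_update b y).comp measurable_snd))

lemma measureReal_relPerm_update (b : Fin r) (π : Perm (Fin r)) (x y : ℝ) :
    ((unifPi (Fin r)).prod (unifPi (Fin r))).real
      {p | relPerm (Function.update p.1 b x) (Function.update p.2 b y) = π} =
      (∑ i, bern r i x * bern r (π i) y) / (r - 1).factorial := by
  have hunion : {p : (Fin r → ℝ) × (Fin r → ℝ) |
      relPerm (Function.update p.1 b x) (Function.update p.2 b y) = π} =
      ⋃ α ∈ (Finset.univ : Finset (Perm (Fin r))),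
        {U | st (Function.update U b x) = α} ×ˢ {U | st (Function.update U b y) = π * α} := by
    ext p
    simp only [relPerm, Set.mem_ofPred_eq, Finset.mem_univ, Set.iUnion_true, Set.mem_iUnion,
      Set.mem_prod, exists_eq_left', mul_inv_eq_iff_eq_mul]
  rw [hunion, measureReal_biUnion_finset
      (fun α _ α' _ hne => Set.disjoint_left.2 fun p hp hp' => hne (hp.1.symm.trans hp'.1))
      (fun α _ => (measurableSet_st_update_eq b x α).prod (measurableSet_st_update_eq b y _)),
    ← Finset.sum_fiberwise (s := Finset.univ) (g := fun α : Perm (Fin r) => α b), Finset.sum_div]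
  refine Finset.sum_congr rfl fun i _ => ?_
  calc ∑ α : Perm (Fin r) with α b = i, ((unifPi (Fin r)).prod (unifPi (Fin r))).real
          ({U | st (Function.update U b x) = α} ×ˢ {U | st (Function.update U b y) = π * α})
      = ∑ α : Perm (Fin r) with α b = i,
          bern r i x / (r - 1).factorial * (bern r (π i) y / (r - 1).factorial) :=
        Finset.sum_congr rfl fun α hα => by
          rw [measureReal_prod_prod, measureReal_st_update, measureReal_st_update,
            Equiv.Perm.mul_apply, (Finset.mem_filter.1 hα).2]
    _ = bern r i x * bern r (π i) y / (r - 1).factorial := by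
        rw [Finset.sum_const, card_perm_apply_eq, nsmul_eq_mul, Fintype.card_fin]
        field_simp

lemma integral_relPerm_update (H : Perm (Fin r) → ℝ) (b : Fin r) (x y : ℝ) :
    ∫ p, H (relPerm (Function.update p.1 b x) (Function.update p.2 b y))
        ∂(unifPi (Fin r)).prod (unifPi (Fin r)) =
      ∑ π, H π * ((∑ i, bern r i x * bern r (π i) y) / (r - 1).factorial) := by
  have hm := measurable_relPerm_update b x y
  have := Measure.isProbabilityMeasure_map (μ := (unifPi (Fin r)).prod (unifPi (Fin r)))
    hm.aemeasurable
  rw [← integral_map (f := H) hm.aemeasurable (measurable_of_countable H).aestronglyMeasurable,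
    integral_fintype .of_finite]
  refine Finset.sum_congr rfl fun π _ => ?_
  rw [map_measureReal_apply hm (MeasurableSet.singleton π), smul_eq_mul, mul_comm,
    ← measureReal_relPerm_update b π x y]
  rfl

lemma measurable_perm : Measurable (perm : (Fin r → ℝ × ℝ) → Perm (Fin r)) := by
  refine measurable_to_countable' fun π => ?_
  have hpre : perm ⁻¹' {π} = ⋃ s : Perm (Fin r),
      {z : Fin r → ℝ × ℝ | st (fun i => (z i).1) = s⁻¹} ∩ {z | st (fun i => (z (s i)).2) = π} := by
    ext z
    simp only [Set.mem_preimage, Set.mem_singleton_iff, Set.mem_iUnion, Set.mem_inter_iff,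
      Set.mem_ofPred_eq, st, inv_inj, exists_eq_left']
    rfl
  rw [hpre]
  refine .iUnion fun s => .inter ?_ ?_
  · exact (measurable_st.comp (by fun_prop : Measurable fun (z : Fin r → ℝ × ℝ) i => (z i).1))
      (MeasurableSet.singleton s⁻¹)
  · exact (measurable_st.comp (by fun_prop : Measurable fun (z : Fin r → ℝ × ℝ) i => (z (s i)).2))
      (MeasurableSet.singleton π)

lemma measurePreserving_init_prod (m : ℕ) :
    MeasurePreserving
      (fun (p : (Fin (m + 1) → ℝ) × (Fin (m + 1) → ℝ)) i => (Fin.init p.1 i, Fin.init p.2 i))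
      ((unifPi (Fin (m + 1))).prod (unifPi (Fin (m + 1)))) (Measure.pi fun _ : Fin m => unifSq) :=
  (measurePreserving_arrowProdEquivProdArrow ℝ ℝ (Fin m) (fun _ => unif) (fun _ => unif)).symm.comp
    ((measurePreserving_comp_injective (Fin.castSucc_injective m)).prod
      (measurePreserving_comp_injective (Fin.castSucc_injective m)))

lemma psi_succ_eq_measureReal_snoc {m : ℕ} (π : Perm (Fin (m + 1))) (z : ℝ × ℝ) :
    psi π z = (Measure.pi fun _ : Fin m => unifSq).real
      {Z | perm (Fin.snoc Z z : Fin (m + 1) → ℝ × ℝ) = π} := rfl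

lemma measurable_snoc {m : ℕ} (z : ℝ × ℝ) :
    Measurable fun Z : Fin m → ℝ × ℝ => (Fin.snoc Z z : Fin (m + 1) → ℝ × ℝ) := by
  refine measurable_pi_lambda _ fun i => ?_
  induction i using Fin.lastCases <;> simp only [Fin.snoc_last, Fin.snoc_castSucc] <;> fun_prop

lemma psi_eq [NeZero r] (π : Perm (Fin r)) (z : ℝ × ℝ) :
    psi π z = (∑ i, bern r i z.1 * bern r (π i) z.2) / (r - 1).factorial := by
  obtain ⟨m, rfl⟩ := Nat.exists_eq_add_one_of_ne_zero (NeZero.ne r)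
  have hmeas : MeasurableSet
      {Z : Fin m → ℝ × ℝ | perm (Fin.snoc Z z : Fin (m + 1) → ℝ × ℝ) = π} :=
    (measurable_perm.comp (measurable_snoc z)) (MeasurableSet.singleton π)
  rw [← measureReal_relPerm_update (Fin.last m) π z.1 z.2, psi_succ_eq_measureReal_snoc,
    ← (measurePreserving_init_prod m).measureReal_preimage hmeas.nullMeasurableSet]
  refine measureReal_congr ?_
  filter_upwards [measurePreserving_snd.quasiMeasurePreserving.ae
    (ae_injective_update_unifPi (Fin.last m) z.2)] with p hp
  have hsnoc : (Fin.snoc (fun i => (Fin.init p.1 i, Fin.init p.2 i)) z : Fin (m + 1) → ℝ × ℝ) =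
      fun i =>
        (Function.update p.1 (Fin.last m) z.1 i, Function.update p.2 (Fin.last m) z.2 i) := by
    funext i
    induction i using Fin.lastCases <;> simp [Fin.init, (Fin.castSucc_lt_last _).ne]
  change (perm (Fin.snoc (fun i => (Fin.init p.1 i, Fin.init p.2 i)) z) = π) = _
  rw [hsnoc, perm_eq_relPerm hp]
  rfl

end Psi

section BernsteinForms

variable {r : ℕ}

/-- The function `∑ M i j b_i(x) b_j(y)` of a point `(x, y)` of the plane, where `b_i` are the
Bernstein polynomials of degree `r - 1`. Up to a constant, `ψ_π` is such a function. -/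
noncomputable def bernForm (M : Matrix (Fin r) (Fin r) ℝ) (z : ℝ × ℝ) : ℝ :=
  ∑ i, ∑ j, M i j * (bern r i z.1 * bern r j z.2)

lemma continuous_bernForm (M : Matrix (Fin r) (Fin r) ℝ) : Continuous (bernForm M) :=
  continuous_finsetSum _ fun i _ => continuous_finsetSum _ fun j _ => continuous_const.mul
    (((continuous_bern i).comp continuous_fst).mul ((continuous_bern j).comp continuous_snd))

lemma abs_bernForm_le (M : Matrix (Fin r) (Fin r) ℝ) (z : ℝ × ℝ) :
    |bernForm M z| ≤ ∑ i, ∑ j, |M i j| := by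
  refine (Finset.abs_sum_le_sum_abs _ _).trans (Finset.sum_le_sum fun i _ => ?_)
  refine (Finset.abs_sum_le_sum_abs _ _).trans (Finset.sum_le_sum fun j _ => ?_)
  rw [abs_mul, abs_of_nonneg (mul_nonneg (bern_nonneg i _) (bern_nonneg j _))]
  exact mul_le_of_le_one_right (abs_nonneg _)
    (mul_le_one₀ (bern_le_one i _) (bern_nonneg j _) (bern_le_one j _))

lemma bernForm_add (M N : Matrix (Fin r) (Fin r) ℝ) (z : ℝ × ℝ) :
    bernForm (M + N) z = bernForm M z + bernForm N z := by
  simp only [bernForm, Matrix.add_apply, add_mul, Finset.sum_add_distrib]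

lemma bernForm_smul (a : ℝ) (M : Matrix (Fin r) (Fin r) ℝ) (z : ℝ × ℝ) :
    bernForm (a • M) z = a * bernForm M z := by
  simp only [bernForm, Matrix.smul_apply, smul_eq_mul, mul_assoc, Finset.mul_sum]

lemma bernForm_swap (M : Matrix (Fin r) (Fin r) ℝ) (z : ℝ × ℝ) :
    bernForm M z.swap = bernForm M.transpose z := by
  unfold bernForm
  rw [Finset.sum_comm]
  simp only [Prod.fst_swap, Prod.snd_swap, Matrix.transpose_apply, mul_comm (bern r _ z.2)]

lemma integrable_bern (k : Fin r) : Integrable (bern r k) unif :=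
  .of_bound (continuous_bern k).aestronglyMeasurable 1 <| ae_of_all _ fun x => by
    simpa only [Real.norm_of_nonneg (bern_nonneg k x)] using bern_le_one k x

lemma integral_bernForm_snd {M : Matrix (Fin r) (Fin r) ℝ} (hrow : ∀ i, ∑ j, M i j = 0) (x : ℝ) :
    ∫ y, bernForm M (x, y) ∂unif = 0 := by
  unfold bernForm
  have hint : ∀ i j, Integrable (fun y => M i j * (bern r i x * bern r j y)) unif := fun i j =>
    ((integrable_bern j).const_mul _).const_mul _
  rw [integral_finsetSum _ fun i _ => integrable_finsetSum _ fun j _ => hint i j]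
  refine Finset.sum_eq_zero fun i _ => ?_
  rw [integral_finsetSum _ fun j _ => hint i j]
  simp only [integral_const_mul, integral_bern]
  rw [← Finset.sum_mul, hrow, zero_mul]

lemma integral_bernForm_fst {M : Matrix (Fin r) (Fin r) ℝ} (hcol : ∀ j, ∑ i, M i j = 0) (y : ℝ) :
    ∫ x, bernForm M (x, y) ∂unif = 0 := by
  have hswap : ∀ x, bernForm M (x, y) = bernForm M.transpose (y, x) :=
    fun x => bernForm_swap M (y, x)
  simp only [hswap]
  exact integral_bernForm_snd (M := M.transpose) hcol y

lemma integrable_bernForm (M : Matrix (Fin r) (Fin r) ℝ) : Integrable (bernForm M) unifSq :=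
  .of_bound (continuous_bernForm M).aestronglyMeasurable _ (ae_of_all _ (abs_bernForm_le M))

lemma integrable_bernForm_mul (M N : Matrix (Fin r) (Fin r) ℝ) :
    Integrable (fun z => bernForm M z * bernForm N z) unifSq :=
  (integrable_bernForm N).bdd_mul (continuous_bernForm M).aestronglyMeasurable
    (ae_of_all _ (abs_bernForm_le M))

lemma integral_bernForm {M : Matrix (Fin r) (Fin r) ℝ} (hrow : ∀ i, ∑ j, M i j = 0) :
    ∫ z, bernForm M z ∂unifSq = 0 := by
  rw [unifSq, integral_prod (bernForm M) (integrable_bernForm M)]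
  simp only [integral_bernForm_snd hrow, integral_zero]

lemma integral_unifSq_swap (f : ℝ × ℝ → ℝ) : ∫ z, f z.swap ∂unifSq = ∫ z, f z ∂unifSq :=
  integral_prod_swap (μ := unif) (ν := unif) f

lemma eq_zero_of_sum_mul_pow_eq_zero {R : Type*} [CommRing R] [IsDomain R] {s : Set R}
    (hs : s.Infinite) {a : Fin r → R} (h : ∀ t ∈ s, ∑ k, a k * t ^ (k : ℕ) = 0) : a = 0 := by
  have hroot : ∀ t ∈ s, (∑ k : Fin r, Polynomial.monomial (k : ℕ) (a k)).IsRoot t := fun t ht => by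
    simpa only [Polynomial.IsRoot.def, Polynomial.eval_finsetSum, Polynomial.eval_monomial]
      using h t ht
  have hzero := Polynomial.eq_zero_of_infinite_isRoot _ (hs.mono hroot)
  ext k
  simpa [Polynomial.coeff_monomial, Fin.val_inj] using congrArg (Polynomial.coeff · (k : ℕ)) hzero

lemma bern_div_one_add (k : Fin r) {t : ℝ} (ht : 0 < t) :
    bern r k (t / (1 + t)) = (r - 1).choose k * t ^ (k : ℕ) / (1 + t) ^ (r - 1) := by
  have hmem : t / (1 + t) ∈ Set.Icc (0 : ℝ) 1 :=
    ⟨by positivity, (div_le_one (by positivity)).2 (by linarith)⟩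
  have hdeg : (1 + t) ^ (r - 1) = (1 + t) ^ (k : ℕ) * (1 + t) ^ (r - 1 - (k : ℕ)) := by
    rw [← pow_add, Nat.add_sub_of_le (by lia)]
  have hcompl : 1 - t / (1 + t) = 1 / (1 + t) := by field_simp; ring
  rw [bern_apply, Set.projIcc_of_mem _ hmem, hcompl, hdeg, div_pow, div_pow, one_pow]
  field_simp

-- The substitution `x = t / (1 + t)` turns Bernstein polynomials into monomials in `t`.
lemma eq_zero_of_sum_mul_bern_eq_zero {a : Fin r → ℝ}
    (h : ∀ x ∈ Set.Icc (0 : ℝ) 1, ∑ k, a k * bern r k x = 0) : a = 0 := by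
  have hchoose : (fun k : Fin r => a k * (r - 1).choose k) = 0 := by
    refine eq_zero_of_sum_mul_pow_eq_zero (Set.Ioi_infinite (0 : ℝ)) fun t (ht : 0 < t) => ?_
    have hsum := h (t / (1 + t))
      ⟨by positivity, (div_le_one (by positivity)).2 (by linarith)⟩
    simpa only [bern_div_one_add _ ht, mul_div_assoc', ← Finset.sum_div, ← mul_assoc,
      div_eq_zero_iff, (pow_pos (show 0 < 1 + t by linarith) (r - 1)).ne', or_false] using hsum
  ext k
  have hpos : 0 < (r - 1).choose k := Nat.choose_pos (by lia)
  simpa [hpos.ne'] using congrFun hchoose k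

lemma eq_zero_of_bernForm_ae_eq_zero {M : Matrix (Fin r) (Fin r) ℝ}
    (h : bernForm M =ᵐ[unifSq] 0) : M = 0 := by
  have hvol : unifSq = volume.restrict (Set.Icc (0 : ℝ) 1 ×ˢ Set.Icc (0 : ℝ) 1) := by
    rw [unifSq, unif, Measure.prod_restrict, Measure.volume_eq_prod]
  rw [hvol] at h
  have hsquare := Measure.eqOn_of_ae_eq h (continuous_bernForm M).continuousOn continuousOn_const
    (by rw [interior_prod_eq, interior_Icc, closure_prod_eq, closure_Ioo zero_ne_one])
  have hrows : ∀ y ∈ Set.Icc (0 : ℝ) 1, (fun i => ∑ j, M i j * bern r j y) = 0 := fun y hy => by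
    refine eq_zero_of_sum_mul_bern_eq_zero fun x hx => ?_
    rw [← show bernForm M (x, y) = 0 from hsquare (Set.mk_mem_prod hx hy)]
    simp only [bernForm, Finset.sum_mul, mul_assoc, mul_comm (bern r _ x)]
  ext i j
  exact congrFun (eq_zero_of_sum_mul_bern_eq_zero (a := M i) fun y hy => congrFun (hrows y hy) i) j

/-- The `L²` inner product of the functions `bernForm M`, as a bilinear form in the matrices. -/
noncomputable def gram (r : ℕ) : LinearMap.BilinForm ℝ (Matrix (Fin r) (Fin r) ℝ) :=
  LinearMap.mk₂ ℝ (fun M N => ∫ z, bernForm M z * bernForm N z ∂unifSq)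
    (fun M M' N => by
      simp only [bernForm_add, add_mul]
      exact integral_add (integrable_bernForm_mul M N) (integrable_bernForm_mul M' N))
    (fun a M N => by
      simp only [bernForm_smul, mul_assoc]
      exact integral_const_mul _ _)
    (fun M N N' => by
      simp only [bernForm_add, mul_add]
      exact integral_add (integrable_bernForm_mul M N) (integrable_bernForm_mul M N'))
    (fun a M N => by
      simp only [bernForm_smul, mul_left_comm _ a]
      exact integral_const_mul _ _)

lemma gram_apply (M N : Matrix (Fin r) (Fin r) ℝ) :
    gram r M N = ∫ z, bernForm M z * bernForm N z ∂unifSq := rfl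

lemma gram_comm (M N : Matrix (Fin r) (Fin r) ℝ) : gram r M N = gram r N M := by
  simp only [gram_apply, mul_comm]

lemma gram_transpose_left (M N : Matrix (Fin r) (Fin r) ℝ) :
    gram r M.transpose N = gram r M N.transpose := by
  simp only [gram_apply]
  rw [← integral_unifSq_swap]
  simp only [bernForm_swap, Matrix.transpose_transpose]

lemma gram_self_nonneg (M : Matrix (Fin r) (Fin r) ℝ) : 0 ≤ gram r M M :=
  integral_nonneg fun _ => mul_self_nonneg _

lemma eq_zero_of_gram_self_eq_zero {M : Matrix (Fin r) (Fin r) ℝ} (h : gram r M M = 0) :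
    M = 0 := by
  rw [gram_apply, integral_eq_zero_iff_of_nonneg (fun _ => mul_self_nonneg _)
    (integrable_bernForm_mul M M)] at h
  exact eq_zero_of_bernForm_ae_eq_zero (h.mono fun z => mul_self_eq_zero.1)

/-- The quadratic form `Var f(U,V) + p Cov(f(U,V), f(V,U))` for `f = bernForm M` of mean zero. -/
noncomputable def twistedVar (p : ℝ) (M : Matrix (Fin r) (Fin r) ℝ) : ℝ :=
  gram r M M + p * gram r M M.transpose

lemma twistedVar_eq (p : ℝ) (M : Matrix (Fin r) (Fin r) ℝ) :
    twistedVar p M =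
      (1 + p) / 4 * gram r (M + M.transpose) (M + M.transpose) +
        (1 - p) / 4 * gram r (M - M.transpose) (M - M.transpose) := by
  simp only [twistedVar, map_add, map_sub, LinearMap.add_apply, LinearMap.sub_apply,
    gram_transpose_left, Matrix.transpose_transpose]
  ring

lemma twistedVar_nonneg {p : ℝ} (hp : p ∈ Set.Icc (-1 : ℝ) 1) (M : Matrix (Fin r) (Fin r) ℝ) :
    0 ≤ twistedVar p M := by
  rw [twistedVar_eq]
  exact add_nonneg (mul_nonneg (by linarith [hp.1]) (gram_self_nonneg _))
    (mul_nonneg (by linarith [hp.2]) (gram_self_nonneg _))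

end BernsteinForms

section CovarianceMatrix

variable {r : ℕ}

/-- The permutation matrix of `π`, centered so that its rows and columns sum to zero. -/
noncomputable def centeredPerm (π : Perm (Fin r)) : Matrix (Fin r) (Fin r) ℝ :=
  π.permMatrix ℝ - Matrix.of fun _ _ => (r : ℝ)⁻¹

lemma centeredPerm_apply (π : Perm (Fin r)) (i j : Fin r) :
    centeredPerm π i j = (if π i = j then 1 else 0) - (r : ℝ)⁻¹ := by
  simp [centeredPerm, PEquiv.toMatrix_apply, Equiv.toPEquiv_apply]

lemma transpose_centeredPerm (π : Perm (Fin r)) :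
    (centeredPerm π).transpose = centeredPerm π⁻¹ := by
  rw [centeredPerm, Matrix.transpose_sub, Matrix.transpose_permMatrix]
  rfl

lemma sum_centeredPerm_row (π : Perm (Fin r)) (i : Fin r) : ∑ j, centeredPerm π i j = 0 := by
  have hr : (r : ℝ) ≠ 0 := Nat.cast_ne_zero.2 i.pos.ne'
  simp [centeredPerm_apply, hr]

/-- The linear combination of the matrices `centeredPerm π` with given coefficients: the matrix of
the function `∑ c π ψ_π`, up to constants. -/
noncomputable def centeredComb (r : ℕ) : (Perm (Fin r) → ℝ) →ₗ[ℝ] Matrix (Fin r) (Fin r) ℝ :=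
  Fintype.linearCombination ℝ centeredPerm

lemma centeredComb_apply (c : Perm (Fin r) → ℝ) :
    centeredComb r c = ∑ π, c π • centeredPerm π := rfl

lemma transpose_centeredComb (c : Perm (Fin r) → ℝ) :
    (centeredComb r c).transpose = centeredComb r fun π => c π⁻¹ := by
  simp only [centeredComb_apply, Matrix.transpose_sum, Matrix.transpose_smul,
    transpose_centeredPerm]
  exact Fintype.sum_equiv (Equiv.inv _) _ _ fun π => by simp

lemma sum_centeredComb_row (c : Perm (Fin r) → ℝ) (i : Fin r) :
    ∑ j, centeredComb r c i j = 0 := by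
  simp only [centeredComb_apply, Matrix.sum_apply, Matrix.smul_apply, smul_eq_mul]
  rw [Finset.sum_comm]
  simp only [← Finset.mul_sum, sum_centeredPerm_row, mul_zero, Finset.sum_const_zero]

lemma sum_centeredComb_col (c : Perm (Fin r) → ℝ) (j : Fin r) :
    ∑ i, centeredComb r c i j = 0 := by
  simpa only [← transpose_centeredComb, Matrix.transpose_apply] using
    sum_centeredComb_row (fun π => c π⁻¹) j

lemma psi_eq_bernForm_add [NeZero r] (π : Perm (Fin r)) (z : ℝ × ℝ) :
    psi π z = bernForm (centeredPerm π) z / (r - 1).factorial + 1 / r.factorial := by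
  have hform : bernForm (centeredPerm π) z = ∑ i, bern r i z.1 * bern r (π i) z.2 - (r : ℝ)⁻¹ := by
    simp only [bernForm, centeredPerm_apply, sub_mul, Finset.sum_sub_distrib, ite_mul, one_mul,
      zero_mul, Finset.sum_ite_eq, Finset.mem_univ, if_true, ← Finset.mul_sum, sum_bern, mul_one]
  have hr : (r : ℝ) ≠ 0 := NeZero.ne _
  rw [psi_eq, hform, ← Nat.mul_factorial_pred (NeZero.ne r)]
  push_cast
  field_simp
  ring

lemma integral_psi [NeZero r] (π : Perm (Fin r)) : ∫ z, psi π z ∂unifSq = 1 / r.factorial := by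
  simp only [psi_eq_bernForm_add]
  rw [integral_add ((integrable_bernForm _).div_const _) (integrable_const _), integral_div,
    integral_bernForm (sum_centeredPerm_row π)]
  simp

lemma sigma_apply [NeZero r] (p : ℝ) (π ρ : Perm (Fin r)) :
    sigma r p π ρ = (gram r (centeredPerm π) (centeredPerm ρ) +
      p * gram r (centeredPerm π) (centeredPerm ρ).transpose) / ((r - 1).factorial : ℝ) ^ 4 := by
  have hswap : ∫ z, psi ρ z.swap ∂unifSq = 1 / r.factorial := by
    rw [integral_unifSq_swap, integral_psi]
  simp only [sigma, Matrix.of_apply, covariance, hswap, integral_psi]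
  simp only [psi_eq_bernForm_add, bernForm_swap, add_sub_cancel_right, gram_apply,
    div_mul_div_comm, integral_div]
  field_simp

lemma sigma_isHermitian [NeZero r] (p : ℝ) : (sigma r p).IsHermitian := by
  ext π ρ
  simp only [Matrix.conjTranspose_apply, star_trivial, sigma_apply]
  rw [gram_comm (centeredPerm ρ) (centeredPerm π), ← gram_transpose_left,
    gram_comm (Matrix.transpose _)]

lemma sigma_mulVec_apply [NeZero r] (p : ℝ) (c : Perm (Fin r) → ℝ) (π : Perm (Fin r)) :
    (sigma r p).mulVec c π =
      gram r (centeredPerm π) (centeredComb r c + p • (centeredComb r c).transpose) /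
        ((r - 1).factorial : ℝ) ^ 4 := by
  simp only [Matrix.mulVec, dotProduct, sigma_apply, centeredComb_apply, Matrix.transpose_sum,
    Matrix.transpose_smul, map_add, map_smul, map_sum, smul_eq_mul, Finset.mul_sum,
    ← Finset.sum_add_distrib, Finset.sum_div]
  exact Finset.sum_congr rfl fun ρ _ => by ring

lemma dotProduct_sigma_mulVec [NeZero r] (p : ℝ) (c d : Perm (Fin r) → ℝ) :
    dotProduct d ((sigma r p).mulVec c) =
      gram r (centeredComb r d) (centeredComb r c + p • (centeredComb r c).transpose) /
        ((r - 1).factorial : ℝ) ^ 4 := by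
  simp only [dotProduct, sigma_mulVec_apply, centeredComb_apply (r := r) d, map_sum, map_smul,
    LinearMap.sum_apply, LinearMap.smul_apply, smul_eq_mul, Finset.sum_div, mul_div_assoc]

lemma dotProduct_sigma_mulVec_self [NeZero r] (p : ℝ) (c : Perm (Fin r) → ℝ) :
    dotProduct c ((sigma r p).mulVec c) =
      twistedVar p (centeredComb r c) / ((r - 1).factorial : ℝ) ^ 4 := by
  rw [dotProduct_sigma_mulVec, twistedVar, map_add, map_smul, smul_eq_mul]

lemma posSemidef_sigma [NeZero r] {p : ℝ} (hp : p ∈ Set.Icc (-1 : ℝ) 1) :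
    (sigma r p).PosSemidef :=
  .of_dotProduct_mulVec_nonneg (sigma_isHermitian p) fun c => by
    rw [star_trivial, dotProduct_sigma_mulVec_self]
    exact div_nonneg (twistedVar_nonneg hp _) (by positivity)

-- The matrix `M + p Mᵀ` is itself a combination of the `centeredPerm π`, so it is orthogonal to
-- all of them only if it vanishes.
lemma sigma_mulVec_eq_zero_iff [NeZero r] (p : ℝ) (c : Perm (Fin r) → ℝ) :
    (sigma r p).mulVec c = 0 ↔
      centeredComb r c + p • (centeredComb r c).transpose = 0 := by
  refine ⟨fun h => ?_, fun h => ?_⟩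
  · have hcomb : centeredComb r c + p • (centeredComb r c).transpose =
        centeredComb r (c + p • fun π => c π⁻¹) := by
      rw [map_add, map_smul, transpose_centeredComb]
    have hdot := dotProduct_sigma_mulVec p c (c + p • fun π => c π⁻¹)
    rw [h, dotProduct_zero, ← hcomb, eq_comm, div_eq_zero_iff, or_iff_left (by positivity)] at hdot
    exact eq_zero_of_gram_self_eq_zero hdot
  · ext π
    rw [sigma_mulVec_apply, h, map_zero, zero_div, Pi.zero_apply]

lemma sigma_diag_pos {p : ℝ} (hp : p ∈ Set.Ioc (-1 : ℝ) 1) (hr : 2 ≤ r) (π : Perm (Fin r)) :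
    0 < sigma r p π π := by
  have : NeZero r := ⟨by lia⟩
  have hpsd := posSemidef_sigma (r := r) ⟨hp.1.le, hp.2⟩
  refine hpsd.diag_nonneg.lt_of_ne' fun hdiag => ?_
  have hker : (sigma r p).mulVec (Pi.single π 1) = 0 := by
    rw [← hpsd.dotProduct_mulVec_zero_iff]
    simpa using hdiag
  have hentry := congrFun (congrFun ((sigma_mulVec_eq_zero_iff p _).1 hker) 0) 0
  have hcomb : centeredComb r (Pi.single π 1) = centeredPerm π := by
    simp [centeredComb, Fintype.linearCombination_apply_single]
  have hcorner : (1 + p) * centeredPerm π 0 0 = 0 := by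
    rw [hcomb, Matrix.add_apply, Matrix.smul_apply, Matrix.transpose_apply, smul_eq_mul,
      Matrix.zero_apply] at hentry
    linarith
  have hinv : (r : ℝ)⁻¹ < 1 := inv_lt_one_of_one_lt₀ (by exact_mod_cast hr)
  have hinv0 : (0 : ℝ) < (r : ℝ)⁻¹ := by positivity
  have hzero := (mul_eq_zero.1 hcorner).resolve_left (by linarith [hp.1])
  rw [centeredPerm_apply] at hzero
  split_ifs at hzero <;> linarith

end CovarianceMatrix

section Rank

lemma rank_eq_finrank_range_of_mulVec_eq_zero_iff {K m n E : Type*} [Field K] [Fintype n]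
    [AddCommGroup E] [Module K E] {A : Matrix m n K} {L : (n → K) →ₗ[K] E}
    (h : ∀ c, A.mulVec c = 0 ↔ L c = 0) : A.rank = Module.finrank K (LinearMap.range L) := by
  have hker : LinearMap.ker A.mulVecLin = LinearMap.ker L := by
    ext c
    rw [LinearMap.mem_ker, LinearMap.mem_ker, Matrix.mulVecLin_apply, h]
  have hA := A.mulVecLin.finrank_range_add_finrank_ker
  have hL := L.finrank_range_add_finrank_ker
  rw [hker] at hA
  rw [Matrix.rank]
  lia

lemma eq_zero_of_add_smul_transpose_eq_zero {n K : Type*} [Field K] {p : K} (hp : p ^ 2 ≠ 1)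
    {M : Matrix n n K} (h : M + p • M.transpose = 0) : M = 0 := by
  have htranspose : M.transpose + p • M = 0 := by
    simpa using congrArg Matrix.transpose h
  have hsq : (1 - p ^ 2) • M = (M + p • M.transpose) - p • (M.transpose + p • M) := by module
  rw [h, htranspose, smul_zero, sub_zero] at hsq
  exact (smul_eq_zero.1 hsq).resolve_left (sub_ne_zero.2 hp.symm)

lemma exists_eq_sum_perm_smul_of_sum_eq_zero {n : Type*} [Fintype n] [DecidableEq n] [Nonempty n]
    {M : Matrix n n ℝ} (hrow : ∀ i, ∑ j, M i j = 0) (hcol : ∀ j, ∑ i, M i j = 0) :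
    ∃ w : Perm n → ℝ,
      M = ∑ π, w π • (π.permMatrix ℝ - Matrix.of fun _ _ => (Fintype.card n : ℝ)⁻¹) := by
  obtain ⟨K, hK⟩ := (Set.finite_range fun q : n × n => |M q.1 q.2|).bddAbove
  have hbound : ∀ i j, |M i j| ≤ max K 1 := fun i j => le_max_of_le_left (hK ⟨(i, j), rfl⟩)
  set d : ℝ := (Fintype.card n : ℝ)
  have hd : 0 < d := by simp [d, Fintype.card_pos]
  set s : ℝ := d * max K 1
  have hs : 0 < s := mul_pos hd (zero_lt_one.trans_le (le_max_right K 1))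
  -- `M / s` is a perturbation of the barycenter of the doubly stochastic matrices.
  have hmem : Matrix.of (fun i j => d⁻¹ + s⁻¹ * M i j) ∈ doublyStochastic ℝ n := by
    rw [mem_doublyStochastic_iff_sum]
    refine ⟨fun i j => ?_, fun i => ?_, fun j => ?_⟩
    · have hsplit : d⁻¹ + s⁻¹ * M i j = s⁻¹ * (max K 1 + M i j) := by
        simp only [s]
        field_simp
      rw [Matrix.of_apply, hsplit]
      exact mul_nonneg (by positivity) (by linarith [(abs_le.1 (hbound i j)).1])
    · simp [Finset.sum_add_distrib, ← Finset.mul_sum, hrow, hd.ne', d]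
    · simp [Finset.sum_add_distrib, ← Finset.mul_sum, hcol, hd.ne', d]
  obtain ⟨w, -, hw, hsum⟩ := exists_eq_sum_perm_of_mem_doublyStochastic hmem
  refine ⟨s • w, ?_⟩
  simp only [Pi.smul_apply, smul_assoc, smul_sub, Finset.sum_sub_distrib, ← Finset.smul_sum,
    ← Finset.sum_smul, hsum, hw]
  ext i j
  simp only [Matrix.sub_apply, Matrix.smul_apply, Matrix.of_apply, smul_eq_mul]
  field_simp
  ring

/-- The matrix of the map that extends a vector by one coordinate so that the coordinates sum to
zero. -/
def zeroSumExt (m : ℕ) : Matrix (Fin (m + 1)) (Fin m) ℝ :=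
  Matrix.of fun i k => Fin.lastCases (-1) (fun l => if l = k then 1 else 0) i

variable {m : ℕ} {n : Type*}

lemma zeroSumExt_mul_castSucc (N : Matrix (Fin m) n ℝ) (k : Fin m) (j : n) :
    (zeroSumExt m * N) k.castSucc j = N k j := by
  simp [Matrix.mul_apply, zeroSumExt]

lemma zeroSumExt_mul_last (N : Matrix (Fin m) n ℝ) (j : n) :
    (zeroSumExt m * N) (Fin.last m) j = -∑ k, N k j := by
  simp [Matrix.mul_apply, zeroSumExt]

lemma sum_zeroSumExt_mul_col (N : Matrix (Fin m) n ℝ) (j : n) :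
    ∑ i, (zeroSumExt m * N) i j = 0 := by
  simp only [Fin.sum_univ_castSucc, zeroSumExt_mul_castSucc, zeroSumExt_mul_last,
    add_neg_cancel]

lemma zeroSumExt_mul_submatrix {M : Matrix (Fin (m + 1)) n ℝ} (hcol : ∀ j, ∑ i, M i j = 0) :
    zeroSumExt m * M.submatrix Fin.castSucc id = M := by
  ext i j
  cases i using Fin.lastCases with
  | cast k => rw [zeroSumExt_mul_castSucc, Matrix.submatrix_apply, id]
  | last =>
    rw [zeroSumExt_mul_last, neg_eq_iff_add_eq_zero, ← hcol j, Fin.sum_univ_castSucc]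
    rfl

/-- The extension of a square matrix by one row and one column to a matrix whose rows and columns
sum to zero, as a linear map. -/
def zeroSumExtSq (m : ℕ) :
    Matrix (Fin m) (Fin m) ℝ →ₗ[ℝ] Matrix (Fin (m + 1)) (Fin (m + 1)) ℝ where
  toFun N := zeroSumExt m * (zeroSumExt m * N.transpose).transpose
  map_add' N N' := by simp [Matrix.mul_add]
  map_smul' a N := by simp

lemma zeroSumExtSq_apply (N : Matrix (Fin m) (Fin m) ℝ) :
    zeroSumExtSq m N = zeroSumExt m * (zeroSumExt m * N.transpose).transpose := rfl

lemma transpose_zeroSumExtSq (N : Matrix (Fin m) (Fin m) ℝ) :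
    (zeroSumExtSq m N).transpose = zeroSumExtSq m N.transpose := by
  simp [zeroSumExtSq_apply, Matrix.transpose_mul, Matrix.mul_assoc]

lemma sum_zeroSumExtSq_col (N : Matrix (Fin m) (Fin m) ℝ) (j : Fin (m + 1)) :
    ∑ i, zeroSumExtSq m N i j = 0 :=
  sum_zeroSumExt_mul_col _ j

lemma sum_zeroSumExtSq_row (N : Matrix (Fin m) (Fin m) ℝ) (i : Fin (m + 1)) :
    ∑ j, zeroSumExtSq m N i j = 0 := by
  simpa only [← transpose_zeroSumExtSq, Matrix.transpose_apply] using
    sum_zeroSumExtSq_col N.transpose i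

lemma zeroSumExtSq_injective : Injective (zeroSumExtSq m) := fun N N' h => by
  ext k l
  simpa only [zeroSumExtSq_apply, zeroSumExt_mul_castSucc, Matrix.transpose_apply] using
    congrFun (congrFun h k.castSucc) l.castSucc

lemma zeroSumExtSq_submatrix {M : Matrix (Fin (m + 1)) (Fin (m + 1)) ℝ}
    (hrow : ∀ i, ∑ j, M i j = 0) (hcol : ∀ j, ∑ i, M i j = 0) :
    zeroSumExtSq m (M.submatrix Fin.castSucc Fin.castSucc) = M := by
  have hinner : zeroSumExt m * (M.submatrix Fin.castSucc Fin.castSucc).transpose =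
      (M.submatrix Fin.castSucc id).transpose :=
    zeroSumExt_mul_submatrix (M := (M.submatrix Fin.castSucc id).transpose)
      fun k => hrow k.castSucc
  rw [zeroSumExtSq_apply, hinner, Matrix.transpose_transpose, zeroSumExt_mul_submatrix hcol]

lemma range_centeredComb_succ (m : ℕ) :
    LinearMap.range (centeredComb (m + 1)) = LinearMap.range (zeroSumExtSq m) := by
  refine le_antisymm ?_ ?_
  · rintro _ ⟨c, rfl⟩
    exact ⟨_, zeroSumExtSq_submatrix (sum_centeredComb_row c) (sum_centeredComb_col c)⟩
  · rintro _ ⟨N, rfl⟩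
    obtain ⟨w, hw⟩ := exists_eq_sum_perm_smul_of_sum_eq_zero (sum_zeroSumExtSq_row N)
      (sum_zeroSumExtSq_col N)
    exact ⟨w, by simp only [hw, Fintype.card_fin, centeredComb_apply, centeredPerm]⟩

variable {r : ℕ}

lemma rank_sigma_of_sq_ne_one [NeZero r] {p : ℝ} (hp : p ^ 2 ≠ 1) :
    (sigma r p).rank = (r - 1) ^ 2 := by
  obtain ⟨m, rfl⟩ := Nat.exists_eq_add_one_of_ne_zero (NeZero.ne r)
  rw [rank_eq_finrank_range_of_mulVec_eq_zero_iff (L := centeredComb (m + 1)) fun c =>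
      (sigma_mulVec_eq_zero_iff p c).trans
        ⟨eq_zero_of_add_smul_transpose_eq_zero hp, fun h => by simp [h]⟩,
    range_centeredComb_succ, LinearMap.finrank_range_of_inj zeroSumExtSq_injective,
    Module.finrank_matrix]
  simp [pow_two]

/-- The symmetric matrix with entries given by a function of unordered pairs. -/
def symMatrix (m : ℕ) : (Sym2 (Fin m) → ℝ) →ₗ[ℝ] Matrix (Fin m) (Fin m) ℝ where
  toFun f := Matrix.of fun k l => f s(k, l)
  map_add' _ _ := rfl
  map_smul' _ _ := rfl

lemma symMatrix_injective : Injective (symMatrix m) := fun f g h => by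
  ext s
  induction s with
  | _ k l => exact congrFun (congrFun h k) l

lemma transpose_symMatrix (f : Sym2 (Fin m) → ℝ) :
    (symMatrix m f).transpose = symMatrix m f := by
  ext k l
  exact congrArg f Sym2.eq_swap

lemma exists_symMatrix_eq {M : Matrix (Fin m) (Fin m) ℝ} (hM : M.IsSymm) :
    ∃ f, symMatrix m f = M :=
  ⟨Sym2.lift ⟨M, fun k l => hM.apply l k⟩, rfl⟩

lemma range_centeredComb_add_transpose (m : ℕ) :
    LinearMap.range (centeredComb (m + 1) +
        (Matrix.transposeLinearEquiv _ _ ℝ ℝ).toLinearMap ∘ₗ centeredComb (m + 1)) =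
      LinearMap.range (zeroSumExtSq m ∘ₗ symMatrix m) := by
  refine le_antisymm ?_ ?_
  · rintro _ ⟨c, rfl⟩
    obtain ⟨N, hN⟩ : centeredComb (m + 1) c ∈ LinearMap.range (zeroSumExtSq m) :=
      range_centeredComb_succ m ▸ LinearMap.mem_range_self _ c
    obtain ⟨f, hf⟩ := exists_symMatrix_eq (Matrix.isSymm_add_transpose_self N)
    refine ⟨f, ?_⟩
    change zeroSumExtSq m (symMatrix m f) =
      centeredComb (m + 1) c + (centeredComb (m + 1) c).transpose
    rw [hf, map_add, ← transpose_zeroSumExtSq, hN]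
  · rintro _ ⟨f, rfl⟩
    obtain ⟨c, hc⟩ : zeroSumExtSq m (symMatrix m f) ∈ LinearMap.range (centeredComb (m + 1)) :=
      range_centeredComb_succ m ▸ LinearMap.mem_range_self _ _
    refine ⟨(1 / 2 : ℝ) • c, ?_⟩
    change centeredComb (m + 1) ((1 / 2 : ℝ) • c) +
      (centeredComb (m + 1) ((1 / 2 : ℝ) • c)).transpose = zeroSumExtSq m (symMatrix m f)
    rw [map_smul, hc, Matrix.transpose_smul, transpose_zeroSumExtSq, transpose_symMatrix]
    module

lemma rank_sigma_one [NeZero r] : (sigma r 1).rank = r * (r - 1) / 2 := by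
  obtain ⟨m, rfl⟩ := Nat.exists_eq_add_one_of_ne_zero (NeZero.ne r)
  rw [rank_eq_finrank_range_of_mulVec_eq_zero_iff (L := centeredComb (m + 1) +
      (Matrix.transposeLinearEquiv _ _ ℝ ℝ).toLinearMap ∘ₗ centeredComb (m + 1))
      fun c => by rw [sigma_mulVec_eq_zero_iff, one_smul]; rfl,
    range_centeredComb_add_transpose, LinearMap.finrank_range_of_inj
      (f := zeroSumExtSq m ∘ₗ symMatrix m) (zeroSumExtSq_injective.comp symMatrix_injective),
    Module.finrank_fintype_fun_eq_card, Sym2.card, Fintype.card_fin, Nat.choose_two_right]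

end Rank

section ComplexEstimates

lemma norm_one_add_mul_I_sub_exp_le {x : ℝ} (hx : |x| ≤ 1 / 2) :
    ‖(1 + x * Complex.I) - Complex.exp (x * Complex.I + x ^ 2 / 2)‖ ≤ 2 * |x| ^ 3 := by
  set w : ℂ := x * Complex.I + x ^ 2 / 2 with hw
  have hx0 := abs_nonneg x
  have hwx : ‖w‖ ≤ 5 / 4 * |x| := by
    calc ‖w‖ ≤ ‖(x * Complex.I : ℂ)‖ + ‖(x ^ 2 / 2 : ℂ)‖ := norm_add_le _ _
      _ = |x| + |x| ^ 2 / 2 := by simp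
      _ ≤ 5 / 4 * |x| := by nlinarith
  have htaylor := Complex.exp_bound (x := w) (by linarith) (n := 3) (by norm_num)
  have hsplit : (1 + x * Complex.I) - Complex.exp w =
      -(Complex.exp w - ∑ m ∈ Finset.range 3, w ^ m / (m.factorial : ℂ)) -
        (x ^ 3 / 2 * Complex.I + x ^ 4 / 8) := by
    simp only [Finset.sum_range_succ, Finset.sum_range_zero, Nat.factorial, hw]
    push_cast
    ring_nf
    simp only [Complex.I_sq]
    ring
  have hrest : ‖(x ^ 3 / 2 * Complex.I + x ^ 4 / 8 : ℂ)‖ ≤ |x| ^ 3 / 2 + |x| ^ 4 / 8 :=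
    (norm_add_le _ _).trans (le_of_eq (by simp))
  have hw3 : ‖w‖ ^ 3 ≤ (5 / 4 * |x|) ^ 3 := pow_le_pow_left₀ (norm_nonneg _) hwx 3
  have hx4 : |x| ^ 4 ≤ |x| ^ 3 * (1 / 2) := by
    rw [pow_succ]
    exact mul_le_mul_of_nonneg_left hx (by positivity)
  have hx3 : (0 : ℝ) ≤ |x| ^ 3 := by positivity
  rw [hsplit]
  refine (norm_sub_le _ _).trans ?_
  rw [norm_neg]
  norm_num at htaylor
  nlinarith

lemma norm_prod_sub_prod_le_mul_sum {ι R : Type*} [NormedCommRing R] [NormOneClass R]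
    (s : Finset ι) {a b : ι → R} {M : ι → ℝ} (hM : ∀ i, 1 ≤ M i) (ha : ∀ i, ‖a i‖ ≤ M i)
    (hb : ∀ i, ‖b i‖ ≤ M i) :
    ‖∏ i ∈ s, a i - ∏ i ∈ s, b i‖ ≤ (∏ i ∈ s, M i) * ∑ i ∈ s, ‖a i - b i‖ := by
  classical
  induction s using Finset.induction_on with
  | empty => simp
  | insert i s hi ih =>
    simp only [Finset.prod_insert hi, Finset.sum_insert hi]
    have hprodb : ‖∏ j ∈ s, b j‖ ≤ ∏ j ∈ s, M j :=
      (Finset.norm_prod_le _ _).trans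
        (Finset.prod_le_prod (fun _ _ => norm_nonneg _) fun j _ => hb j)
    have hprodM : 0 ≤ ∏ j ∈ s, M j := Finset.prod_nonneg fun j _ => zero_le_one.trans (hM j)
    calc ‖a i * ∏ j ∈ s, a j - b i * ∏ j ∈ s, b j‖
        = ‖a i * (∏ j ∈ s, a j - ∏ j ∈ s, b j) + (a i - b i) * ∏ j ∈ s, b j‖ := by ring_nf
      _ ≤ ‖a i‖ * ‖∏ j ∈ s, a j - ∏ j ∈ s, b j‖ + ‖a i - b i‖ * ‖∏ j ∈ s, b j‖ :=
          (norm_add_le _ _).trans (add_le_add (norm_mul_le _ _) (norm_mul_le _ _))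
      _ ≤ M i * ((∏ j ∈ s, M j) * ∑ j ∈ s, ‖a j - b j‖) +
          (M i * ∏ j ∈ s, M j) * ‖a i - b i‖ := by
          refine add_le_add (mul_le_mul (ha i) ih (norm_nonneg _) (zero_le_one.trans (hM i))) ?_
          rw [mul_comm]
          exact mul_le_mul_of_nonneg_right
            (hprodb.trans (le_mul_of_one_le_left hprodM (hM i))) (norm_nonneg _)
      _ = M i * (∏ j ∈ s, M j) * (‖a i - b i‖ + ∑ j ∈ s, ‖a j - b j‖) := by ring

lemma abs_exp_sub_one_le_mul_exp (u : ℝ) : |Real.exp u - 1| ≤ |u| * Real.exp |u| := by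
  have htaylor := Complex.norm_exp_sub_sum_le_norm_mul_exp (u : ℂ) 1
  simp only [Finset.sum_range_one, pow_zero, Nat.factorial_zero, Nat.cast_one, div_one, pow_one,
    Complex.norm_real, Real.norm_eq_abs] at htaylor
  exact_mod_cast htaylor

lemma norm_one_add_mul_I_le_exp (x : ℝ) : ‖(1 + x * Complex.I : ℂ)‖ ≤ Real.exp (x ^ 2 / 2) := by
  have hnorm : ‖(1 + x * Complex.I : ℂ)‖ ^ 2 = 1 + x ^ 2 := by
    rw [← Complex.normSq_eq_norm_sq]
    simp [Complex.normSq_apply, pow_two]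
  refine le_of_sq_le_sq ?_ (Real.exp_pos _).le
  rw [hnorm, ← Real.exp_nat_mul, Nat.cast_ofNat, mul_div_cancel₀ _ two_ne_zero, add_comm]
  exact Real.add_one_le_exp (x ^ 2)

lemma norm_exp_mul_I_add_sq_div_two (x : ℝ) :
    ‖Complex.exp (x * Complex.I + x ^ 2 / 2)‖ = Real.exp (x ^ 2 / 2) := by
  rw [Complex.exp_add, norm_mul, Complex.norm_exp_ofReal_mul_I, one_mul]
  norm_cast
  exact Real.norm_of_nonneg (Real.exp_pos _).le

lemma norm_prod_one_add_mul_I_sub_exp_le {ι : Type*} (s : Finset ι) {x : ι → ℝ}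
    (hx : ∀ i, |x i| ≤ 1 / 2) :
    ‖∏ i ∈ s, (1 + x i * Complex.I) -
        Complex.exp ((∑ i ∈ s, x i : ℝ) * Complex.I) * (Real.exp ((∑ i ∈ s, x i ^ 2) / 2) : ℝ)‖ ≤
      Real.exp ((∑ i ∈ s, x i ^ 2) / 2) * ∑ i ∈ s, 2 * |x i| ^ 3 := by
  have hprod : ∏ i ∈ s, Complex.exp (x i * Complex.I + x i ^ 2 / 2) =
      Complex.exp ((∑ i ∈ s, x i : ℝ) * Complex.I) *
        (Real.exp ((∑ i ∈ s, x i ^ 2) / 2) : ℝ) := by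
    rw [← Complex.exp_sum, Finset.sum_add_distrib, ← Finset.sum_mul, ← Finset.sum_div,
      Complex.exp_add]
    push_cast
    rfl
  have hbound : ∏ i ∈ s, Real.exp (x i ^ 2 / 2) = Real.exp ((∑ i ∈ s, x i ^ 2) / 2) := by
    rw [← Real.exp_sum, ← Finset.sum_div]
  rw [← hprod, ← hbound]
  exact (norm_prod_sub_prod_le_mul_sum s (fun i => Real.one_le_exp (by positivity))
      (fun i => norm_one_add_mul_I_le_exp (x i))
      fun i => (norm_exp_mul_I_add_sq_div_two (x i)).le).trans
    (mul_le_mul_of_nonneg_left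
      (Finset.sum_le_sum fun i _ => norm_one_add_mul_I_sub_exp_le (hx i))
      (Finset.prod_nonneg fun i _ => (Real.exp_pos _).le))

lemma abs_exp_half_sub_one_le {Q v K : ℝ} (hQ : Q ∈ Set.Icc 0 K) (hv : v ∈ Set.Icc 0 K) :
    |Real.exp ((Q - v) / 2) - 1| ≤ Real.exp K * |Q - v| := by
  have hhalf : |(Q - v) / 2| = |Q - v| / 2 := by rw [abs_div, abs_two]
  have hdiff : |Q - v| ≤ K :=
    abs_sub_le_iff.2 ⟨by linarith [hQ.2, hv.1], by linarith [hQ.1, hv.2]⟩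
  refine (abs_exp_sub_one_le_mul_exp _).trans ?_
  rw [mul_comm, hhalf]
  exact mul_le_mul (Real.exp_le_exp.2 (by linarith [abs_nonneg (Q - v)]))
    (by linarith [abs_nonneg (Q - v)]) (by positivity) (Real.exp_pos _).le

-- McLeish's device for martingale central limit theorems: for martingale differences `x i`, the
-- product of the factors `1 + i x_i` has expectation one.
lemma norm_exp_sum_mul_I_sub_prod_one_add_mul_I_le {ι : Type*} (s : Finset ι) {x : ι → ℝ}
    {v K : ℝ} (hv : v ∈ Set.Icc 0 K) (hx : ∀ i, |x i| ≤ 1 / 2) (hsq : ∑ i ∈ s, x i ^ 2 ≤ K) :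
    ‖Complex.exp ((∑ i ∈ s, x i : ℝ) * Complex.I) -
        (Real.exp (-(v / 2)) : ℝ) * ∏ i ∈ s, (1 + x i * Complex.I)‖ ≤
      Real.exp K * (|∑ i ∈ s, x i ^ 2 - v| + ∑ i ∈ s, 2 * |x i| ^ 3) := by
  have hprod := norm_prod_one_add_mul_I_sub_exp_le s hx
  have hQ : ∑ i ∈ s, x i ^ 2 ∈ Set.Icc 0 K := ⟨Finset.sum_nonneg fun i _ => sq_nonneg _, hsq⟩
  set Q := ∑ i ∈ s, x i ^ 2
  set S := ∑ i ∈ s, x i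
  have hsplit : Complex.exp (S * Complex.I) -
        (Real.exp (-(v / 2)) : ℝ) * ∏ i ∈ s, (1 + x i * Complex.I) =
      -(Complex.exp (S * Complex.I) * ((Real.exp ((Q - v) / 2) - 1 : ℝ) : ℂ)) -
        (Real.exp (-(v / 2)) : ℝ) * (∏ i ∈ s, (1 + x i * Complex.I) -
          Complex.exp (S * Complex.I) * (Real.exp (Q / 2) : ℝ)) := by
    have hexp : Real.exp ((Q - v) / 2) = Real.exp (-(v / 2)) * Real.exp (Q / 2) := by
      rw [← Real.exp_add]
      congr 1
      ring
    rw [hexp]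
    push_cast
    ring
  rw [hsplit]
  refine (norm_sub_le _ _).trans ?_
  rw [norm_neg, norm_mul, norm_mul, Complex.norm_exp_ofReal_mul_I, one_mul, Complex.norm_real,
    Complex.norm_real, Real.norm_eq_abs, Real.norm_of_nonneg (Real.exp_pos _).le, mul_add]
  refine add_le_add (abs_exp_half_sub_one_le hQ hv) ?_
  have hQK : Real.exp (Q / 2) ≤ Real.exp K := Real.exp_le_exp.2 (by linarith [hQ.1, hQ.2])
  calc Real.exp (-(v / 2)) * _
      ≤ 1 * (Real.exp (Q / 2) * ∑ i ∈ s, 2 * |x i| ^ 3) :=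
        mul_le_mul (Real.exp_le_one_iff.2 (by linarith [hv.1])) hprod (norm_nonneg _) zero_le_one
    _ ≤ Real.exp K * ∑ i ∈ s, 2 * |x i| ^ 3 := by
        rw [one_mul]
        exact mul_le_mul_of_nonneg_right hQK (Finset.sum_nonneg fun _ _ => by positivity)

end ComplexEstimates

section AdaptedProducts

variable {ι : Type*} [Fintype ι] [LinearOrder ι] {X : ι → Type*} [∀ i, MeasurableSpace (X i)]
  (μ : ∀ i, Measure (X i)) [∀ i, IsProbabilityMeasure (μ i)] {𝕜 : Type*} [RCLike 𝕜]

lemma integral_prod_one_add_eq_one_of_adapted {y : ι → (∀ i, X i) → 𝕜} {B : ℝ}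
    (hmeas : ∀ j, Measurable (y j)) (hbound : ∀ j x, ‖y j x‖ ≤ B)
    (hadapted : ∀ j x x', (∀ i ≤ j, x i = x' i) → y j x = y j x')
    (hmean : ∀ j x, ∫ x', y j (({j} : Finset ι).piecewise x' x) ∂Measure.pi μ = 0)
    (s : Finset ι) : ∫ x, ∏ j ∈ s, (1 + y j x) ∂Measure.pi μ = 1 := by
  have hint : ∀ s : Finset ι, Integrable (fun x => ∏ j ∈ s, (1 + y j x)) (Measure.pi μ) := fun s =>
    Integrable.of_bound (C := ∏ _j ∈ s, (1 + B))
      (Finset.measurable_prod _ fun j _ => (hmeas j).const_add 1).aestronglyMeasurable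
      (ae_of_all _ fun x => by
        rw [norm_prod]
        exact Finset.prod_le_prod (fun _ _ => norm_nonneg _) fun j _ =>
          (norm_add_le _ _).trans (by simpa using hbound j x))
  induction s using Finset.induction_on_max with
  | empty => simp
  | insert a s ha ih =>
    have hnot : a ∉ s := fun h => (ha a h).false
    have hsplit : ∀ x, ∏ j ∈ insert a s, (1 + y j x) =
        ∏ j ∈ s, (1 + y j x) + (∏ j ∈ s, (1 + y j x)) * y a x := fun x => by
      rw [Finset.prod_insert hnot]
      ring
    have hmul : Integrable (fun x => (∏ j ∈ s, (1 + y j x)) * y a x) (Measure.pi μ) :=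
      ((hint (insert a s)).sub (hint s)).congr
        (ae_of_all _ fun x => by simp only [Pi.sub_apply, hsplit, add_sub_cancel_left])
    have hpast : ∀ x x', ∏ j ∈ s, (1 + y j (({a} : Finset ι).piecewise x' x)) =
        ∏ j ∈ s, (1 + y j x) := fun x x' => by
      refine Finset.prod_congr rfl fun j hj => ?_
      rw [hadapted j _ x fun i hi => Finset.piecewise_eq_of_notMem _ _ _ ?_]
      simpa using (hi.trans_lt (ha j hj)).ne
    simp only [hsplit]
    rw [integral_add (hint s) hmul, ih, integral_mul_eq_zero_of_integral_piecewise_eq_zero μ {a}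
      hpast hmul (ae_of_all _ (hmean a)), add_zero]

end AdaptedProducts

section EdgeSums

lemma integral_sq_sum_eq_sum_sum {Ω ι : Type*} [MeasurableSpace Ω] {μ : Measure Ω} (s : Finset ι)
    {f : ι → Ω → ℝ} (hf : ∀ i ∈ s, ∀ j ∈ s, Integrable (fun ω => f i ω * f j ω) μ) :
    ∫ ω, (∑ i ∈ s, f i ω) ^ 2 ∂μ = ∑ i ∈ s, ∑ j ∈ s, ∫ ω, f i ω * f j ω ∂μ := by
  simp only [pow_two, Finset.sum_mul_sum]
  rw [integral_finsetSum _ fun i hi => integrable_finsetSum _ fun j hj => hf i hi j hj]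
  exact Finset.sum_congr rfl fun i hi => integral_finsetSum _ fun j hj => hf i hi j hj

variable {ι : Type*}

lemma integral_pair_unifPi [Fintype ι] {f : ℝ × ℝ → ℝ} (hf : Measurable f) {i j : ι}
    (hij : i ≠ j) : ∫ V, f (V i, V j) ∂unifPi ι = ∫ z, f z ∂unifSq := by
  rw [← (measurePreserving_pair hij).map_eq]
  exact (integral_map (measurePreserving_pair hij).measurable.aemeasurable
    hf.aestronglyMeasurable).symm

/-- A bounded measurable function of two variables that integrates to zero over each of them, that
is, a degenerate kernel in the sense of Hoeffding's theory of `U`-statistics. -/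
structure IsDegenerate (g : ℝ × ℝ → ℝ) (C : ℝ) : Prop where
  measurable : Measurable g
  bound : ∀ z, |g z| ≤ C
  integral_snd : ∀ x, ∫ y, g (x, y) ∂unif = 0
  integral_fst : ∀ y, ∫ x, g (x, y) ∂unif = 0

/-- The contribution of the arc from `i` to `σ i` to the sum of `g` over the arcs of the functional
graph of `σ`; loops do not contribute. -/
noncomputable def edge [DecidableEq ι] (σ : Perm ι) (g : ℝ × ℝ → ℝ) (i : ι) (U : ι → ℝ) : ℝ :=
  if σ i = i then 0 else g (U i, U (σ i))

/-- The contribution of the arcs joining `j` to smaller vertices: the increment of the sum of `g`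
over the arcs of `σ` when the vertices are revealed in increasing order. -/
noncomputable def increment [LinearOrder ι] (σ : Perm ι) (g : ℝ × ℝ → ℝ) (j : ι) (U : ι → ℝ) : ℝ :=
  (if σ j < j then g (U j, U (σ j)) else 0) + if σ⁻¹ j < j then g (U (σ⁻¹ j), U j) else 0

/-- The vertices at distance at most one from `j` in the graph of `σ`. -/
def nbhd [DecidableEq ι] (σ : Perm ι) (j : ι) : Finset ι := {j, σ j, σ⁻¹ j}

variable {g : ℝ × ℝ → ℝ} {C : ℝ}

lemma increment_congr [LinearOrder ι] {σ : Perm ι} {j : ι} {U V : ι → ℝ}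
    (h : ∀ i ≤ j, U i = V i) : increment σ g j U = increment σ g j V := by
  unfold increment
  congr 1
  · split_ifs with hlt
    · rw [h j le_rfl, h _ hlt.le]
    · rfl
  · split_ifs with hlt
    · rw [h j le_rfl, h _ hlt.le]
    · rfl

lemma increment_congr_nbhd [LinearOrder ι] {σ : Perm ι} {j : ι} {U V : ι → ℝ}
    (h : ∀ i ∈ nbhd σ j, U i = V i) : increment σ g j U = increment σ g j V := by
  unfold increment
  rw [h j (by simp [nbhd]), h (σ j) (by simp [nbhd]), h (σ⁻¹ j) (by simp [nbhd])]

lemma sum_increment [Fintype ι] [LinearOrder ι] (σ : Perm ι) (g : ℝ × ℝ → ℝ) (U : ι → ℝ) :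
    ∑ j, increment σ g j U = ∑ i, edge σ g i U := by
  have hforward : ∑ j, (if σ⁻¹ j < j then g (U (σ⁻¹ j), U j) else 0) =
      ∑ i, if i < σ i then g (U i, U (σ i)) else 0 := by
    rw [← Equiv.sum_comp σ]
    simp
  simp only [increment, Finset.sum_add_distrib]
  rw [hforward, ← Finset.sum_add_distrib]
  refine Finset.sum_congr rfl fun i _ => ?_
  rw [edge]
  rcases lt_trichotomy (σ i) i with h | h | h
  · simp [h, h.ne, h.not_gt]
  · simp [h]
  · simp [h, h.ne', h.not_gt]

namespace IsDegenerate

lemma bound_nonneg (hg : IsDegenerate g C) : 0 ≤ C := (abs_nonneg _).trans (hg.bound 0)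

lemma abs_ite_le (hg : IsDegenerate g C) (p : Prop) [Decidable p] (z : ℝ × ℝ) :
    |if p then g z else 0| ≤ C := by
  split_ifs
  · exact hg.bound z
  · simpa using hg.bound_nonneg

lemma measurable_comp_pair (hg : IsDegenerate g C) (i j : ι) :
    Measurable fun U : ι → ℝ => g (U i, U j) :=
  hg.measurable.comp (by fun_prop)

lemma integral_snd_unifPi [Fintype ι] (hg : IsDegenerate g C) (x : ℝ) (j : ι) :
    ∫ V, g (x, V j) ∂unifPi ι = 0 := by
  rw [← hg.integral_snd x]
  exact integral_comp_eval (μ := fun _ => unif) (f := fun y => g (x, y))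
    (hg.measurable.comp (by fun_prop)).aestronglyMeasurable

lemma integral_fst_unifPi [Fintype ι] (hg : IsDegenerate g C) (y : ℝ) (j : ι) :
    ∫ V, g (V j, y) ∂unifPi ι = 0 := by
  rw [← hg.integral_fst y]
  exact integral_comp_eval (μ := fun _ => unif) (f := fun x => g (x, y))
    (hg.measurable.comp (by fun_prop)).aestronglyMeasurable

section Edge

variable [DecidableEq ι] {σ : Perm ι} (hg : IsDegenerate g C)
include hg

lemma measurable_edge (i : ι) : Measurable (edge σ g i) := by
  unfold edge
  split_ifs
  · exact measurable_const
  · exact hg.measurable_comp_pair _ _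

lemma abs_edge_le (i : ι) (U : ι → ℝ) : |edge σ g i U| ≤ C := by
  rw [edge, ← ite_not]
  exact hg.abs_ite_le _ _

variable [Fintype ι]

lemma integrable_edge_mul (i j : ι) :
    Integrable (fun U => edge σ g i U * edge σ g j U) (unifPi ι) :=
  Integrable.of_bound (C := C * C) ((hg.measurable_edge i).mul
    (hg.measurable_edge j)).aestronglyMeasurable (ae_of_all _ fun U => by
      rw [norm_mul]
      exact mul_le_mul (hg.abs_edge_le i U) (hg.abs_edge_le j U) (norm_nonneg _) hg.bound_nonneg)

lemma integral_edge_mul_edge_of_exists {i j : ι}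
    (h : ∃ v, (v = j ∨ v = σ j) ∧ v ≠ i ∧ v ≠ σ i) :
    ∫ U, edge σ g i U * edge σ g j U ∂unifPi ι = 0 := by
  obtain ⟨v, hv, hvi, hvσi⟩ := h
  refine integral_mul_eq_zero_of_integral_piecewise_eq_zero (fun _ => unif) {v} (fun U V => ?_)
    (hg.integrable_edge_mul i j) (ae_of_all _ fun U => ?_)
  · unfold edge
    rw [Finset.piecewise_eq_of_notMem _ _ _ (by simpa using hvi.symm),
      Finset.piecewise_eq_of_notMem _ _ _ (by simpa using hvσi.symm)]
  · unfold edge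
    split_ifs with hj
    · simp
    · simp only [Finset.piecewise_singleton]
      rcases hv with rfl | rfl
      · simp only [Function.update_self, Function.update_of_ne hj]
        exact hg.integral_fst_unifPi _ _
      · simp only [Function.update_self, Function.update_of_ne (Ne.symm hj)]
        exact hg.integral_snd_unifPi _ _

-- Distinct arcs are orthogonal, except for the two arcs of a 2-cycle.
lemma integral_edge_mul_edge (i j : ι) :
    ∫ U, edge σ g i U * edge σ g j U ∂unifPi ι =
      (if j = i ∧ σ i ≠ i then ∫ z, g z * g z ∂unifSq else 0) +
        (if j = σ i ∧ (σ i ≠ i ∧ σ (σ i) = i) then ∫ z, g z * g z.swap ∂unifSq else 0) := by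
  by_cases hi : σ i = i
  · simp [edge, hi]
  by_cases hji : j = i
  · subst hji
    rw [if_pos ⟨rfl, hi⟩, if_neg (fun h => hi h.1.symm), add_zero]
    simp only [edge, if_neg hi]
    exact integral_pair_unifPi (hg.measurable.mul hg.measurable) (Ne.symm hi)
  rw [if_neg fun h => hji h.1, zero_add]
  by_cases htwo : j = σ i ∧ (σ i ≠ i ∧ σ (σ i) = i)
  · rw [if_pos htwo]
    obtain ⟨rfl, -, hσσ⟩ := htwo
    simp only [edge, if_neg hi, hσσ, if_neg (Ne.symm hi)]
    exact integral_pair_unifPi (f := fun z => g z * g z.swap)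
      (hg.measurable.mul (hg.measurable.comp measurable_swap)) (Ne.symm hi)
  · rw [if_neg htwo]
    by_cases hj : σ j = j
    · simp [edge, hj]
    refine hg.integral_edge_mul_edge_of_exists ?_
    by_contra! hcon
    obtain rfl := hcon j (Or.inl rfl) hji
    exact htwo ⟨rfl, hi, by_contra fun hσσ => hj (hcon _ (Or.inr rfl) hσσ)⟩

lemma integral_sq_sum_edge :
    ∫ U, (∑ i, edge σ g i U) ^ 2 ∂unifPi ι =
      (Fintype.card ι - σ.partition.parts.count 1) * (∫ z, g z * g z ∂unifSq) +
        2 * σ.partition.parts.count 2 * ∫ z, g z * g z.swap ∂unifSq := by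
  have hloops : (#{i | σ i ≠ i} : ℝ) = Fintype.card ι - σ.partition.parts.count 1 := by
    rw [count_one_partition, eq_sub_iff_add_eq', ← Finset.card_univ]
    exact_mod_cast Finset.card_filter_add_card_filter_not (s := Finset.univ) fun i => σ i = i
  have htwo : (#{i | σ i ≠ i ∧ σ (σ i) = i} : ℝ) = 2 * σ.partition.parts.count 2 :=
    mod_cast (two_mul_count_two_partition σ).symm
  rw [integral_sq_sum_eq_sum_sum _ fun i _ j _ => hg.integrable_edge_mul i j, ← hloops, ← htwo]
  simp only [hg.integral_edge_mul_edge, Finset.sum_add_distrib, ite_and, Finset.sum_ite_eq',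
    Finset.mem_univ, if_true]
  simp only [← ite_and]
  rw [← Finset.sum_filter, ← Finset.sum_filter, Finset.sum_const, Finset.sum_const, nsmul_eq_mul,
    nsmul_eq_mul]

end Edge

section Increment

variable [LinearOrder ι] {σ : Perm ι} (hg : IsDegenerate g C)
include hg

lemma measurable_increment (j : ι) : Measurable (increment σ g j) := by
  unfold increment
  refine Measurable.add ?_ ?_ <;> split_ifs
  exacts [hg.measurable_comp_pair _ _, measurable_const, hg.measurable_comp_pair _ _,
    measurable_const]

lemma abs_increment_le (j : ι) (U : ι → ℝ) : |increment σ g j U| ≤ 2 * C := by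
  rw [two_mul]
  exact (abs_add_le _ _).trans (add_le_add (hg.abs_ite_le _ _) (hg.abs_ite_le _ _))

variable [Fintype ι]

lemma integral_increment_piecewise (j : ι) (U : ι → ℝ) :
    ∫ V, increment σ g j (({j} : Finset ι).piecewise V U) ∂unifPi ι = 0 := by
  have hincr : ∀ V, increment σ g j (({j} : Finset ι).piecewise V U) =
      (if σ j < j then g (V j, U (σ j)) else 0) +
        (if σ⁻¹ j < j then g (U (σ⁻¹ j), V j) else 0) := fun V => by
    rw [Finset.piecewise_singleton, increment, Function.update_self]
    congr 1
    · split_ifs with hlt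
      · rw [Function.update_of_ne hlt.ne]
      · rfl
    · split_ifs with hlt
      · rw [Function.update_of_ne hlt.ne]
      · rfl
  have hint : ∀ (p : Prop) [Decidable p] (z : (ι → ℝ) → ℝ × ℝ), Measurable z →
      Integrable (fun V => if p then g (z V) else 0) (unifPi ι) := fun p _ z hz =>
    Integrable.of_bound (Measurable.ite (by simp) (hg.measurable.comp hz)
      measurable_const).aestronglyMeasurable C (ae_of_all _ fun _ => hg.abs_ite_le _ _)
  simp only [hincr]
  rw [integral_add (hint _ _ (by fun_prop)) (hint _ _ (by fun_prop))]
  split_ifs <;> simp only [hg.integral_fst_unifPi, hg.integral_snd_unifPi, integral_zero, add_zero]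

lemma integral_prod_one_add (θ : ℝ) :
    ∫ U, ∏ j, (1 + (θ * increment σ g j U : ℝ) * Complex.I) ∂unifPi ι = 1 := by
  refine integral_prod_one_add_eq_one_of_adapted (fun _ => unif)
    (y := fun j U => ((θ * increment σ g j U : ℝ) * Complex.I : ℂ)) (B := |θ| * (2 * C))
    (fun j => (Complex.measurable_ofReal.comp
      ((hg.measurable_increment j).const_mul θ)).mul_const _) (fun j U => ?_)
    (fun j U V hUV => by rw [increment_congr hUV]) (fun j U => ?_) Finset.univ
  · rw [norm_mul, Complex.norm_I, mul_one, Complex.norm_real, Real.norm_eq_abs, abs_mul]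
    exact mul_le_mul_of_nonneg_left (hg.abs_increment_le j U) (abs_nonneg θ)
  · rw [integral_mul_const, integral_complex_ofReal, integral_const_mul,
      hg.integral_increment_piecewise, mul_zero, Complex.ofReal_zero, zero_mul]

lemma integrable_increment_mul (j k : ι) :
    Integrable (fun U => increment σ g j U * increment σ g k U) (unifPi ι) :=
  Integrable.of_bound (C := (2 * C) * (2 * C)) ((hg.measurable_increment j).mul
    (hg.measurable_increment k)).aestronglyMeasurable (ae_of_all _ fun U => by
      rw [norm_mul]
      exact mul_le_mul (hg.abs_increment_le j U) (hg.abs_increment_le k U) (norm_nonneg _)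
        (by linarith [hg.bound_nonneg]))

lemma integral_increment_mul_increment {j k : ι} (hjk : j ≠ k) :
    ∫ U, increment σ g j U * increment σ g k U ∂unifPi ι = 0 := by
  wlog hlt : j < k generalizing j k
  · simp only [mul_comm (increment σ g j _)]
    exact this hjk.symm (lt_of_le_of_ne (not_lt.1 hlt) hjk.symm)
  refine integral_mul_eq_zero_of_integral_piecewise_eq_zero (fun _ => unif) {k} (fun U V => ?_)
    (hg.integrable_increment_mul j k) (ae_of_all _ fun U => hg.integral_increment_piecewise k U)
  refine increment_congr fun i hi => ?_
  rw [Finset.piecewise_eq_of_notMem]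
  simpa using (hi.trans_lt hlt).ne

lemma sum_integral_increment_sq :
    ∑ j, ∫ U, increment σ g j U ^ 2 ∂unifPi ι =
      (Fintype.card ι - σ.partition.parts.count 1) * (∫ z, g z * g z ∂unifSq) +
        2 * σ.partition.parts.count 2 * ∫ z, g z * g z.swap ∂unifSq := by
  rw [← hg.integral_sq_sum_edge]
  simp only [← sum_increment]
  rw [integral_sq_sum_eq_sum_sum _ fun i _ j _ => hg.integrable_increment_mul i j]
  refine Finset.sum_congr rfl fun j _ => ?_
  rw [Finset.sum_eq_single j (fun k _ hk => hg.integral_increment_mul_increment hk.symm)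
    (by simp)]
  simp only [pow_two]

end Increment

end IsDegenerate

end EdgeSums

section SecondMoment

variable {Ω ι : Type*} [MeasurableSpace Ω] {μ : Measure Ω} [IsProbabilityMeasure μ]

lemma integral_abs_le_sqrt_integral_sq {f : Ω → ℝ} (hf : MemLp f 2 μ) :
    ∫ ω, |f ω| ∂μ ≤ √(∫ ω, f ω ^ 2 ∂μ) := by
  refine Real.le_sqrt_of_sq_le ?_
  have hvar := variance_nonneg |f| μ
  rw [variance_eq_sub hf.abs] at hvar
  simpa only [Pi.pow_apply, Pi.abs_apply, sq_abs, sub_nonneg] using hvar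

lemma integral_sq_sum_le (s : Finset ι) {f : ι → Ω → ℝ} {B : ℝ} (hf : ∀ i ∈ s, Measurable (f i))
    (hB : ∀ i ∈ s, ∀ ω, |f i ω| ≤ B) {near : ι → ι → Prop} [DecidableRel near]
    (hfar : ∀ i ∈ s, ∀ j ∈ s, ¬near i j → ∫ ω, f i ω * f j ω ∂μ = 0) :
    ∫ ω, (∑ i ∈ s, f i ω) ^ 2 ∂μ ≤ B ^ 2 * ∑ i ∈ s, (#{j ∈ s | near i j} : ℝ) := by
  have hbound : ∀ i ∈ s, ∀ j ∈ s, ∀ ω, |f i ω * f j ω| ≤ B ^ 2 := fun i hi j hj ω => by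
    rw [abs_mul, pow_two]
    exact mul_le_mul (hB i hi ω) (hB j hj ω) (abs_nonneg _) ((abs_nonneg _).trans (hB i hi ω))
  have hint : ∀ i ∈ s, ∀ j ∈ s, Integrable (fun ω => f i ω * f j ω) μ := fun i hi j hj =>
    Integrable.of_bound ((hf i hi).mul (hf j hj)).aestronglyMeasurable (B ^ 2)
      (ae_of_all _ (hbound i hi j hj))
  rw [integral_sq_sum_eq_sum_sum s hint, Finset.mul_sum]
  refine Finset.sum_le_sum fun i hi => ?_
  rw [mul_comm, ← nsmul_eq_mul, ← Finset.sum_const, Finset.sum_filter]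
  refine Finset.sum_le_sum fun j hj => ?_
  split_ifs with h
  · calc ∫ ω, f i ω * f j ω ∂μ ≤ ∫ _, B ^ 2 ∂μ :=
          integral_mono (hint i hi j hj) (integrable_const _)
            fun ω => (le_abs_self _).trans (hbound i hi j hj ω)
      _ = B ^ 2 := by simp
  · exact (hfar i hi j hj h).le

lemma abs_sub_integral_le_of_mem_Icc {f : Ω → ℝ} {B : ℝ} (hf : Measurable f)
    (hB : ∀ ω, f ω ∈ Set.Icc 0 B) (ω : Ω) : |f ω - ∫ ω', f ω' ∂μ| ≤ B := by
  have hint : Integrable f μ := Integrable.of_mem_Icc 0 B hf.aemeasurable (ae_of_all _ hB)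
  have hmean : ∫ ω', f ω' ∂μ ∈ Set.Icc 0 B :=
    (convex_Icc 0 B).integral_mem isClosed_Icc (ae_of_all _ hB) hint
  exact abs_sub_le_iff.2
    ⟨by linarith [(hB ω).2, hmean.1], by linarith [(hB ω).1, hmean.2]⟩

end SecondMoment

section LocalDependence

variable {ι κ : Type*} [Fintype ι] [DecidableEq ι] [Fintype κ] {X : ι → Type*}
  [∀ i, MeasurableSpace (X i)] (μ : ∀ i, Measure (X i)) [∀ i, IsProbabilityMeasure (μ i)]

lemma integral_sq_sum_sub_integral_le_of_local {Y : κ → (∀ i, X i) → ℝ} {N : κ → Finset ι} {B : ℝ}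
    (hmeas : ∀ k, Measurable (Y k)) (hB : ∀ k x, Y k x ∈ Set.Icc 0 B)
    (hlocal : ∀ k x x', (∀ i ∈ N k, x i = x' i) → Y k x = Y k x') :
    ∫ x, (∑ k, (Y k x - ∫ x', Y k x' ∂Measure.pi μ)) ^ 2 ∂Measure.pi μ ≤
      B ^ 2 * ∑ k, (#{l | ¬Disjoint (N k) (N l)} : ℝ) := by
  have habs := fun k => abs_sub_integral_le_of_mem_Icc (μ := Measure.pi μ) (hmeas k) (hB k)
  have hmeas' := fun k => (hmeas k).sub_const (∫ x', Y k x' ∂Measure.pi μ)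
  refine integral_sq_sum_le Finset.univ (fun k _ => hmeas' k) (fun k _ => habs k)
    fun k _ l _ hkl => ?_
  rw [not_not] at hkl
  refine integral_mul_eq_zero_of_integral_piecewise_eq_zero μ (N l) (fun x x' => ?_) ?_
    (ae_of_all _ fun x => ?_)
  · rw [hlocal k _ x fun i hi =>
      Finset.piecewise_eq_of_notMem _ _ _ (Finset.disjoint_left.1 hkl hi)]
  · refine Integrable.of_bound ((hmeas' k).mul (hmeas' l)).aestronglyMeasurable (B * B)
      (ae_of_all _ fun x => ?_)
    rw [norm_mul]
    exact mul_le_mul (habs k x) (habs l x) (norm_nonneg _) ((abs_nonneg _).trans (habs k x))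
  · have hpiecewise : ∀ x', Y l ((N l).piecewise x' x) = Y l x' := fun x' =>
      hlocal l _ _ fun i hi => Finset.piecewise_eq_of_mem _ _ _ hi
    simp only [hpiecewise]
    rw [integral_sub (Integrable.of_mem_Icc 0 B (hmeas l).aemeasurable (ae_of_all _ (hB l)))
      (integrable_const _), integral_const, probReal_univ, one_smul, sub_self]

end LocalDependence

section CentralLimit

lemma norm_integral_exp_sum_sub_exp_le {Ω ι : Type*} [MeasurableSpace Ω] {μ : Measure Ω}
    [IsProbabilityMeasure μ] (s : Finset ι) {x : ι → Ω → ℝ} {v K ε : ℝ} (hv : v ∈ Set.Icc 0 K)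
    (hmeas : ∀ i, Measurable (x i)) (hx : ∀ i ω, |x i ω| ≤ ε) (hε : ε ≤ 1 / 2)
    (hsq : ∀ ω, ∑ i ∈ s, x i ω ^ 2 ≤ K) (hprod : ∫ ω, ∏ i ∈ s, (1 + x i ω * Complex.I) ∂μ = 1) :
    ‖∫ ω, Complex.exp ((∑ i ∈ s, x i ω : ℝ) * Complex.I) ∂μ - (Real.exp (-(v / 2)) : ℝ)‖ ≤
      Real.exp K * (∫ ω, |∑ i ∈ s, x i ω ^ 2 - v| ∂μ + #s * (2 * ε ^ 3)) := by
  have hprodInt : Integrable (fun ω => ∏ i ∈ s, (1 + x i ω * Complex.I)) μ :=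
    Integrable.of_integral_ne_zero (by rw [hprod]; exact one_ne_zero)
  have hexpInt : Integrable (fun ω => Complex.exp ((∑ i ∈ s, x i ω : ℝ) * Complex.I)) μ :=
    Integrable.of_bound (by fun_prop) 1
      (ae_of_all _ fun ω => (Complex.norm_exp_ofReal_mul_I _).le)
  have hvarInt : Integrable (fun ω => |∑ i ∈ s, x i ω ^ 2 - v|) μ :=
    (Integrable.sub (Integrable.of_mem_Icc 0 K (by fun_prop) (ae_of_all _ fun ω =>
      ⟨Finset.sum_nonneg fun i _ => sq_nonneg _, hsq ω⟩)) (integrable_const v)).abs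
  have hpointwise : ∀ ω, ‖Complex.exp ((∑ i ∈ s, x i ω : ℝ) * Complex.I) -
      (Real.exp (-(v / 2)) : ℝ) * ∏ i ∈ s, (1 + x i ω * Complex.I)‖ ≤
      Real.exp K * (|∑ i ∈ s, x i ω ^ 2 - v| + #s * (2 * ε ^ 3)) := fun ω => by
    refine (norm_exp_sum_mul_I_sub_prod_one_add_mul_I_le s hv
      (fun i => (hx i ω).trans hε) (hsq ω)).trans ?_
    gcongr
    rw [← nsmul_eq_mul]
    exact Finset.sum_le_card_nsmul _ _ _ fun i _ => mul_le_mul_of_nonneg_left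
      (pow_le_pow_left₀ (abs_nonneg _) (hx i ω) 3) zero_le_two
  calc _ = ‖∫ ω, (Complex.exp ((∑ i ∈ s, x i ω : ℝ) * Complex.I) -
        (Real.exp (-(v / 2)) : ℝ) * ∏ i ∈ s, (1 + x i ω * Complex.I)) ∂μ‖ := by
        rw [integral_sub hexpInt (hprodInt.const_mul _), integral_const_mul, hprod, mul_one]
    _ ≤ ∫ ω, Real.exp K * (|∑ i ∈ s, x i ω ^ 2 - v| + #s * (2 * ε ^ 3)) ∂μ :=
        norm_integral_le_of_norm_le ((hvarInt.add (integrable_const _)).const_mul _)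
          (ae_of_all _ hpointwise)
    _ = _ := by
        rw [integral_const_mul, integral_add hvarInt (integrable_const _), integral_const,
          probReal_univ, one_smul]

variable {ι : Type*}

section Nbhd

variable [DecidableEq ι] {σ : Perm ι}

lemma mem_nbhd_symm {i j : ι} (h : i ∈ nbhd σ j) : j ∈ nbhd σ i := by
  simp only [nbhd, Finset.mem_insert, Finset.mem_singleton] at h ⊢
  rcases h with rfl | rfl | rfl <;> simp

lemma card_nbhd_le (σ : Perm ι) (j : ι) : #(nbhd σ j) ≤ 3 := Finset.card_le_three

lemma card_not_disjoint_nbhd_le [Fintype ι] (j : ι) :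
    #{k | ¬Disjoint (nbhd σ j) (nbhd σ k)} ≤ 9 := by
  have hsub : ({k | ¬Disjoint (nbhd σ j) (nbhd σ k)} : Finset ι) ⊆
      (nbhd σ j).biUnion (nbhd σ) := fun k hk => by
    obtain ⟨a, ha, hak⟩ := Finset.not_disjoint_iff.1 (Finset.mem_filter.1 hk).2
    exact Finset.mem_biUnion.2 ⟨a, ha, mem_nbhd_symm hak⟩
  calc _ ≤ #((nbhd σ j).biUnion (nbhd σ)) := Finset.card_le_card hsub
    _ ≤ #(nbhd σ j) * 3 := Finset.card_biUnion_le_card_mul _ _ _ fun a _ => card_nbhd_le σ a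
    _ ≤ 9 := Nat.mul_le_mul_right 3 (card_nbhd_le σ j)

end Nbhd

namespace IsDegenerate

variable [LinearOrder ι] {σ : Perm ι} {g : ℝ × ℝ → ℝ} {C : ℝ} (hg : IsDegenerate g C)
include hg

lemma increment_sq_mem_Icc (j : ι) (U : ι → ℝ) :
    increment σ g j U ^ 2 ∈ Set.Icc 0 (4 * C ^ 2) := by
  refine ⟨sq_nonneg _, ?_⟩
  rw [← sq_abs]
  exact (pow_le_pow_left₀ (abs_nonneg _) (hg.abs_increment_le j U) 2).trans_eq (by ring)

variable [Fintype ι]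

lemma sum_increment_sq_le (U : ι → ℝ) :
    ∑ j, increment σ g j U ^ 2 ≤ Fintype.card ι * (4 * C ^ 2) := by
  rw [← nsmul_eq_mul]
  exact Finset.sum_le_card_nsmul _ _ _ fun j _ => (hg.increment_sq_mem_Icc j U).2

lemma integral_sq_sum_increment_sq_le :
    ∫ U, (∑ j, increment σ g j U ^ 2 - ∑ j, ∫ U, increment σ g j U ^ 2 ∂unifPi ι) ^ 2 ∂unifPi ι ≤
      (12 * C ^ 2) ^ 2 * Fintype.card ι := by
  simp only [← Finset.sum_sub_distrib]
  refine (integral_sq_sum_sub_integral_le_of_local (fun _ => unif) (N := nbhd σ)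
    (fun j => (hg.measurable_increment j).pow_const 2) (fun j => hg.increment_sq_mem_Icc j)
    fun j U V hUV => by rw [increment_congr_nbhd hUV]).trans ?_
  have hcard : ∑ j : ι, (#{k | ¬Disjoint (nbhd σ j) (nbhd σ k)} : ℝ) ≤ Fintype.card ι • (9 : ℝ) :=
    Finset.sum_le_card_nsmul _ _ _ fun j _ => mod_cast card_not_disjoint_nbhd_le j
  refine (mul_le_mul_of_nonneg_left hcard (sq_nonneg _)).trans_eq ?_
  rw [nsmul_eq_mul]
  ring

lemma memLp_sum_increment_sq : MemLp (fun U => ∑ j, increment σ g j U ^ 2) 2 (unifPi ι) := by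
  have hmeas : Measurable fun U => ∑ j, increment σ g j U ^ 2 :=
    Finset.measurable_fun_sum _ fun j _ => (hg.measurable_increment j).pow_const 2
  refine MemLp.of_bound hmeas.aestronglyMeasurable (Fintype.card ι * (4 * C ^ 2))
    (ae_of_all _ fun U => ?_)
  rw [Real.norm_of_nonneg (Finset.sum_nonneg fun j _ => sq_nonneg _)]
  exact hg.sum_increment_sq_le U

lemma integral_abs_sum_increment_sq_sub_le (v : ℝ) :
    ∫ U, |∑ j, increment σ g j U ^ 2 - Fintype.card ι * v| ∂unifPi ι ≤
      12 * C ^ 2 * √(Fintype.card ι) +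
        |∑ j, ∫ U, increment σ g j U ^ 2 ∂unifPi ι - Fintype.card ι * v| := by
  set w := ∑ j, ∫ U, increment σ g j U ^ 2 ∂unifPi ι
  have hcentered : MemLp (fun U => ∑ j, increment σ g j U ^ 2 - w) 2 (unifPi ι) :=
    hg.memLp_sum_increment_sq.sub (memLp_const w)
  have hint : Integrable (fun U => |∑ j, increment σ g j U ^ 2 - w|) (unifPi ι) :=
    (hcentered.integrable one_le_two).abs
  calc _ ≤ ∫ U, (|∑ j, increment σ g j U ^ 2 - w| + |w - Fintype.card ι * v|) ∂unifPi ι :=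
        integral_mono
          ((hg.memLp_sum_increment_sq.sub (memLp_const _)).integrable one_le_two).abs
          (hint.add (integrable_const _)) fun U => abs_sub_le _ _ _
    _ = ∫ U, |∑ j, increment σ g j U ^ 2 - w| ∂unifPi ι + |w - Fintype.card ι * v| := by
        rw [integral_add hint (integrable_const _), integral_const, probReal_univ, one_smul]
    _ ≤ √((12 * C ^ 2) ^ 2 * Fintype.card ι) + |w - Fintype.card ι * v| :=
        add_le_add_left ((integral_abs_le_sqrt_integral_sq hcentered).trans
          (Real.sqrt_le_sqrt hg.integral_sq_sum_increment_sq_le)) _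
    _ = _ := by rw [Real.sqrt_mul (sq_nonneg _), Real.sqrt_sq (by positivity)]

lemma integral_abs_sum_increment_sq_div_sub_le [Nonempty ι] (v : ℝ) :
    ∫ U, |(∑ j, increment σ g j U ^ 2) / Fintype.card ι - v| ∂unifPi ι ≤
      12 * C ^ 2 / √(Fintype.card ι) +
        |(∑ j, ∫ U, increment σ g j U ^ 2 ∂unifPi ι) / Fintype.card ι - v| := by
  have hN : (0 : ℝ) < Fintype.card ι := mod_cast Fintype.card_pos
  set N : ℝ := (Fintype.card ι : ℝ)
  have hscale : ∀ q, |q / N - v| = |q - N * v| / N := fun q => by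
    rw [← abs_of_pos hN, ← abs_div, abs_of_pos hN, sub_div, mul_div_cancel_left₀ _ hN.ne']
  simp only [hscale, integral_div]
  refine (div_le_div_of_nonneg_right (hg.integral_abs_sum_increment_sq_sub_le v)
    hN.le).trans_eq ?_
  rw [add_div, mul_div_assoc, Real.sqrt_div_self', mul_one_div]

lemma norm_integral_exp_sum_edge_sub_le [Nonempty ι] (hC : 4 * C ≤ √(Fintype.card ι)) {v K : ℝ}
    (hv : v ∈ Set.Icc 0 K) (hCK : 4 * C ^ 2 ≤ K) :
    ‖∫ U, Complex.exp (((1 / √(Fintype.card ι)) * ∑ i, edge σ g i U : ℝ) * Complex.I) ∂unifPi ι -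
        (Real.exp (-(v / 2)) : ℝ)‖ ≤
      Real.exp K * ((12 * C ^ 2 + 16 * C ^ 3) / √(Fintype.card ι) +
        |(∑ j, ∫ U, increment σ g j U ^ 2 ∂unifPi ι) / Fintype.card ι - v|) := by
  have hN : (0 : ℝ) < Fintype.card ι := mod_cast Fintype.card_pos
  set N : ℝ := (Fintype.card ι : ℝ)
  have hs : 0 < √N := Real.sqrt_pos.2 hN
  have hsq : √N ^ 2 = N := Real.sq_sqrt hN.le
  have hQ : ∀ U, ∑ j, (1 / √N * increment σ g j U) ^ 2 = (∑ j, increment σ g j U ^ 2) / N :=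
    fun U => by simp only [one_div_mul_eq_div, div_pow, hsq, Finset.sum_div]
  have hclt := norm_integral_exp_sum_sub_exp_le (μ := unifPi ι) Finset.univ
    (x := fun j U => 1 / √N * increment σ g j U) (ε := 2 * C / √N) hv
    (fun j => (hg.measurable_increment j).const_mul _)
    (fun j U => by
      rw [abs_mul, abs_of_pos (one_div_pos.2 hs), one_div_mul_eq_div]
      exact div_le_div_of_nonneg_right (hg.abs_increment_le j U) hs.le)
    (by rw [div_le_div_iff₀ hs two_pos]; linarith)
    (fun U => by
      rw [hQ, div_le_iff₀' hN]
      exact (hg.sum_increment_sq_le U).trans (mul_le_mul_of_nonneg_left hCK hN.le))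
    (hg.integral_prod_one_add (1 / √N))
  simp only [hQ, ← Finset.mul_sum, sum_increment, Finset.card_univ] at hclt
  refine hclt.trans (mul_le_mul_of_nonneg_left ?_ (Real.exp_pos _).le)
  have hcube : N * (2 * (2 * C / √N) ^ 3) = 16 * C ^ 3 / √N := by
    rw [div_pow, pow_succ (√N), hsq]
    field_simp
    ring
  rw [hcube, add_div]
  linarith [hg.integral_abs_sum_increment_sq_div_sub_le (σ := σ) v]

end IsDegenerate

end CentralLimit

section Counting

variable {ι κ : Type*}

lemma card_offDiag_le_sq (s : Finset κ) : #s.offDiag ≤ #s ^ 2 := by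
  rw [Finset.offDiag_card, sq]
  exact Nat.sub_le _ _

variable [Fintype ι] [Fintype κ] [DecidableEq κ]

lemma card_forall_mem_mul_pow [DecidableEq ι] (s : Finset κ) (N : Finset ι) :
    #{f : κ → ι | ∀ c ∈ s, f c ∈ N} * Fintype.card ι ^ #s =
      #N ^ #s * Fintype.card ι ^ Fintype.card κ := by
  have hpi : ({f : κ → ι | ∀ c ∈ s, f c ∈ N} : Finset (κ → ι)) =
      Fintype.piFinset fun c => if c ∈ s then N else Finset.univ := by
    ext f
    simp only [Finset.mem_filter, Finset.mem_univ, true_and, Fintype.mem_piFinset]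
    refine forall_congr' fun c => ?_
    split_ifs with hc <;> simp [hc]
  simp only [hpi, Fintype.card_piFinset, apply_ite Finset.card, Finset.card_univ]
  rw [Finset.prod_ite, Finset.prod_const, Finset.prod_const, mul_assoc, ← pow_add,
    Finset.filter_mem_eq_inter, Finset.univ_inter, Finset.filter_notMem_eq_sdiff,
    ← Finset.compl_eq_univ_sdiff, add_comm, Finset.card_add_card_compl]

lemma card_apply_eq_mul_le [DecidableEq ι] {a b : κ} (hab : a ≠ b) (φ : ι → ι) :
    #{f : κ → ι | f b = φ (f a)} * Fintype.card ι ≤ Fintype.card ι ^ Fintype.card κ := by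
  have hinj : Set.InjOn (fun q : (κ → ι) × ι => Function.update q.1 b q.2)
      (({f : κ → ι | f b = φ (f a)} : Finset (κ → ι)) ×ˢ (Finset.univ : Finset ι) :
        Finset ((κ → ι) × ι)) := by
    rintro ⟨f, v⟩ hf ⟨f', v'⟩ hf' h
    simp only [Finset.coe_product, Set.mem_prod, Finset.mem_coe, Finset.mem_filter,
      Finset.mem_univ, true_and, and_true] at hf hf'
    have hne : ∀ c, c ≠ b → f c = f' c := fun c hc => by
      simpa only [Function.update_of_ne hc] using congrFun h c
    have hv : v = v' := by simpa only [Function.update_self] using congrFun h b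
    have hff' : f = f' := funext fun c => by
      by_cases hc : c = b
      · rw [hc, hf, hf', hne a hab]
      · exact hne c hc
    rw [hv, hff']
  simpa using Finset.card_le_card_of_injOn _ (fun _ _ => Finset.mem_coe.2 (Finset.mem_univ _)) hinj

lemma sum_apply_mul (G : ι → ℝ) (a : κ) :
    (∑ f : κ → ι, G (f a)) * Fintype.card ι = Fintype.card ι ^ Fintype.card κ * ∑ i, G i := by
  classical
  rw [← Finset.sum_fiberwise (s := Finset.univ) (g := fun f : κ → ι => f a), Finset.sum_mul,
    Finset.mul_sum]
  refine Finset.sum_congr rfl fun i _ => ?_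
  rw [Finset.sum_congr rfl (g := fun _ => G i) fun f hf => by rw [(Finset.mem_filter.1 hf).2],
    Finset.sum_const, nsmul_eq_mul, mul_right_comm]
  congr 1
  have hfiber := card_forall_mem_mul_pow ({a} : Finset κ) ({i} : Finset ι)
  simp only [Finset.mem_singleton, forall_eq, Finset.card_singleton, pow_one, one_mul] at hfiber
  exact_mod_cast hfiber

lemma sum_sum_apply_mul (G : ι → ℝ) :
    (∑ f : κ → ι, ∑ a, G (f a)) * Fintype.card ι =
      Fintype.card κ * Fintype.card ι ^ Fintype.card κ * ∑ i, G i := by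
  rw [Finset.sum_comm, Finset.sum_mul]
  simp only [sum_apply_mul, Finset.sum_const, Finset.card_univ, nsmul_eq_mul, mul_assoc]

end Counting

section Spread

variable {ι κ : Type*} {σ : Perm ι} {f : κ → ι}

/-- The arcs starting from the entries of `f` are pairwise disjoint and none of them is a loop. -/
def IsSpread (σ : Perm ι) (f : κ → ι) : Prop := Injective (Sum.elim f (σ ∘ f))

lemma IsSpread.injective (hf : IsSpread σ f) : Injective f := hf.comp Sum.inl_injective

lemma IsSpread.apply_ne (hf : IsSpread σ f) (a b : κ) : f a ≠ σ (f b) :=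
  hf.ne (a₁ := .inl a) (a₂ := .inr b) Sum.inl_ne_inr

lemma isSpread_of_forall_ne (hinj : ∀ a b, a ≠ b → f b ≠ f a) (harc : ∀ a b, f b ≠ σ (f a)) :
    IsSpread σ f := by
  have hf : Injective f := fun a b h => by_contra fun hab => hinj b a (Ne.symm hab) h
  exact hf.sumElim (σ.injective.comp hf) fun a b => harc b a

variable [Fintype κ] [DecidableEq ι]

/-- The vertices at distance at most one from an entry of `f`. -/
def tupleNbhd (σ : Perm ι) (f : κ → ι) : Finset ι := Finset.univ.biUnion fun a => nbhd σ (f a)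

lemma card_tupleNbhd_le (f : κ → ι) : #(tupleNbhd σ f) ≤ 3 * Fintype.card κ := by
  rw [mul_comm]
  exact Finset.card_biUnion_le_card_mul _ _ _ fun a _ => card_nbhd_le σ (f a)

/-- At least two entries of `f'` are close to `f`: deleting any one entry of `f'` leaves another
one that is close to `f`. -/
def TwiceNear (σ : Perm ι) (f f' : κ → ι) : Prop := ∀ b, ∃ b', b' ≠ b ∧ f' b' ∈ tupleNbhd σ f

variable [DecidableEq κ]

instance (σ : Perm ι) : DecidablePred (IsSpread (κ := κ) σ) :=
  fun f => inferInstanceAs (Decidable (Injective (Sum.elim f (σ ∘ f))))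

instance (σ : Perm ι) : DecidableRel (TwiceNear (κ := κ) σ) :=
  fun f f' => inferInstanceAs (Decidable (∀ b, ∃ b', b' ≠ b ∧ f' b' ∈ tupleNbhd σ f))

variable [Fintype ι]

lemma not_isSpread_subset :
    ({f : κ → ι | ¬IsSpread σ f} : Finset (κ → ι)) ⊆
      (Finset.univ.offDiag.biUnion fun q => {f | f q.2 = f q.1 ∨ f q.2 = σ (f q.1)}) ∪
        Finset.univ.biUnion fun a => {f | σ (f a) = f a} := by
  intro f hf
  contrapose! hf
  simp only [Finset.mem_union, Finset.mem_biUnion, Finset.mem_offDiag, Finset.mem_filter,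
    Finset.mem_univ, true_and, Prod.exists, not_or, not_exists, not_and, not_not] at hf ⊢
  obtain ⟨hpair, hfix⟩ := hf
  refine isSpread_of_forall_ne (fun a b hab => (hpair a b hab).1) fun a b => ?_
  obtain rfl | hab := eq_or_ne a b
  · exact fun h => hfix a h.symm
  · exact (hpair a b hab).2

lemma card_apply_fixed_mul (a : κ) :
    #{f : κ → ι | σ (f a) = f a} * Fintype.card ι =
      σ.partition.parts.count 1 * Fintype.card ι ^ Fintype.card κ := by
  have hcard := card_forall_mem_mul_pow ({a} : Finset κ) {i : ι | σ i = i}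
  simpa only [Finset.mem_singleton, forall_eq, Finset.mem_filter, Finset.mem_univ, true_and,
    Finset.card_singleton, pow_one, count_one_partition] using hcard

lemma card_not_isSpread_mul_le :
    #{f : κ → ι | ¬IsSpread σ f} * Fintype.card ι ≤
      (2 * Fintype.card κ ^ 2 + Fintype.card κ * σ.partition.parts.count 1) *
        Fintype.card ι ^ Fintype.card κ := by
  set N := Fintype.card ι
  set k := Fintype.card κ
  set pairs := (Finset.univ : Finset κ).offDiag
  have hpairs : #pairs ≤ k ^ 2 := card_offDiag_le_sq _
  have hpair : ∀ q ∈ pairs,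
      #{f : κ → ι | f q.2 = f q.1 ∨ f q.2 = σ (f q.1)} * N ≤ 2 * N ^ k := fun q hq => by
    have hne := (Finset.mem_offDiag.1 hq).2.2
    calc _ ≤ (#{f : κ → ι | f q.2 = f q.1} + #{f : κ → ι | f q.2 = σ (f q.1)}) * N :=
          by
          rw [Finset.filter_or]
          exact Nat.mul_le_mul_right _ (Finset.card_union_le _ _)
      _ ≤ N ^ k + N ^ k := by
          rw [add_mul]
          exact add_le_add (card_apply_eq_mul_le hne id) (card_apply_eq_mul_le hne σ)
      _ = 2 * N ^ k := (two_mul _).symm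
  calc _ ≤ (∑ q ∈ pairs, #{f : κ → ι | f q.2 = f q.1 ∨ f q.2 = σ (f q.1)} +
        ∑ a : κ, #{f : κ → ι | σ (f a) = f a}) * N :=
        Nat.mul_le_mul_right _ ((Finset.card_le_card not_isSpread_subset).trans
          ((Finset.card_union_le _ _).trans
            (add_le_add Finset.card_biUnion_le Finset.card_biUnion_le)))
    _ ≤ k ^ 2 * (2 * N ^ k) + k * (σ.partition.parts.count 1 * N ^ k) := by
        rw [add_mul, Finset.sum_mul, Finset.sum_mul]
        refine add_le_add ?_ ?_
        · exact (Finset.sum_le_card_nsmul _ _ _ hpair).trans (Nat.mul_le_mul_right _ hpairs)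
        · simp only [card_apply_fixed_mul, Finset.sum_const, Finset.card_univ, smul_eq_mul, k, N,
            le_refl]
    _ = _ := by ring

lemma twiceNear_subset [Nonempty κ] (f : κ → ι) :
    ({f' | TwiceNear σ f f'} : Finset (κ → ι)) ⊆
      Finset.univ.offDiag.biUnion fun q =>
        {f' | ∀ c ∈ ({q.1, q.2} : Finset κ), f' c ∈ tupleNbhd σ f} := by
  intro f' hf'
  have hnear : TwiceNear σ f f' := (Finset.mem_filter.1 hf').2
  obtain ⟨b, -, hb⟩ := hnear (Classical.arbitrary κ)
  obtain ⟨c, hcb, hc⟩ := hnear b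
  refine Finset.mem_biUnion.2 ⟨(c, b), by simpa using hcb, ?_⟩
  simp [hb, hc]

lemma card_twiceNear_mul_le [Nonempty κ] (f : κ → ι) :
    #{f' : κ → ι | TwiceNear σ f f'} * Fintype.card ι ^ 2 ≤
      9 * Fintype.card κ ^ 4 * Fintype.card ι ^ Fintype.card κ := by
  set N := Fintype.card ι
  set k := Fintype.card κ
  set pairs := (Finset.univ : Finset κ).offDiag
  have hpairs : #pairs ≤ k ^ 2 := card_offDiag_le_sq _
  have hpair : ∀ q ∈ pairs,
      #{f' : κ → ι | ∀ c ∈ ({q.1, q.2} : Finset κ), f' c ∈ tupleNbhd σ f} * N ^ 2 ≤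
        (3 * k) ^ 2 * N ^ k := fun q hq => by
    have hcard := card_forall_mem_mul_pow {q.1, q.2} (tupleNbhd σ f)
    rw [Finset.card_pair (Finset.mem_offDiag.1 hq).2.2] at hcard
    rw [hcard]
    exact Nat.mul_le_mul_right _ (Nat.pow_le_pow_left (card_tupleNbhd_le f) 2)
  calc _ ≤ (∑ q ∈ pairs, #{f' : κ → ι | ∀ c ∈ ({q.1, q.2} : Finset κ), f' c ∈ tupleNbhd σ f}) *
        N ^ 2 := Nat.mul_le_mul_right _
          ((Finset.card_le_card (twiceNear_subset f)).trans Finset.card_biUnion_le)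
    _ ≤ k ^ 2 * ((3 * k) ^ 2 * N ^ k) := by
        rw [Finset.sum_mul]
        exact (Finset.sum_le_card_nsmul _ _ _ hpair).trans (Nat.mul_le_mul_right _ hpairs)
    _ = _ := by ring

end Spread

section Projection

variable {r : ℕ}

/-- The centered conditional expectation, given that one of the points is `z`, of `H` at the pattern
of `r` independent uniform points. -/
noncomputable def proj (H : Perm (Fin r) → ℝ) (z : ℝ × ℝ) : ℝ :=
  bernForm (centeredComb r H) z / (r - 1).factorial

lemma exists_isDegenerate_proj (H : Perm (Fin r) → ℝ) : ∃ C, IsDegenerate (proj H) C := by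
  refine ⟨(∑ i, ∑ j, |centeredComb r H i j|) / (r - 1).factorial,
    ((continuous_bernForm _).div_const _).measurable, fun z => ?_, fun x => ?_, fun y => ?_⟩
  · rw [proj, abs_div, Nat.abs_cast]
    exact div_le_div_of_nonneg_right (abs_bernForm_le _ z) (by positivity)
  · simp only [proj, integral_div, integral_bernForm_snd (sum_centeredComb_row H), zero_div]
  · simp only [proj, integral_div, integral_bernForm_fst (sum_centeredComb_col H), zero_div]

lemma integral_proj (H : Perm (Fin r) → ℝ) : ∫ z, proj H z ∂unifSq = 0 := by
  simp only [proj, integral_div, integral_bernForm (sum_centeredComb_row H), zero_div]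

lemma bernForm_centeredComb (H : Perm (Fin r) → ℝ) (z : ℝ × ℝ) :
    bernForm (centeredComb r H) z = ∑ π, H π * bernForm (centeredPerm π) z := by
  let evalForm : Matrix (Fin r) (Fin r) ℝ →ₗ[ℝ] ℝ :=
    { toFun := fun M => bernForm M z
      map_add' := fun M N => bernForm_add M N z
      map_smul' := fun a M => bernForm_smul a M z }
  rw [centeredComb_apply]
  exact (map_sum evalForm _ _).trans (Finset.sum_congr rfl fun π _ => evalForm.map_smul _ _)

lemma sum_mul_bern_eq_permMean_add_proj [NeZero r] (H : Perm (Fin r) → ℝ) (x y : ℝ) :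
    ∑ π, H π * ((∑ i, bern r i x * bern r (π i) y) / (r - 1).factorial) =
      permMean H + proj H (x, y) := by
  simp only [← psi_eq _ (x, y), psi_eq_bernForm_add, mul_add, Finset.sum_add_distrib, permMean,
    proj, bernForm_centeredComb, Finset.sum_div, mul_one_div, mul_div_assoc]
  exact add_comm _ _

lemma abs_permMean_le {H : Perm (Fin r) → ℝ} {B : ℝ} (hB : ∀ π, |H π| ≤ B) : |permMean H| ≤ B := by
  rw [permMean, abs_div, Nat.abs_cast, div_le_iff₀' (by positivity)]
  calc |∑ π, H π| ≤ ∑ π, |H π| := Finset.abs_sum_le_sum_abs _ _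
    _ ≤ Fintype.card (Perm (Fin r)) • B := Finset.sum_le_card_nsmul _ _ _ fun π _ => hB π
    _ = r.factorial * B := by rw [Fintype.card_perm, Fintype.card_fin, nsmul_eq_mul]

end Projection

section Remainder

variable {r : ℕ} {ι : Type*}

lemma measurable_arcPattern (σ : Perm ι) (f : Fin r → ι) :
    Measurable (arcPattern σ f : (ι → ℝ) → Perm (Fin r)) := by
  have hsource : Measurable fun (U : ι → ℝ) a => U (f a) := by fun_prop
  have htarget : Measurable fun (U : ι → ℝ) a => U (σ (f a)) := by fun_prop
  exact (measurable_of_countable fun q : Perm (Fin r) × Perm (Fin r) => q.2 * q.1⁻¹).comp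
    ((measurable_st.comp hsource).prodMk (measurable_st.comp htarget))

/-- What is left of `H` at the pattern of the arcs starting from `f` after subtracting its mean and
its projections on the single arcs. -/
noncomputable def remainder (σ : Perm ι) (H : Perm (Fin r) → ℝ) (f : Fin r → ι) (U : ι → ℝ) : ℝ :=
  H (arcPattern σ f U) - permMean H - ∑ a, proj H (U (f a), U (σ (f a)))

variable {σ : Perm ι} {H : Perm (Fin r) → ℝ} {B C : ℝ} {f f' : Fin r → ι}

lemma measurable_remainder (f : Fin r → ι) : Measurable (remainder σ H f) := by
  obtain ⟨C, hC⟩ := exists_isDegenerate_proj H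
  exact (((measurable_of_countable H).comp (measurable_arcPattern σ f)).sub measurable_const).sub
    (Finset.measurable_fun_sum _ fun a _ => hC.measurable_comp_pair _ _)

lemma abs_sub_permMean_le (hB : ∀ π, |H π| ≤ B) (π : Perm (Fin r)) :
    |H π - permMean H| ≤ 2 * B := by
  rw [two_mul]
  exact (abs_sub _ _).trans (add_le_add (hB π) (abs_permMean_le hB))

lemma abs_sum_proj_le (hC : IsDegenerate (proj H) C) (f : Fin r → ι) (U : ι → ℝ) :
    |∑ a, proj H (U (f a), U (σ (f a)))| ≤ r * C := by
  calc _ ≤ ∑ a, |proj H (U (f a), U (σ (f a)))| := Finset.abs_sum_le_sum_abs _ _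
    _ ≤ Fintype.card (Fin r) • C := Finset.sum_le_card_nsmul _ _ _ fun a _ => hC.bound _
    _ = r * C := by rw [Fintype.card_fin, nsmul_eq_mul]

lemma abs_remainder_le (hB : ∀ π, |H π| ≤ B) (hC : IsDegenerate (proj H) C) (f : Fin r → ι)
    (U : ι → ℝ) : |remainder σ H f U| ≤ 2 * B + r * C :=
  (abs_sub _ _).trans (add_le_add (abs_sub_permMean_le hB _) (abs_sum_proj_le hC f U))

lemma abs_le_sum_abs (H : Perm (Fin r) → ℝ) (π : Perm (Fin r)) : |H π| ≤ ∑ π, |H π| :=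
  Finset.single_le_sum (f := fun π => |H π|) (fun _ _ => abs_nonneg _) (Finset.mem_univ π)

lemma piecewise_comp_eq_update [DecidableEq ι] {T : Finset ι} {e : Fin r → ι} {b : Fin r}
    (he : ∀ a, e a ∈ T ↔ a ≠ b) (U V : ι → ℝ) :
    (fun a => T.piecewise V U (e a)) = Function.update (fun a => V (e a)) b (U (e b)) := by
  ext a
  obtain rfl | ha := eq_or_ne a b
  · simp [he]
  · simp [he, ha]

variable [Fintype ι]

lemma measurePreserving_arcs (hf : IsSpread σ f) : MeasurePreserving
    (fun V : ι → ℝ => ((fun a => V (f a), fun a => V (σ (f a))) : (Fin r → ℝ) × (Fin r → ℝ)))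
    (unifPi ι) ((unifPi (Fin r)).prod (unifPi (Fin r))) :=
  (measurePreserving_sumPiEquivProdPi (fun _ : Fin r ⊕ Fin r => unif)).comp
    (measurePreserving_comp_injective hf)

variable [DecidableEq ι]

/-- The vertices of all arcs of `f` but the one at `b`. -/
def otherVertices (σ : Perm ι) (f : Fin r → ι) (b : Fin r) : Finset ι :=
  {i | ∃ a, a ≠ b ∧ (i = f a ∨ i = σ (f a))}

lemma mem_otherVertices {b : Fin r} {i : ι} :
    i ∈ otherVertices σ f b ↔ ∃ a, a ≠ b ∧ (i = f a ∨ i = σ (f a)) := by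
  simp only [otherVertices, Finset.mem_filter, Finset.mem_univ, true_and]

lemma IsSpread.apply_mem_otherVertices_iff (hf : IsSpread σ f) {a b : Fin r} :
    f a ∈ otherVertices σ f b ↔ a ≠ b := by
  simp [mem_otherVertices, hf.injective.eq_iff, hf.apply_ne]

lemma IsSpread.perm_apply_mem_otherVertices_iff (hf : IsSpread σ f) {a b : Fin r} :
    σ (f a) ∈ otherVertices σ f b ↔ a ≠ b := by
  simp [mem_otherVertices, hf.injective.eq_iff, (hf.apply_ne _ _).symm]

lemma integral_arcPattern_piecewise (hf : IsSpread σ f) (b : Fin r) (U : ι → ℝ) :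
    ∫ V, H (arcPattern σ f ((otherVertices σ f b).piecewise V U)) ∂unifPi ι =
      permMean H + proj H (U (f b), U (σ (f b))) := by
  have : NeZero r := ⟨b.pos.ne'⟩
  have hmp := measurePreserving_arcs hf
  have hmeas := (measurable_of_countable H).comp
    (measurable_relPerm_update b (U (f b)) (U (σ (f b))))
  simp only [arcPattern, piecewise_comp_eq_update fun _ => hf.apply_mem_otherVertices_iff,
    piecewise_comp_eq_update (e := fun a => σ (f a)) fun _ => hf.perm_apply_mem_otherVertices_iff]
  rw [← sum_mul_bern_eq_permMean_add_proj, ← integral_relPerm_update H b, ← hmp.map_eq]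
  exact (integral_map hmp.measurable.aemeasurable hmeas.aestronglyMeasurable).symm

lemma integral_proj_piecewise (hf : IsSpread σ f) (a b : Fin r) (U : ι → ℝ) :
    ∫ V, proj H ((otherVertices σ f b).piecewise V U (f a),
        (otherVertices σ f b).piecewise V U (σ (f a))) ∂unifPi ι =
      if a = b then proj H (U (f b), U (σ (f b))) else 0 := by
  obtain ⟨C, hC⟩ := exists_isDegenerate_proj H
  obtain rfl | hab := eq_or_ne a b
  · have hsource : f a ∉ otherVertices σ f a := by simp [hf.apply_mem_otherVertices_iff]
    have htarget : σ (f a) ∉ otherVertices σ f a := by simp [hf.perm_apply_mem_otherVertices_iff]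
    simp [hsource, htarget]
  · simp only [Finset.piecewise_eq_of_mem _ _ _ (hf.apply_mem_otherVertices_iff.2 hab),
      Finset.piecewise_eq_of_mem _ _ _ (hf.perm_apply_mem_otherVertices_iff.2 hab), if_neg hab]
    rw [integral_pair_unifPi hC.measurable (hf.apply_ne a a), integral_proj]

lemma integral_remainder_piecewise (hf : IsSpread σ f) (b : Fin r) (U : ι → ℝ) :
    ∫ V, remainder σ H f ((otherVertices σ f b).piecewise V U) ∂unifPi ι = 0 := by
  obtain ⟨C, hC⟩ := exists_isDegenerate_proj H
  have hpiecewise : Measurable fun V : ι → ℝ => (otherVertices σ f b).piecewise V U :=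
    (measurePreserving_piecewise_pi (fun _ => unif) _).measurable.comp
      (measurable_const.prodMk measurable_id)
  have hpattern : Integrable
      (fun V => H (arcPattern σ f ((otherVertices σ f b).piecewise V U))) (unifPi ι) :=
    Integrable.of_bound (((measurable_of_countable H).comp (measurable_arcPattern σ f)).comp
      hpiecewise).aestronglyMeasurable _ (ae_of_all _ fun V => abs_le_sum_abs H _)
  have hproj : ∀ a, Integrable (fun V => proj H ((otherVertices σ f b).piecewise V U (f a),
      (otherVertices σ f b).piecewise V U (σ (f a)))) (unifPi ι) := fun a =>
    Integrable.of_bound ((hC.measurable_comp_pair (f a) (σ (f a))).comp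
      hpiecewise).aestronglyMeasurable C (ae_of_all _ fun V => hC.bound _)
  simp only [remainder]
  have hcentered : Integrable (fun V =>
      H (arcPattern σ f ((otherVertices σ f b).piecewise V U)) - permMean H) (unifPi ι) :=
    hpattern.sub (integrable_const _)
  rw [integral_sub hcentered (integrable_finsetSum _ fun a _ => hproj a),
    integral_sub hpattern (integrable_const _), integral_finsetSum _ fun a _ => hproj a,
    integral_arcPattern_piecewise hf]
  simp [integral_proj_piecewise hf]

lemma remainder_piecewise_eq {b : Fin r} (h : ∀ a, a ≠ b → f' a ∉ tupleNbhd σ f) (U V : ι → ℝ) :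
    remainder σ H f ((otherVertices σ f' b).piecewise V U) = remainder σ H f U := by
  have hnear : ∀ a c, c ≠ b → f' c ∉ nbhd σ (f a) := fun a c hc hmem =>
    h c hc (Finset.mem_biUnion.2 ⟨a, Finset.mem_univ _, hmem⟩)
  have hsource : ∀ a, f a ∉ otherVertices σ f' b := fun a hmem => by
    obtain ⟨c, hc, hac | hac⟩ := mem_otherVertices.1 hmem
    · exact hnear a c hc (by simp [nbhd, hac])
    · exact hnear a c hc (by simp [nbhd, hac])
  have htarget : ∀ a, σ (f a) ∉ otherVertices σ f' b := fun a hmem => by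
    obtain ⟨c, hc, hac | hac⟩ := mem_otherVertices.1 hmem
    · exact hnear a c hc (by simp [nbhd, hac])
    · exact hnear a c hc (by simp [nbhd, σ.injective hac])
  simp only [remainder, arcPattern, Finset.piecewise_eq_of_notMem _ _ _ (hsource _),
    Finset.piecewise_eq_of_notMem _ _ _ (htarget _)]

lemma integral_remainder_mul_remainder (hf' : IsSpread σ f') (h : ¬TwiceNear σ f f') :
    ∫ U, remainder σ H f U * remainder σ H f' U ∂unifPi ι = 0 := by
  obtain ⟨C, hC⟩ := exists_isDegenerate_proj H
  have hbound : ∀ f U, |remainder σ H f U| ≤ 2 * ∑ π, |H π| + r * C :=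
    abs_remainder_le (abs_le_sum_abs H) hC
  simp only [TwiceNear, not_forall, not_exists, not_and] at h
  obtain ⟨b, hb⟩ := h
  refine integral_mul_eq_zero_of_integral_piecewise_eq_zero (fun _ => unif) (otherVertices σ f' b)
    (fun U V => remainder_piecewise_eq hb U V) ?_
    (ae_of_all _ fun U => integral_remainder_piecewise hf' b U)
  refine Integrable.of_bound
    ((measurable_remainder f).mul (measurable_remainder f')).aestronglyMeasurable
    ((2 * ∑ π, |H π| + r * C) * (2 * ∑ π, |H π| + r * C)) (ae_of_all _ fun U => ?_)
  rw [norm_mul]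
  exact mul_le_mul (hbound f U) (hbound f' U) (norm_nonneg _) ((abs_nonneg _).trans (hbound f U))

lemma integral_sq_sum_remainder_mul_le [NeZero r] (hB : ∀ π, |H π| ≤ B)
    (hC : IsDegenerate (proj H) C) :
    (∫ U, (∑ f : Fin r → ι with IsSpread σ f, remainder σ H f U) ^ 2 ∂unifPi ι) *
        (Fintype.card ι : ℝ) ^ 2 ≤
      (3 * r ^ 2 * (2 * B + r * C) * (Fintype.card ι : ℝ) ^ r) ^ 2 := by
  set N : ℝ := (Fintype.card ι : ℝ)
  have hcard : ∀ f : Fin r → ι,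
      (#{f' ∈ {f' | IsSpread σ f'} | TwiceNear σ f f'} : ℝ) * N ^ 2 ≤ 9 * r ^ 4 * N ^ r :=
      fun f => by
    have hle := card_twiceNear_mul_le (σ := σ) f
    rw [Fintype.card_fin] at hle
    have hsub : #{f' ∈ {f' | IsSpread σ f'} | TwiceNear σ f f'} ≤ #{f' | TwiceNear σ f f'} :=
      Finset.card_le_card (Finset.filter_subset_filter _ (Finset.filter_subset _ _))
    have hmul := (Nat.mul_le_mul_right (Fintype.card ι ^ 2) hsub).trans hle
    simp only [N]
    exact_mod_cast hmul
  calc _ ≤ ((2 * B + r * C) ^ 2 * ∑ f : Fin r → ι with IsSpread σ f,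
        (#{f' ∈ {f' | IsSpread σ f'} | TwiceNear σ f f'} : ℝ)) * N ^ 2 := by
        refine mul_le_mul_of_nonneg_right (integral_sq_sum_le _ (fun f _ => measurable_remainder f)
          (fun f _ => abs_remainder_le hB hC f) fun f _ f' hf' hff' => ?_) (by positivity)
        exact integral_remainder_mul_remainder (Finset.mem_filter.1 hf').2 hff'
    _ = (2 * B + r * C) ^ 2 * ∑ f : Fin r → ι with IsSpread σ f,
        (#{f' ∈ {f' | IsSpread σ f'} | TwiceNear σ f f'} : ℝ) * N ^ 2 := by
        rw [mul_assoc, Finset.sum_mul]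
    _ ≤ (2 * B + r * C) ^ 2 * ∑ f : Fin r → ι, 9 * r ^ 4 * N ^ r := by
        gcongr
        refine (Finset.sum_le_sum fun f _ => hcard f).trans ?_
        exact Finset.sum_le_sum_of_subset_of_nonneg (Finset.filter_subset _ _)
          fun _ _ _ => by positivity
    _ = _ := by
        simp only [Finset.sum_const, Finset.card_univ, Fintype.card_pi_const, nsmul_eq_mul,
          Nat.cast_pow, N]
        ring

lemma measurable_sum_remainder :
    Measurable fun U => ∑ f : Fin r → ι with IsSpread σ f, remainder σ H f U :=
  Finset.measurable_fun_sum _ fun f _ => measurable_remainder f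

lemma integral_abs_sum_remainder_mul_le [NeZero r] (hB : ∀ π, |H π| ≤ B)
    (hC : IsDegenerate (proj H) C) :
    (∫ U, |∑ f : Fin r → ι with IsSpread σ f, remainder σ H f U| ∂unifPi ι) * Fintype.card ι ≤
      3 * r ^ 2 * (2 * B + r * C) * (Fintype.card ι : ℝ) ^ r := by
  have hB0 : 0 ≤ B := (abs_nonneg _).trans (hB 1)
  have hC0 := hC.bound_nonneg
  have hmem : MemLp (fun U => ∑ f : Fin r → ι with IsSpread σ f, remainder σ H f U) 2
      (unifPi ι) := by
    refine MemLp.of_bound measurable_sum_remainder.aestronglyMeasurable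
      (#{f : Fin r → ι | IsSpread σ f} • (2 * B + r * C)) (ae_of_all _ fun U => ?_)
    exact (Finset.abs_sum_le_sum_abs _ _).trans
      (Finset.sum_le_card_nsmul _ _ _ fun f _ => abs_remainder_le hB hC f U)
  calc _ ≤ √(∫ U, (∑ f : Fin r → ι with IsSpread σ f, remainder σ H f U) ^ 2 ∂unifPi ι) *
        √((Fintype.card ι : ℝ) ^ 2) := by
        rw [Real.sqrt_sq (Nat.cast_nonneg _)]
        exact mul_le_mul_of_nonneg_right (integral_abs_le_sqrt_integral_sq hmem)
          (Nat.cast_nonneg _)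
    _ ≤ √((3 * r ^ 2 * (2 * B + r * C) * (Fintype.card ι : ℝ) ^ r) ^ 2) := by
        rw [← Real.sqrt_mul' _ (by positivity)]
        exact Real.sqrt_le_sqrt (integral_sq_sum_remainder_mul_le hB hC)
    _ = _ := Real.sqrt_sq (by positivity)

end Remainder

section Decomposition

variable {r : ℕ} {ι : Type*} [Fintype ι] [DecidableEq ι] {σ : Perm ι} {H : Perm (Fin r) → ℝ}
  {B C : ℝ}

lemma sum_arcPattern_sub_eq (σ : Perm ι) (H : Perm (Fin r) → ℝ) (U : ι → ℝ) :
    ∑ f : Fin r → ι with Injective f, (H (arcPattern σ f U) - permMean H) =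
      ∑ f : Fin r → ι with IsSpread σ f, remainder σ H f U +
        ∑ f : Fin r → ι, ∑ a, proj H (U (f a), U (σ (f a))) +
        ∑ f : Fin r → ι with ¬IsSpread σ f, ((if Injective f then H (arcPattern σ f U) - permMean H
          else 0) - ∑ a, proj H (U (f a), U (σ (f a)))) := by
  have hspread : ∑ f : Fin r → ι with IsSpread σ f, remainder σ H f U =
      ∑ f : Fin r → ι with IsSpread σ f, ((if Injective f then H (arcPattern σ f U) - permMean H
        else 0) - ∑ a, proj H (U (f a), U (σ (f a)))) :=
    Finset.sum_congr rfl fun f hf => by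
      rw [if_pos (Finset.mem_filter.1 hf).2.injective, remainder]
  rw [hspread, add_right_comm, Finset.sum_filter_add_sum_filter_not, ← Finset.sum_add_distrib,
    Finset.sum_filter]
  simp only [sub_add_cancel]

lemma abs_sum_not_isSpread_mul_le (hB : ∀ π, |H π| ≤ B) (hC : IsDegenerate (proj H) C)
    (U : ι → ℝ) :
    |∑ f : Fin r → ι with ¬IsSpread σ f, ((if Injective f then H (arcPattern σ f U) - permMean H
        else 0) - ∑ a, proj H (U (f a), U (σ (f a))))| * Fintype.card ι ≤
      (2 * r ^ 2 + r * σ.partition.parts.count 1) * (2 * B + r * C) *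
        (Fintype.card ι : ℝ) ^ r := by
  have hB0 : 0 ≤ B := (abs_nonneg _).trans (hB 1)
  have hC0 := hC.bound_nonneg
  have hterm : ∀ f : Fin r → ι, |(if Injective f then H (arcPattern σ f U) - permMean H else 0) -
      ∑ a, proj H (U (f a), U (σ (f a)))| ≤ 2 * B + r * C := fun f => by
    refine (abs_sub _ _).trans (add_le_add ?_ (abs_sum_proj_le hC f U))
    split_ifs
    · exact abs_sub_permMean_le hB _
    · rw [abs_zero]
      positivity
  have hcard : (#{f : Fin r → ι | ¬IsSpread σ f} : ℝ) * Fintype.card ι ≤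
      (2 * r ^ 2 + r * σ.partition.parts.count 1) * (Fintype.card ι : ℝ) ^ r := by
    have hle := card_not_isSpread_mul_le (σ := σ) (κ := Fin r)
    rw [Fintype.card_fin] at hle
    exact_mod_cast hle
  calc _ ≤ #{f : Fin r → ι | ¬IsSpread σ f} • (2 * B + r * C) * (Fintype.card ι : ℝ) :=
        mul_le_mul_of_nonneg_right ((Finset.abs_sum_le_sum_abs _ _).trans
          (Finset.sum_le_card_nsmul _ _ _ fun f _ => hterm f)) (Nat.cast_nonneg _)
    _ = #{f : Fin r → ι | ¬IsSpread σ f} * (Fintype.card ι : ℝ) * (2 * B + r * C) := by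
        rw [nsmul_eq_mul, mul_right_comm]
    _ ≤ (2 * r ^ 2 + r * σ.partition.parts.count 1) * (Fintype.card ι : ℝ) ^ r *
        (2 * B + r * C) := mul_le_mul_of_nonneg_right hcard (by positivity)
    _ = _ := mul_right_comm _ _ _

lemma IsDegenerate.abs_sum_sub_sum_edge_le {g : ℝ × ℝ → ℝ} (hg : IsDegenerate g C) (σ : Perm ι)
    (U : ι → ℝ) :
    |∑ i, g (U i, U (σ i)) - ∑ i, edge σ g i U| ≤ σ.partition.parts.count 1 * C := by
  have hloop : ∀ i, g (U i, U (σ i)) - edge σ g i U = if σ i = i then g (U i, U (σ i)) else 0 :=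
    fun i => by
      rw [edge]
      split_ifs
      · exact sub_zero _
      · exact sub_self _
  rw [← Finset.sum_sub_distrib, Finset.sum_congr rfl fun i _ => hloop i, ← Finset.sum_filter,
    count_one_partition, ← nsmul_eq_mul]
  exact (Finset.abs_sum_le_sum_abs _ _).trans
    (Finset.sum_le_card_nsmul _ _ _ fun i _ => hg.bound _)

lemma abs_sum_arcPattern_sub_le (hB : ∀ π, |H π| ≤ B) (hC : IsDegenerate (proj H) C)
    (U : ι → ℝ) :
    |(∑ f : Fin r → ι with Injective f, (H (arcPattern σ f U) - permMean H) -
        ∑ f : Fin r → ι with IsSpread σ f, remainder σ H f U) * Fintype.card ι -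
        r * (Fintype.card ι : ℝ) ^ r * ∑ i, edge σ (proj H) i U| ≤
      ((2 * r ^ 2 + r * σ.partition.parts.count 1) * (2 * B + r * C) +
        r * σ.partition.parts.count 1 * C) * (Fintype.card ι : ℝ) ^ r := by
  set N : ℝ := (Fintype.card ι : ℝ)
  set defect := ∑ f : Fin r → ι with ¬IsSpread σ f, ((if Injective f then
    H (arcPattern σ f U) - permMean H else 0) - ∑ a, proj H (U (f a), U (σ (f a))))
  have hdefect : |defect| * N ≤ _ := abs_sum_not_isSpread_mul_le hB hC U
  have hproj : (∑ f : Fin r → ι, ∑ a, proj H (U (f a), U (σ (f a)))) * N =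
      r * N ^ r * ∑ i, proj H (U i, U (σ i)) := by
    simpa only [Fintype.card_fin] using
      sum_sum_apply_mul (κ := Fin r) fun i => proj H (U i, U (σ i))
  have hsplit : (∑ f : Fin r → ι with Injective f, (H (arcPattern σ f U) - permMean H) -
      ∑ f : Fin r → ι with IsSpread σ f, remainder σ H f U) * N -
        r * N ^ r * ∑ i, edge σ (proj H) i U =
      r * N ^ r * (∑ i, proj H (U i, U (σ i)) - ∑ i, edge σ (proj H) i U) + defect * N := by
    rw [sum_arcPattern_sub_eq]
    linear_combination hproj
  calc _ ≤ r * N ^ r * |∑ i, proj H (U i, U (σ i)) - ∑ i, edge σ (proj H) i U| +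
        |defect| * N := by
        rw [hsplit]
        refine (abs_add_le _ _).trans_eq ?_
        rw [abs_mul, abs_mul defect, abs_of_nonneg (by positivity : 0 ≤ r * N ^ r),
          abs_of_nonneg (by positivity : 0 ≤ N)]
    _ ≤ r * N ^ r * (σ.partition.parts.count 1 * C) +
        (2 * r ^ 2 + r * σ.partition.parts.count 1) * (2 * B + r * C) * N ^ r := by
        gcongr
        exact hC.abs_sum_sub_sum_edge_le σ U
    _ = _ := by ring

end Decomposition

section Fluctuations

variable {ι : Type*} {g : ℝ × ℝ → ℝ} {C : ℝ}

lemma edge_const_mul [DecidableEq ι] (σ : Perm ι) (c : ℝ) (g : ℝ × ℝ → ℝ) (i : ι) (U : ι → ℝ) :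
    edge σ (fun z => c * g z) i U = c * edge σ g i U := by
  simp only [edge, mul_ite, mul_zero]

lemma IsDegenerate.const_mul (hg : IsDegenerate g C) (c : ℝ) :
    IsDegenerate (fun z => c * g z) (|c| * C) where
  measurable := hg.measurable.const_mul c
  bound z := by
    rw [abs_mul]
    exact mul_le_mul_of_nonneg_left (hg.bound z) (abs_nonneg c)
  integral_snd x := by rw [integral_const_mul, hg.integral_snd, mul_zero]
  integral_fst y := by rw [integral_const_mul, hg.integral_fst, mul_zero]

lemma IsDegenerate.tendsto_sum_integral_increment_sq_div (hg : IsDegenerate g C) {p : ℝ}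
    {σ : (n : ℕ) → Perm (Fin n)}
    (hfixed : (fun n => ((σ n).partition.parts.count 1 : ℝ)) =o[atTop] fun n : ℕ => (n : ℝ))
    (htwo : (fun n => 2 * ((σ n).partition.parts.count 2 : ℝ) - n * p) =o[atTop]
      fun n : ℕ => (n : ℝ)) :
    Tendsto (fun n => (∑ j, ∫ U, increment (σ n) g j U ^ 2 ∂unifPi (Fin n)) / n) atTop
      (𝓝 (∫ z, g z * g z ∂unifSq + p * ∫ z, g z * g z.swap ∂unifSq)) := by
  have hlim := ((hfixed.tendsto_div_nhds_zero.const_sub 1).mul_const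
    (∫ z, g z * g z ∂unifSq)).add ((htwo.tendsto_div_nhds_zero.add_const p).mul_const
      (∫ z, g z * g z.swap ∂unifSq))
  rw [sub_zero, one_mul, zero_add] at hlim
  refine hlim.congr' ?_
  filter_upwards [eventually_ne_atTop 0] with n hn
  have hn0 : (n : ℝ) ≠ 0 := mod_cast hn
  have hcard : (Fintype.card (Fin n) : ℝ) = n := congrArg _ (Fintype.card_fin n)
  rw [hg.sum_integral_increment_sq, hcard]
  field_simp
  ring

lemma norm_exp_mul_I_sub_le (a b : ℝ) :
    ‖Complex.exp (a * Complex.I) - Complex.exp (b * Complex.I)‖ ≤ |a - b| := by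
  have hfactor : Complex.exp (a * Complex.I) - Complex.exp (b * Complex.I) =
      Complex.exp (b * Complex.I) * (Complex.exp (Complex.I * ((a - b : ℝ) : ℂ)) - 1) := by
    rw [mul_sub, ← Complex.exp_add, mul_one, Complex.ofReal_sub]
    congr 2
    ring
  rw [hfactor, norm_mul, Complex.norm_exp_ofReal_mul_I, one_mul]
  exact Real.norm_exp_I_mul_ofReal_sub_one_le

lemma integrable_exp_mul_I {Ω : Type*} [MeasurableSpace Ω] {μ : Measure Ω} [IsFiniteMeasure μ]
    {X : Ω → ℝ} (hX : Measurable X) : Integrable (fun ω => Complex.exp (X ω * Complex.I)) μ :=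
  Integrable.of_bound ((Complex.measurable_ofReal.comp hX).mul_const _).cexp.aestronglyMeasurable 1
    (ae_of_all _ fun _ => (Complex.norm_exp_ofReal_mul_I _).le)

variable {n r : ℕ} {σ : Perm (Fin n)} {H : Perm (Fin r) → ℝ} {B : ℝ}

/-- The linear combination with coefficients `H` of the rescaled pattern counts of the permutation
obtained by relabelling `σ` according to the relative order of the points `U`. -/
noncomputable def normalizedComb (σ : Perm (Fin n)) (H : Perm (Fin r) → ℝ) (U : Fin n → ℝ) : ℝ :=
  ∑ π, H π * (((patternCount π (st U * σ * (st U)⁻¹) : ℝ) - (n.choose r : ℝ) / (r.factorial : ℝ)) /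
    (n : ℝ) ^ ((r : ℝ) - 1 / 2))

/-- The function whose sum over the arcs, divided by `√n`, approximates `normalizedComb`. -/
noncomputable def limitKernel (H : Perm (Fin r) → ℝ) (z : ℝ × ℝ) : ℝ :=
  1 / (r - 1).factorial * proj H z

lemma measurable_normalizedComb : Measurable (normalizedComb σ H) :=
  (Measurable.of_discrete (f := fun α : Perm (Fin n) => ∑ π, H π *
    (((patternCount π (α * σ * α⁻¹) : ℝ) - (n.choose r : ℝ) / (r.factorial : ℝ)) /
      (n : ℝ) ^ ((r : ℝ) - 1 / 2)))).comp measurable_st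

lemma normalizedComb_sub_sum_edge_eq [NeZero r] (hn : 0 < n) {U : Fin n → ℝ} (hU : Injective U) :
    normalizedComb σ H U - 1 / √n * ∑ i, edge σ (limitKernel H) i U =
      ((∑ f : Fin r → Fin n with Injective f, (H (arcPattern σ f U) - permMean H)) * n -
        r * (n : ℝ) ^ r * ∑ i, edge σ (proj H) i U) / (r.factorial * (n : ℝ) ^ r * √n) := by
  have hn' : (0 : ℝ) < n := mod_cast hn
  have _ : 0 < √(n : ℝ) := Real.sqrt_pos.2 hn'
  have hpow : (n : ℝ) ^ ((r : ℝ) - 1 / 2) = (n : ℝ) ^ r / √n := by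
    rw [Real.rpow_sub hn', Real.rpow_natCast, Real.sqrt_eq_rpow]
  have hfactorial : (r.factorial : ℝ) = r * (r - 1).factorial :=
    mod_cast (Nat.mul_factorial_pred (NeZero.ne r)).symm
  have hr : (r : ℝ) ≠ 0 := NeZero.ne _
  have hcomb : normalizedComb σ H U = (∑ π, H π * ((patternCount π (st U * σ * (st U)⁻¹) : ℝ) -
      (n.choose r : ℝ) / (r.factorial : ℝ))) * √n / (n : ℝ) ^ r := by
    rw [normalizedComb, Finset.sum_mul, Finset.sum_div]
    exact Finset.sum_congr rfl fun π _ => by rw [hpow]; field_simp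
  have hedge : ∑ i, edge σ (limitKernel H) i U =
      1 / (r - 1).factorial * ∑ i, edge σ (proj H) i U := by
    rw [Finset.mul_sum]
    exact Finset.sum_congr rfl fun i _ => edge_const_mul _ _ _ _ _
  rw [← sum_mul_patternCount_conj_sub hU, hcomb, hedge, hfactorial]
  generalize ∑ π, H π * _ = X
  field_simp
  rw [Real.sq_sqrt hn'.le]
  ring

lemma abs_normalizedComb_sub_le [NeZero r] (hn : 0 < n) (hB : ∀ π, |H π| ≤ B)
    (hC : IsDegenerate (proj H) C) {U : Fin n → ℝ} (hU : Injective U) :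
    |normalizedComb σ H U - 1 / √n * ∑ i, edge σ (limitKernel H) i U| ≤
      ((2 * r ^ 2 + r * σ.partition.parts.count 1) * (2 * B + r * C) +
        r * σ.partition.parts.count 1 * C) / √n +
      |∑ f : Fin r → Fin n with IsSpread σ f, remainder σ H f U| * n / ((n : ℝ) ^ r * √n) := by
  set bound := (2 * r ^ 2 + r * σ.partition.parts.count 1) * (2 * B + r * C) +
    r * σ.partition.parts.count 1 * C
  set R := ∑ f : Fin r → Fin n with IsSpread σ f, remainder σ H f U
  have hn' : (0 : ℝ) < n := mod_cast hn
  have _ : 0 < √(n : ℝ) := Real.sqrt_pos.2 hn'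
  have hfactorial : (1 : ℝ) ≤ r.factorial := mod_cast r.factorial_pos
  have hmain := abs_sum_arcPattern_sub_le (σ := σ) hB hC U
  have hcard : (Fintype.card (Fin n) : ℝ) = n := congrArg _ (Fintype.card_fin n)
  rw [hcard, sub_mul, sub_right_comm] at hmain
  have hle := (abs_sub_abs_le_abs_sub _ _).trans hmain
  rw [abs_mul, Nat.abs_cast, sub_le_iff_le_add] at hle
  rw [normalizedComb_sub_sum_edge_eq hn hU, abs_div,
    abs_of_pos (by positivity : 0 < r.factorial * (n : ℝ) ^ r * √n)]
  calc _ ≤ (bound * (n : ℝ) ^ r + |R| * n) / ((n : ℝ) ^ r * √n) := by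
        refine div_le_div₀ ((abs_nonneg _).trans hle) hle (by positivity) ?_
        rw [mul_assoc]
        exact le_mul_of_one_le_left (by positivity) hfactorial
    _ = _ := by
        field_simp

lemma norm_integral_exp_normalizedComb_sub_le [NeZero r] (hn : 0 < n) (hB : ∀ π, |H π| ≤ B)
    (hC : IsDegenerate (proj H) C) :
    ‖∫ U, Complex.exp (normalizedComb σ H U * Complex.I) ∂unifPi (Fin n) -
        ∫ U, Complex.exp ((1 / √n * ∑ i, edge σ (limitKernel H) i U : ℝ) * Complex.I)
          ∂unifPi (Fin n)‖ ≤
      (5 * r ^ 2 * (2 * B + r * C) + r * (2 * B + r * C + C) * σ.partition.parts.count 1) / √n := by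
  have hn' : (0 : ℝ) < n := mod_cast hn
  have _ : 0 < √(n : ℝ) := Real.sqrt_pos.2 hn'
  set bound := (2 * r ^ 2 + r * σ.partition.parts.count 1) * (2 * B + r * C) +
    r * σ.partition.parts.count 1 * C with hbound
  set R : (Fin n → ℝ) → ℝ := fun U => ∑ f : Fin r → Fin n with IsSpread σ f, remainder σ H f U
  have hkernel : IsDegenerate (limitKernel H) (|1 / ((r - 1).factorial : ℝ)| * C) := hC.const_mul _
  have hedge : Measurable fun U => 1 / √n * ∑ i, edge σ (limitKernel H) i U :=
    (Finset.measurable_fun_sum _ fun i _ => hkernel.measurable_edge i).const_mul _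
  have hR : Integrable (fun U => |R U|) (unifPi (Fin n)) := by
    refine (Integrable.of_bound measurable_sum_remainder.aestronglyMeasurable
      (#{f : Fin r → Fin n | IsSpread σ f} • (2 * B + r * C)) (ae_of_all _ fun U => ?_)).abs
    exact (Finset.abs_sum_le_sum_abs _ _).trans
      (Finset.sum_le_card_nsmul _ _ _ fun f _ => abs_remainder_le hB hC f U)
  have hpointwise : ∀ᵐ U ∂unifPi (Fin n), ‖Complex.exp (normalizedComb σ H U * Complex.I) -
      Complex.exp ((1 / √n * ∑ i, edge σ (limitKernel H) i U : ℝ) * Complex.I)‖ ≤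
        bound / √n + |R U| * (n / ((n : ℝ) ^ r * √n)) := by
    filter_upwards [ae_injective_unifPi] with U hU
    rw [← mul_div_assoc]
    exact (norm_exp_mul_I_sub_le _ _).trans (abs_normalizedComb_sub_le hn hB hC hU)
  rw [← integral_sub (integrable_exp_mul_I measurable_normalizedComb) (integrable_exp_mul_I hedge)]
  calc _ ≤ ∫ U, bound / √n + |R U| * (n / ((n : ℝ) ^ r * √n)) ∂unifPi (Fin n) :=
        norm_integral_le_of_norm_le ((integrable_const _).add (hR.mul_const _)) hpointwise
    _ = bound / √n + (∫ U, |R U| ∂unifPi (Fin n)) * n / ((n : ℝ) ^ r * √n) := by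
        rw [integral_add (integrable_const _) (hR.mul_const _), integral_mul_const, integral_const,
          probReal_univ, one_smul, mul_div_assoc]
    _ ≤ bound / √n + 3 * r ^ 2 * (2 * B + r * C) * (n : ℝ) ^ r / ((n : ℝ) ^ r * √n) := by
        have hle := integral_abs_sum_remainder_mul_le (σ := σ) hB hC
        rw [Fintype.card_fin] at hle
        gcongr
    _ = _ := by
        rw [hbound]
        field_simp
        ring

lemma integral_limitKernel_mul_self : ∫ z, limitKernel H z * limitKernel H z ∂unifSq =
    gram r (centeredComb r H) (centeredComb r H) / ((r - 1).factorial : ℝ) ^ 4 := by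
  rw [gram_apply, ← integral_div]
  congr 1 with z
  simp only [limitKernel, proj]
  field_simp

lemma integral_limitKernel_mul_swap : ∫ z, limitKernel H z * limitKernel H z.swap ∂unifSq =
    gram r (centeredComb r H) (centeredComb r H).transpose / ((r - 1).factorial : ℝ) ^ 4 := by
  rw [gram_apply, ← integral_div]
  congr 1 with z
  simp only [limitKernel, proj, bernForm_swap]
  field_simp

lemma dotProduct_sigma_mulVec_self_eq_integral [NeZero r] (p : ℝ) (H : Perm (Fin r) → ℝ) :
    dotProduct H ((sigma r p).mulVec H) = ∫ z, limitKernel H z * limitKernel H z ∂unifSq +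
      p * ∫ z, limitKernel H z * limitKernel H z.swap ∂unifSq := by
  rw [dotProduct_sigma_mulVec_self, twistedVar, integral_limitKernel_mul_self,
    integral_limitKernel_mul_swap]
  ring

lemma charFun_map_normalizedCounts {t : n.Partition}
    (hσ : σ.partition.parts = t.parts) (s : EuclideanSpace ℝ (Perm (Fin r))) :
    charFun ((uniformCyclic t).map (normalizedCounts r)) s =
      ∫ U, Complex.exp (normalizedComb σ (fun π => s π) U * Complex.I) ∂unifPi (Fin n) := by
  have hmp := measurePreserving_conj_st hσ
  rw [charFun_apply, integral_map Measurable.of_discrete.aemeasurable (by fun_prop), ← hmp.map_eq,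
    integral_map hmp.measurable.aemeasurable Measurable.of_discrete.aestronglyMeasurable]
  simp only [normalizedCounts, PiLp.inner_apply, normalizedComb, RCLike.inner_apply, conj_trivial]

end Fluctuations

section Convergence

lemma isBigO_sqrt_natCast :
    (fun n : ℕ => √(n : ℝ)) =O[atTop] fun n : ℕ => (n : ℝ) :=
  Asymptotics.isBigO_of_le _ fun n => by
    rw [Real.norm_of_nonneg (Real.sqrt_nonneg _), Real.norm_of_nonneg (Nat.cast_nonneg n)]
    exact Real.sqrt_le_iff.2 ⟨Nat.cast_nonneg n, mod_cast Nat.le_self_pow two_ne_zero n⟩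

variable {r : ℕ} [NeZero r] {p : ℝ}

lemma tendsto_integral_exp_normalizedComb (hp : p ∈ Set.Icc (-1 : ℝ) 1) (H : Perm (Fin r) → ℝ)
    {σ : (n : ℕ) → Perm (Fin n)}
    (hfixed : (fun n => ((σ n).partition.parts.count 1 : ℝ)) =o[atTop] fun n : ℕ => √(n : ℝ))
    (htwo : (fun n => 2 * ((σ n).partition.parts.count 2 : ℝ) - n * p) =o[atTop]
      fun n : ℕ => (n : ℝ)) :
    Tendsto (fun n => ∫ U, Complex.exp (normalizedComb (σ n) H U * Complex.I) ∂unifPi (Fin n)) atTop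
      (𝓝 ((Real.exp (-(dotProduct H ((sigma r p).mulVec H) / 2)) : ℝ) : ℂ)) := by
  obtain ⟨C, hC⟩ := exists_isDegenerate_proj H
  obtain ⟨C', hC'⟩ : ∃ C', IsDegenerate (limitKernel H) C' := ⟨_, hC.const_mul _⟩
  have hvar := hC'.tendsto_sum_integral_increment_sq_div (hfixed.trans_isBigO isBigO_sqrt_natCast)
    htwo
  rw [← dotProduct_sigma_mulVec_self_eq_integral] at hvar
  have hnonneg : 0 ≤ dotProduct H ((sigma r p).mulVec H) := by
    rw [dotProduct_sigma_mulVec_self]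
    exact div_nonneg (twistedVar_nonneg hp _) (by positivity)
  set v := dotProduct H ((sigma r p).mulVec H)
  set B := ∑ π, |H π|
  set K := max v (4 * C' ^ 2)
  have hsqrt : Tendsto (fun n : ℕ => √(n : ℝ)) atTop atTop :=
    Real.tendsto_sqrt_atTop.comp tendsto_natCast_atTop_atTop
  have hlim := ((hsqrt.const_div_atTop (5 * r ^ 2 * (2 * B + r * C))).add
    (hfixed.tendsto_div_nhds_zero.const_mul (r * (2 * B + r * C + C)))).add
      (((hsqrt.const_div_atTop (12 * C' ^ 2 + 16 * C' ^ 3)).add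
        (tendsto_iff_norm_sub_tendsto_zero.1 hvar)).const_mul (Real.exp K))
  simp only [mul_zero, add_zero] at hlim
  rw [tendsto_iff_norm_sub_tendsto_zero]
  refine squeeze_zero' (Eventually.of_forall fun _ => norm_nonneg _) ?_ hlim
  filter_upwards [eventually_gt_atTop 0, hsqrt.eventually_ge_atTop (4 * C')] with n hn hnC
  have : Nonempty (Fin n) := Fin.pos_iff_nonempty.1 hn
  have hgauss := hC'.norm_integral_exp_sum_edge_sub_le (σ := σ n) (by rwa [Fintype.card_fin])
    ⟨hnonneg, le_max_left v (4 * C' ^ 2)⟩ (le_max_right _ _)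
  rw [Fintype.card_fin] at hgauss
  rw [← mul_div_assoc, ← add_div]
  exact (norm_sub_le_norm_sub_add_norm_sub _ _ _).trans (add_le_add
    (norm_integral_exp_normalizedComb_sub_le hn (abs_le_sum_abs H) hC) hgauss)

theorem tendstoInDistribution_normalizedCounts (hp : p ∈ Set.Icc (-1 : ℝ) 1)
    {t : (n : ℕ) → n.Partition}
    (hfixed : (fun n => ((t n).parts.count 1 : ℝ)) =o[atTop] fun n : ℕ => √(n : ℝ))
    (htwo : (fun n => 2 * ((t n).parts.count 2 : ℝ) - n * p) =o[atTop] fun n : ℕ => (n : ℝ))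
    {Ω : ℕ → Type*} [∀ n, MeasurableSpace (Ω n)] {P : (n : ℕ) → Measure (Ω n)}
    [∀ n, IsProbabilityMeasure (P n)] {τ : (n : ℕ) → Ω n → Perm (Fin n)}
    (hτ : ∀ n, HasLaw (τ n) (uniformCyclic (t n)) (P n)) :
    TendstoInDistribution (fun n ω => normalizedCounts r (τ n ω)) atTop id P
      (multivariateGaussian 0 (sigma r p)) := by
  choose σ hσ using fun n => exists_perm_partition_parts_eq (t n)
  have hmeas : ∀ n, Measurable (normalizedCounts r : Perm (Fin n) → _) := fun n => .of_discrete
  have hlaw : ∀ n, (P n).map (fun ω => normalizedCounts r (τ n ω)) =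
      (uniformCyclic (t n)).map (normalizedCounts r) := fun n => by
    rw [← (hτ n).map_eq, AEMeasurable.map_map_of_aemeasurable (hmeas n).aemeasurable
      (hτ n).aemeasurable]
    rfl
  refine ⟨fun n => (hmeas n).comp_aemeasurable (hτ n).aemeasurable, aemeasurable_id,
    ProbabilityMeasure.tendsto_iff_tendsto_charFun.2 fun s => ?_⟩
  simp only [ProbabilityMeasure.coe_mk, hlaw, Measure.map_id,
    charFun_multivariateGaussian (posSemidef_sigma hp)]
  simp only [fun n => charFun_map_normalizedCounts (hσ n) s]
  simp only [← hσ] at hfixed htwo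
  convert tendsto_integral_exp_normalizedComb hp (fun π => s π) hfixed htwo using 2
  rw [Complex.ofReal_exp]
  simp

end Convergence

end PatternCLT

open Filter Asymptotics MeasureTheory ProbabilityTheory in
theorem mainTheorem9_general (r : ℕ) (hr : 1 ≤ r) (p₂ : ℝ) (hp₂ : p₂ ∈ Set.Ioc (-1 : ℝ) 1) :
    (∀ (t : (n : ℕ) → n.Partition)
        (_ : (fun n => ((t n).parts.count 1 : ℝ)) =o[atTop] fun n : ℕ => √(n : ℝ))
        (_ : (fun n => 2 * ((t n).parts.count 2 : ℝ) - n * p₂) =o[atTop] fun n : ℕ => (n : ℝ))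
        (Ω : ℕ → Type*) [∀ n, MeasurableSpace (Ω n)] (P : (n : ℕ) → Measure (Ω n))
        [∀ n, IsProbabilityMeasure (P n)] (τ : (n : ℕ) → Ω n → Equiv.Perm (Fin n))
        (_ : ∀ n, HasLaw (τ n) (PatternCLT.uniformCyclic (t n)) (P n)),
        TendstoInDistribution (fun n ω => PatternCLT.normalizedCounts r (τ n ω)) atTop id P
          (multivariateGaussian 0 (PatternCLT.sigma r p₂))) ∧
      (PatternCLT.sigma r p₂).PosSemidef ∧
      (p₂ < 1 → (PatternCLT.sigma r p₂).rank = (r - 1) ^ 2) ∧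
      (p₂ = 1 → (PatternCLT.sigma r p₂).rank = r * (r - 1) / 2) ∧
      (2 ≤ r → ∀ π : Equiv.Perm (Fin r), 0 < PatternCLT.sigma r p₂ π π) := by
  have : NeZero r := ⟨by lia⟩
  have hp₂' : p₂ ∈ Set.Icc (-1 : ℝ) 1 := ⟨hp₂.1.le, hp₂.2⟩
  exact ⟨fun _ hfixed htwo _ _ _ _ _ hτ =>
      PatternCLT.tendstoInDistribution_normalizedCounts hp₂' hfixed htwo hτ,
    PatternCLT.posSemidef_sigma hp₂',
    fun h => PatternCLT.rank_sigma_of_sq_ne_one (by nlinarith [hp₂.1]),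
    fun h => h ▸ PatternCLT.rank_sigma_one,
    fun h π => PatternCLT.sigma_diag_pos hp₂ h π⟩

open Filter Asymptotics MeasureTheory ProbabilityTheory in
theorem mainTheorem9 (r : ℕ) (hr : 1 ≤ r) (p₂ : ℝ) (hp₂ : p₂ ∈ Set.Icc (0 : ℝ) 1) :
    (∀ (t : (n : ℕ) → n.Partition)
        (_ : (fun n => ((t n).parts.count 1 : ℝ)) =o[atTop] fun n : ℕ => √(n : ℝ))
        (_ : (fun n => 2 * ((t n).parts.count 2 : ℝ) - n * p₂) =o[atTop] fun n : ℕ => (n : ℝ))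
        (Ω : ℕ → Type*) [∀ n, MeasurableSpace (Ω n)] (P : (n : ℕ) → Measure (Ω n))
        [∀ n, IsProbabilityMeasure (P n)] (τ : (n : ℕ) → Ω n → Equiv.Perm (Fin n))
        (_ : ∀ n, HasLaw (τ n) (PatternCLT.uniformCyclic (t n)) (P n)),
        TendstoInDistribution (fun n ω => PatternCLT.normalizedCounts r (τ n ω)) atTop id P
          (multivariateGaussian 0 (PatternCLT.sigma r p₂))) ∧
      (PatternCLT.sigma r p₂).PosSemidef ∧
      (p₂ < 1 → (PatternCLT.sigma r p₂).rank = (r - 1) ^ 2) ∧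
      (p₂ = 1 → (PatternCLT.sigma r p₂).rank = r * (r - 1) / 2) ∧
      (2 ≤ r → ∀ π : Equiv.Perm (Fin r), 0 < PatternCLT.sigma r p₂ π π) :=
  mainTheorem9_general r hr p₂ ⟨by linarith [hp₂.1], hp₂.2⟩
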